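/- Let $(\Omega,\mathcal F,P)$ be a complete probability space carrying a standard Brownian motion $(B_r)_{0\le r\le 1}$ and an independent subordinator (nondecreasing Lévy process) $(L_r)_{0\le r\le 1}$, and let $\mathcal F_r$ be the $\sigma$-algebra generated by $B_v,L_v$ $(v\le r)$ and the $P$-null sets. Let $\sigma,b:\mathbb R\to\mathbb R$ be bounded and Lipschitz continuous, let $h:[0,\infty)\to[0,\infty)$ be continuous and non-decreasing, and put $g(x)=\int_0^x h(y)\,dy$. For $t\in[0,1]$ and $\varphi\ge 0$ let $\mathcal A_t(\varphi)$ be the set of $(\mathcal F_r)$-adapted processes $(\zeta_r)_{0\le r\le t}$ with values in $[0,\infty)$ that are left-continuous with right limits, are bounded on $[0,t]\times\Omega$, and satisfy $\int_0^t\zeta_r\,dr\le\varphi$ almost surely. Let $\mathcal A^{\mathrm{SO}}_t(\varphi)$ be the set of those $\zeta\in\mathcal A_t(\varphi)$ with $\int_0^t\zeta_r\,dr=\varphi$ almost surely. For $w\in\mathbb R$, $s\ge 0$ and $\zeta\in\mathcal A_t(\varphi)$ let $$dW_r=\zeta_rS_r\,dr,\qquad d\varphi_r=-\zeta_r\,dr,\qquad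 dX_r=\sigma(X_r)\,dB_r+b(X_r)\,dr-g(\zeta_r)\,dL_r,\qquad S_r=e^{X_r},$$ with $W_0=w$, $\varphi_0=\varphi$, $S_0=s$ (and $S\equiv 0$ if $s=0$). Let $U:\mathbb R\to\mathbb R$ be continuous, non-decreasing and of polynomial growth, i.e. $|U(x)|\le C(1+|x|^m)$ for all $x$ and some constants $C,m>0$. Set $u(w,\varphi,s)=U(w)$ and $$V_t(w,\varphi,s;u)=\sup_{\zeta\in\mathcal A_t(\varphi)}E[u(W_t,\varphi_t,S_t)],\qquad V^{\mathrm{SO}}_t(w,\varphi,s;U)=\sup_{\zeta\in\mathcal A^{\mathrm{SO}}_t(\varphi)}E[U(W_t)],$$ where expectations and suprema are taken in the extended reals. Then, for all $t\in(0,1]$, $w\in\mathbb R$, $\varphi\ge 0$ and $s\ge 0$ (and also for $t=0$ if $\varphi=0$), $$V^{\mathrm{SO}}_t(w,\varphi,s;U)=V_t(w,\varphi,s;u).$$ -/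

import Mathlib

open MeasureTheory ProbabilityTheory Set Filter Topology
open scoped ENNReal

namespace OptimalExecution

/-- `f` is left-continuous on `(0, t]` and has right limits on `[0, t)`. -/
def IsCaglad (t : ℝ) (f : ℝ → ℝ) : Prop :=
  (∀ r ∈ Ioc 0 t, ContinuousWithinAt f (Iio r) r) ∧
    ∀ r ∈ Ico 0 t, ∃ l, Tendsto f (𝓝[>] r) (𝓝 l)

/-- `f` is right-continuous on `[0, t)` and has left limits on `(0, t]`. -/
def IsCadlag (t : ℝ) (f : ℝ → ℝ) : Prop :=
  (∀ r ∈ Ico 0 t, ContinuousWithinAt f (Ioi r) r) ∧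
    ∀ r ∈ Ioc 0 t, ∃ l, Tendsto f (𝓝[<] r) (𝓝 l)

/-- `B` is a standard one-dimensional Brownian motion on the time interval `[0, 1]`. -/
structure IsBrownianMotion {Ω : Type*} [MeasurableSpace Ω] (P : Measure Ω)
    (B : ℝ → Ω → ℝ) : Prop where
  measurable : ∀ r ∈ Icc (0 : ℝ) 1, Measurable (B r)
  zero : ∀ᵐ ω ∂P, B 0 ω = 0
  indep : HasIndepIncrements (fun r : Icc (0 : ℝ) 1 => B r) P
  law : ∀ q ∈ Icc (0 : ℝ) 1, ∀ r ∈ Icc (0 : ℝ) 1, q ≤ r →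
    HasLaw (fun ω => B r ω - B q ω) (gaussianReal 0 (r - q).toNNReal) P
  continuous : ∀ᵐ ω ∂P, ContinuousOn (fun r => B r ω) (Icc 0 1)

/-- `L` is a subordinator on the time interval `[0, 1]`: a Lévy process with
nondecreasing paths. -/
structure IsSubordinator {Ω : Type*} [MeasurableSpace Ω] (P : Measure Ω)
    (L : ℝ → Ω → ℝ) : Prop where
  measurable : ∀ r ∈ Icc (0 : ℝ) 1, Measurable (L r)
  zero : ∀ᵐ ω ∂P, L 0 ω = 0
  indep : HasIndepIncrements (fun r : Icc (0 : ℝ) 1 => L r) P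
  stationary : ∀ q ∈ Icc (0 : ℝ) 1, ∀ r ∈ Icc (0 : ℝ) 1, q ≤ r →
    IdentDistrib (fun ω => L r ω - L q ω) (L (r - q)) P P
  monotone : ∀ᵐ ω ∂P, MonotoneOn (fun r => L r ω) (Icc 0 1)
  cadlag : ∀ᵐ ω ∂P, IsCadlag 1 (fun r => L r ω)

/-- The data of the continuous-time execution model, with its standing assumptions. -/
structure Model (Ω : Type*) [MeasurableSpace Ω] where
  /-- the probability -/
  P : Measure Ω
  isProbabilityMeasure : IsProbabilityMeasure P
  isComplete : P.IsComplete
  /-- the Brownian motion driving the price -/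
  B : ℝ → Ω → ℝ
  isBrownianMotion : IsBrownianMotion P B
  /-- the subordinator giving the noise in the market impact -/
  L : ℝ → Ω → ℝ
  isSubordinator : IsSubordinator P L
  indep : IndepFun (fun ω (r : Icc (0 : ℝ) 1) => B r ω) (fun ω (r : Icc (0 : ℝ) 1) => L r ω) P
  /-- the volatility of the log-price -/
  σ : ℝ → ℝ
  lipschitz_σ : ∃ K, LipschitzWith K σ
  bounded_σ : ∃ C, ∀ x, |σ x| ≤ C
  /-- the drift of the log-price -/
  b : ℝ → ℝ
  lipschitz_b : ∃ K, LipschitzWith K b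
  bounded_b : ∃ C, ∀ x, |b x| ≤ C
  /-- the derivative of the market impact function, on `[0, ∞)` -/
  h : ℝ → ℝ
  nonneg_h : ∀ x, 0 ≤ x → 0 ≤ h x
  monotone_h : MonotoneOn h (Ici 0)
  continuous_h : ContinuousOn h (Ici 0)

/-- A simple (step) process `∑ i < n, value i * 1_(time i, time (i + 1)]` on `(0, r]`, each
`value i` being bounded and measurable for the information at `time i`. -/
structure SimpleProcess {Ω : Type*} (F : ℝ → MeasurableSpace Ω) (r : ℝ) where
  /-- the number of steps -/
  n : ℕ
  /-- the partition points -/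
  time : ℕ → ℝ
  /-- the value on each step -/
  value : ℕ → Ω → ℝ
  monotone_time : Monotone time
  time_mem : ∀ i, time i ∈ Icc 0 r
  measurable_value : ∀ i, Measurable[F (time i)] (value i)
  bounded_value : ∀ i, ∃ C, ∀ ω, |value i ω| ≤ C

/-- The simple process as a function of time and scenario. -/
noncomputable def SimpleProcess.eval {Ω : Type*} {F : ℝ → MeasurableSpace Ω} {r : ℝ}
    (H : SimpleProcess F r) (v : ℝ) (ω : Ω) : ℝ :=
  ∑ i ∈ Finset.range H.n, (Ioc (H.time i) (H.time (i + 1))).indicator (fun _ => H.value i ω) v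

/-- The elementary stochastic integral of a simple process over `(0, r]`. -/
noncomputable def SimpleProcess.integral {Ω : Type*} {F : ℝ → MeasurableSpace Ω} {r : ℝ}
    (H : SimpleProcess F r) (B : ℝ → Ω → ℝ) (ω : Ω) : ℝ :=
  ∑ i ∈ Finset.range H.n, H.value i ω * (B (H.time (i + 1)) ω - B (H.time i) ω)

/-- `J` is (a version of) the Itô integral `∫_0^r H dB`: the limit in `L²(P)` of the integrals of
simple processes converging to `H` in `L²(dv ⊗ P)`. -/
def IsItoIntegral {Ω : Type*} [MeasurableSpace Ω] (P : Measure Ω) (F : ℝ → MeasurableSpace Ω)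
    (B : ℝ → Ω → ℝ) (H : ℝ → Ω → ℝ) (r : ℝ) (J : Ω → ℝ) : Prop :=
  ∃ G : ℕ → SimpleProcess F r,
    Tendsto (fun k => ∫⁻ ω, ∫⁻ v in Ioc 0 r,
      ENNReal.ofReal (((G k).eval v ω - H v ω) ^ 2) ∂volume ∂P) atTop (𝓝 0) ∧
    Tendsto (fun k => ∫⁻ ω, ENNReal.ofReal (((G k).integral B ω - J ω) ^ 2) ∂P) atTop (𝓝 0)

/-- The extension of a path on `[0, 1]` to `ℝ`, constant outside `[0, 1]`. -/
noncomputable def extendPath (f : ℝ → ℝ) (r : ℝ) : ℝ := f (max 0 (min 1 r))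

theorem monotone_extendPath {f : ℝ → ℝ} (hf : MonotoneOn f (Icc 0 1)) :
    Monotone (extendPath f) := by
  intro x y hxy
  refine hf ⟨le_max_left _ _, max_le zero_le_one (min_le_left _ _)⟩
    ⟨le_max_left _ _, max_le zero_le_one (min_le_left _ _)⟩ ?_
  exact max_le_max le_rfl (min_le_min le_rfl hxy)

open Classical in
/-- The Lebesgue-Stieltjes measure `df` of a path `f` which is nondecreasing on `[0, 1]` (and `0`
for other paths; the paths of a subordinator are almost surely nondecreasing). -/
noncomputable def pathMeasure (f : ℝ → ℝ) : Measure ℝ :=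
  if hf : MonotoneOn f (Icc 0 1) then (monotone_extendPath hf).stieltjesFunction.measure else 0

/-- The expectation `E[Y⁺] - E[Y⁻]` of a random variable, as an extended real number. -/
noncomputable def expectation {Ω : Type*} [MeasurableSpace Ω] (P : Measure Ω) (Y : Ω → ℝ) :
    EReal :=
  ((∫⁻ ω, ENNReal.ofReal (Y ω) ∂P : ℝ≥0∞) : EReal) -
    ((∫⁻ ω, ENNReal.ofReal (-Y ω) ∂P : ℝ≥0∞) : EReal)

namespace Model

variable {Ω : Type*} [MeasurableSpace Ω] (M : Model Ω)

/-- The information at time `r`: generated by `B v` and `L v` for `v ∈ [0, r]` and by the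
null sets. -/
@[reducible]
def filtration (r : ℝ) : MeasurableSpace Ω :=
  (⨆ v ∈ Icc 0 r,
    MeasurableSpace.comap (M.B v) inferInstance ⊔ MeasurableSpace.comap (M.L v) inferInstance) ⊔
    MeasurableSpace.generateFrom {N | M.P N = 0}

/-- The market impact function `g(x) = ∫_0^x h`. -/
noncomputable def g (x : ℝ) : ℝ := ∫ y in (0 : ℝ)..x, M.h y

/-- `ζ` is an admissible strategy up to time `t` for a trader with `φ` shares. -/
structure Admissible (t φ : ℝ) (ζ : ℝ → Ω → ℝ) : Prop where
  adapted : ∀ r ∈ Icc 0 t, Measurable[M.filtration r] (ζ r)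
  caglad : ∀ ω, IsCaglad t (fun r => ζ r ω)
  nonneg : ∀ r ∈ Icc 0 t, ∀ ω, 0 ≤ ζ r ω
  bounded : ∃ C, ∀ r ∈ Icc 0 t, ∀ ω, ζ r ω ≤ C
  total_le : ∀ᵐ ω ∂M.P, ∫ r in (0 : ℝ)..t, ζ r ω ≤ φ

/-- `ζ` is an admissible strategy which sells exactly `φ` shares up to time `t`. -/
structure AdmissibleSellOff (t φ : ℝ) (ζ : ℝ → Ω → ℝ) : Prop extends M.Admissible t φ ζ where
  total_eq : ∀ᵐ ω ∂M.P, ∫ r in (0 : ℝ)..t, ζ r ω = φ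

/-- `X` is a solution on `[0, t]`, with `X_0 = x`, of
`dX_r = σ(X_r) dB_r + b(X_r) dr - g(ζ_r) dL_r`. -/
structure IsLogPrice (t x : ℝ) (ζ X : ℝ → Ω → ℝ) : Prop where
  adapted : ∀ r ∈ Icc 0 t, Measurable[M.filtration r] (X r)
  cadlag : ∀ᵐ ω ∂M.P, IsCadlag t (fun r => X r ω)
  equation : ∀ r ∈ Icc 0 t, ∃ J : Ω → ℝ,
    IsItoIntegral M.P M.filtration M.B (fun v ω => M.σ (X v ω)) r J ∧
    ∀ᵐ ω ∂M.P, X r ω = x + J ω + (∫ v in (0 : ℝ)..r, M.b (X v ω)) -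
      ∫ v in Ioc 0 r, M.g (ζ v ω) ∂pathMeasure (fun q => M.L q ω)

/-- `S` is the security price on `[0, t]` with `S_0 = s` under the strategy `ζ`: the exponential
of the log-price if `s > 0`, and identically `0` if `s = 0`. -/
def IsPrice (t s : ℝ) (ζ S : ℝ → Ω → ℝ) : Prop :=
  (0 < s ∧ ∃ X, M.IsLogPrice t (Real.log s) ζ X ∧
    ∀ r ∈ Icc 0 t, ∀ ω, S r ω = Real.exp (X r ω)) ∨
  (s = 0 ∧ ∀ r ∈ Icc 0 t, ∀ ω, S r ω = 0)

/-- `(W, Φ, S)` is the triplet of cash, shares and price on `[0, t]` started from `(w, φ, s)` and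
controlled by the strategy `ζ`. -/
structure IsControlled (t w φ s : ℝ) (ζ W Φ S : ℝ → Ω → ℝ) : Prop where
  cash : ∀ r ∈ Icc 0 t, ∀ᵐ ω ∂M.P, W r ω = w + ∫ v in (0 : ℝ)..r, ζ v ω * S v ω
  shares : ∀ r ∈ Icc 0 t, ∀ᵐ ω ∂M.P, Φ r ω = φ - ∫ v in (0 : ℝ)..r, ζ v ω
  price : M.IsPrice t s ζ S

/-- The continuous-time value function `V_t(w, φ, s; u)`. -/
noncomputable def value (t w φ s : ℝ) (u : ℝ → ℝ → ℝ → ℝ) : EReal :=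
  sSup {y | ∃ ζ W Φ S : ℝ → Ω → ℝ, M.Admissible t φ ζ ∧ M.IsControlled t w φ s ζ W Φ S ∧
    y = expectation M.P (fun ω => u (W t ω) (Φ t ω) (S t ω))}

/-- The continuous-time value function `V^SO_t(w, φ, s; U)` under the sell-off condition. -/
noncomputable def sellOffValue (t w φ s : ℝ) (U : ℝ → ℝ) : EReal :=
  sSup {y | ∃ ζ W Φ S : ℝ → Ω → ℝ, M.AdmissibleSellOff t φ ζ ∧ M.IsControlled t w φ s ζ W Φ S ∧
    y = expectation M.P (fun ω => U (W t ω))}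

end Model

end OptimalExecution

/-!
A strategy which sells exactly `φ` shares is admissible, so only `V ≤ V^SO` needs an argument. Take
any admissible `ζ`, stop it at a time `τ < t`, and sell what is left at a constant rate on `(τ, t]`
(`Model.liquidate`). The rate is known at time `τ`, and it is bounded, since at most `φ` shares are
sold over an interval of fixed length; so the new strategy is admissible and meets the sell-off
condition (`Model.Admissible.liquidate`). The price is nonnegative, so the liquidation never costs
cash: the final wealth is at least `w + ∫_0^τ ζ S`, however bad the price becomes under the heavy
selling. As `τ ↑ t` these amounts increase to the final wealth of `ζ`, and since `U` is
nondecreasing they are bounded below by `U(w)` after applying `U`; monotone convergence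
(`tendsto_expectation`) gives the inequality.

The value functions are suprema over strategies together with a price process, so the argument has
to produce a price for the new strategy: a solution of the stochastic differential equation which
continues the given one from time `τ` (`Model.exists_logPrice_ite`). As the new rate is a constant
`c` known at time `τ`, the jump part is explicitly `-g(c) (L_r - L_τ)`, and the problem is to solve
`Y = η + ∫ σ(Y) dB + ∫ b(Y) dr` on `[τ, t]` for a given adapted càdlàg `η` without any moments. It
suffices to do this for `t - τ` small (`Model.exists_solution`), which makes Picard iteration
contract without a Gronwall argument.

No stochastic integral beyond that of step processes is needed for it. The `k`-th Picard step
freezes the coefficients on a uniform grid of `2 ^ N k` steps, where `N k` is chosen along the way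
so that the discretization error is at most `64 ^ (-k)` in mean square (`Model.exists_scheme`); as
`σ` and `b` are bounded and Lipschitz this is possible whatever the moments of `η`. The Itô
isometry (`Model.lintegral_stepSum_sq`) shows that consecutive iterates are geometrically close in
mean square, Doob's maximal inequality (`Model.maximal_stepSum`) and the Borel-Cantelli lemma turn
this into almost sure uniform convergence, and the step processes themselves witness that the limit
is an Itô integral. Finally the witnesses before and after `τ` are concatenated
(`IsItoIntegral.append`).

The one probabilistic input is that `B_r - B_q` is independent of the information at time `q`,
which also contains the subordinator and the null sets (`Model.indep_filtration`).
-/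

namespace OptimalExecution

/-! ### Uniform grids and step sums -/

/-- The `i`-th point of the partition of `[a, b]` into `n` steps of equal length, for `i ≤ n`; the
sequence of grid points is continued by `b` for `i > n`. -/
noncomputable def gridPt (a b : ℝ) (n i : ℕ) : ℝ := a + (b - a) * ((min i n : ℕ) / n)

/-- The index `i < n` of the step `(gridPt i, gridPt (i + 1)]` which contains `v ∈ (a, b]`; the
outer `min` only matters for `v > b`. -/
noncomputable def gridIdx (a b : ℝ) (n : ℕ) (v : ℝ) : ℕ :=
  min (⌈(v - a) * n / (b - a)⌉₊ - 1) (n - 1)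

section Grid

variable {a b : ℝ} {n : ℕ}

@[simp] lemma gridPt_zero : gridPt a b n 0 = a := by simp [gridPt]

lemma gridPt_last (hn : 0 < n) : gridPt a b n n = b := by
  have : (n : ℝ) ≠ 0 := by positivity
  simp [gridPt, this]

lemma gridPt_mono (hab : a ≤ b) : Monotone (gridPt a b n) := by
  intro i j hij
  unfold gridPt
  have : (0 : ℝ) ≤ b - a := by linarith
  have := min_le_min_right n hij
  gcongr

lemma gridPt_mem (hab : a ≤ b) (hn : 0 < n) (i : ℕ) : gridPt a b n i ∈ Icc a b := by
  refine ⟨by simpa using gridPt_mono (n := n) hab (Nat.zero_le i), ?_⟩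
  have h := gridPt_mono (n := n) hab (min_le_right i n)
  rw [gridPt_last hn] at h
  simpa [gridPt] using h

lemma gridPt_succ_sub {i : ℕ} (hi : i < n) :
    gridPt a b n (i + 1) - gridPt a b n i = (b - a) / n := by
  rw [gridPt, gridPt, min_eq_left hi.le, min_eq_left (Nat.succ_le_of_lt hi)]; push_cast; ring

lemma gridPt_mul (hn : 0 < n) {q : ℕ} (hq : 0 < q) (i : ℕ) :
    gridPt a b (n * q) (i * q) = gridPt a b n i := by
  have : (n : ℝ) ≠ 0 := by positivity
  have : (q : ℝ) ≠ 0 := by positivity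
  rw [gridPt, gridPt, Nat.mul_min_mul_right]; push_cast; field_simp

lemma gridIdx_lt (hn : 0 < n) (v : ℝ) : gridIdx a b n v < n := by
  unfold gridIdx; omega

lemma gridIdx_eq (hab : a < b) (hn : 0 < n) {i : ℕ} (hi : i < n) {v : ℝ}
    (hv : v ∈ Ioc (gridPt a b n i) (gridPt a b n (i + 1))) : gridIdx a b n v = i := by
  have hd : 0 < b - a := by linarith
  have hn' : (0 : ℝ) < n := by positivity
  obtain ⟨h1, h2⟩ := hv
  have e1 : (i : ℝ) < (v - a) * n / (b - a) := by
    rw [lt_div_iff₀ hd]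
    have := mul_lt_mul_of_pos_right (sub_lt_sub_right h1 a) hn'
    have e : (gridPt a b n i - a) * n = i * (b - a) := by
      rw [gridPt, min_eq_left hi.le]; field_simp; ring
    linarith
  have e2 : (v - a) * n / (b - a) ≤ (i + 1 : ℕ) := by
    rw [div_le_iff₀ hd]
    have := mul_le_mul_of_nonneg_right (sub_le_sub_right h2 a) hn'.le
    have e : (gridPt a b n (i + 1) - a) * n = (i + 1 : ℕ) * (b - a) := by
      rw [gridPt, min_eq_left (Nat.succ_le_of_lt hi)]; field_simp; ring
    linarith
  have : ⌈(v - a) * n / (b - a)⌉₊ = i + 1 := by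
    rw [Nat.ceil_eq_iff (by omega)]
    exact ⟨by simpa using e1, e2⟩
  unfold gridIdx; omega

lemma mem_grid (hab : a < b) (hn : 0 < n) {v : ℝ} (hv : v ∈ Ioc a b) :
    v ∈ Ioc (gridPt a b n (gridIdx a b n v)) (gridPt a b n (gridIdx a b n v + 1)) := by
  have key : ∃ i < n, v ∈ Ioc (gridPt a b n i) (gridPt a b n (i + 1)) := by
    have h : ∃ j, v ≤ gridPt a b n j := ⟨n, by rw [gridPt_last hn]; exact hv.2⟩
    classical
    have hf := Nat.find_spec h
    have h0 : Nat.find h ≠ 0 := by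
      intro h0; rw [h0, gridPt_zero] at hf; exact absurd hv.1 (not_lt.2 hf)
    obtain ⟨i, hi⟩ := Nat.exists_eq_succ_of_ne_zero h0
    have hle : Nat.find h ≤ n := Nat.find_min' h (by rw [gridPt_last hn]; exact hv.2)
    refine ⟨i, by omega, ?_, ?_⟩
    · exact not_le.1 (Nat.find_min h (by omega))
    · rw [hi] at hf; exact hf
  obtain ⟨i, hi, hvi⟩ := key
  rwa [gridIdx_eq hab hn hi hvi]

lemma gridIdx_mul_div (hab : a < b) (hn : 0 < n) {q : ℕ} (hq : 0 < q) {v : ℝ}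
    (hv : v ∈ Ioc a b) : gridIdx a b (n * q) v / q = gridIdx a b n v := by
  have hnq : 0 < n * q := Nat.mul_pos hn hq
  set j := gridIdx a b (n * q) v with hj
  have hjlt : j < n * q := gridIdx_lt hnq v
  have hv' := mem_grid hab hnq hv
  rw [← hj] at hv'
  symm
  apply gridIdx_eq hab hn (Nat.div_lt_of_lt_mul (by rwa [mul_comm] at hjlt))
  rw [← gridPt_mul hn hq, ← gridPt_mul hn hq]
  exact ⟨lt_of_le_of_lt (gridPt_mono hab.le (Nat.div_mul_le_self j q)) hv'.1,
    hv'.2.trans (gridPt_mono hab.le (Nat.succ_le_of_lt (Nat.lt_mul_of_div_lt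
      (Nat.lt_succ_self _) hq)))⟩

lemma measurable_gridIdx : Measurable (gridIdx a b n) := by
  unfold gridIdx
  have h : Measurable fun v : ℝ => ⌈(v - a) * n / (b - a)⌉₊ := by
    apply Nat.measurable_ceil.comp; fun_prop
  exact (measurable_from_nat (f := fun k : ℕ => min (k - 1) (n - 1))).comp h

lemma measurable_comp_gridIdx (h : ℕ → ℝ) : Measurable fun v => h (gridIdx a b n v) :=
  measurable_from_nat.comp measurable_gridIdx

lemma gridPt_idx_mem (hab : a < b) (hn : 0 < n) (v : ℝ) :
    gridPt a b n (gridIdx a b n v) ∈ Icc a b :=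
  gridPt_mem hab.le hn _

lemma gridPt_idx_succ_mem (hab : a < b) (hn : 0 < n) (v : ℝ) :
    gridPt a b n (gridIdx a b n v + 1) ∈ Icc a b :=
  gridPt_mem hab.le hn _

lemma tendsto_gridPt_idx (hab : a < b) {n : ℕ → ℕ} (hn : ∀ k, 0 < n k)
    (hn' : Tendsto n atTop atTop) {v : ℝ} (hv : v ∈ Ioc a b) :
    Tendsto (fun k => gridPt a b (n k) (gridIdx a b (n k) v)) atTop (𝓝[Ico a v] v) := by
  have h0 : Tendsto (fun k => (b - a) / (n k : ℝ)) atTop (𝓝 0) :=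
    tendsto_const_nhds.div_atTop (tendsto_natCast_atTop_atTop.comp hn')
  apply tendsto_nhdsWithin_of_tendsto_nhds_of_eventually_within
  · refine tendsto_of_tendsto_of_tendsto_of_le_of_le (g := fun k => v - (b - a) / (n k : ℝ))
      (h := fun _ => v) (by simpa using tendsto_const_nhds.sub h0) tendsto_const_nhds ?_ ?_
    · intro k
      have := (mem_grid hab (hn k) hv).2
      have e := gridPt_succ_sub (a := a) (b := b) (n := n k)
        (gridIdx_lt (a := a) (b := b) (hn k) v)
      simp only; linarith
    · intro k; exact (mem_grid hab (hn k) hv).1.le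
  · exact Eventually.of_forall fun k =>
      ⟨(gridPt_idx_mem hab (hn k) v).1, (mem_grid hab (hn k) hv).1⟩

lemma tendsto_gridPt_idx_succ (hab : a < b) {n : ℕ → ℕ} (hn : ∀ k, 0 < n k)
    (hn' : Tendsto n atTop atTop) {v : ℝ} (hv : v ∈ Ioc a b) :
    Tendsto (fun k => gridPt a b (n k) (gridIdx a b (n k) v + 1)) atTop (𝓝[Icc v b] v) := by
  have h0 : Tendsto (fun k => (b - a) / (n k : ℝ)) atTop (𝓝 0) :=
    tendsto_const_nhds.div_atTop (tendsto_natCast_atTop_atTop.comp hn')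
  apply tendsto_nhdsWithin_of_tendsto_nhds_of_eventually_within
  · refine tendsto_of_tendsto_of_tendsto_of_le_of_le (g := fun _ => v)
      (h := fun k => v + (b - a) / (n k : ℝ)) tendsto_const_nhds
      (by simpa using tendsto_const_nhds.add h0) ?_ ?_
    · intro k; exact (mem_grid hab (hn k) hv).2
    · intro k
      have := (mem_grid hab (hn k) hv).1
      have e := gridPt_succ_sub (a := a) (b := b) (n := n k)
        (gridIdx_lt (a := a) (b := b) (hn k) v)
      simp only; linarith
  · exact Eventually.of_forall fun k =>
      ⟨(mem_grid hab (hn k) hv).2, (gridPt_idx_succ_mem hab (hn k) v).2⟩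

/-- The elementary integral over `(a, r]` of the step function with value `h i` on the `i`-th step
of the grid, with respect to the increments of the path `A`. -/
noncomputable def stepSum (a b : ℝ) (n : ℕ) (A : ℝ → ℝ) (h : ℕ → ℝ) (r : ℝ) : ℝ :=
  ∑ i ∈ Finset.range n,
    h i * (A (min (gridPt a b n (i + 1)) r) - A (min (gridPt a b n i) r))

lemma stepSum_sub (A : ℝ → ℝ) (h h' : ℕ → ℝ) (r : ℝ) :
    stepSum a b n A (fun i => h i - h' i) r = stepSum a b n A h r - stepSum a b n A h' r := by
  simp only [stepSum, ← Finset.sum_sub_distrib]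
  exact Finset.sum_congr rfl fun i _ => by ring

lemma stepSum_left (hab : a ≤ b) (A : ℝ → ℝ) (h : ℕ → ℝ) : stepSum a b n A h a = 0 := by
  have ha : ∀ i, min (gridPt a b n i) a = a := fun i =>
    min_eq_right (by simpa using gridPt_mono (n := n) hab (Nat.zero_le i))
  simp [stepSum, ha]

lemma sum_range_mul (f : ℕ → ℝ) (n q : ℕ) :
    ∑ j ∈ Finset.range (n * q), f j =
      ∑ i ∈ Finset.range n, ∑ l ∈ Finset.range q, f (i * q + l) := by
  induction n with
  | zero => simp
  | succ n ih => rw [Finset.sum_range_succ, ← ih, add_mul, one_mul, Finset.sum_range_add]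

lemma stepSum_refine (hn : 0 < n) {q : ℕ} (hq : 0 < q) (A : ℝ → ℝ) (h : ℕ → ℝ) (r : ℝ) :
    stepSum a b n A h r = stepSum a b (n * q) A (fun j => h (j / q)) r := by
  unfold stepSum
  rw [sum_range_mul]
  refine Finset.sum_congr rfl fun i _ => ?_
  have : ∀ l ∈ Finset.range q, h ((i * q + l) / q) *
      (A (min (gridPt a b (n * q) (i * q + l + 1)) r) - A (min (gridPt a b (n * q) (i * q + l)) r))
      = h i * ((fun l => A (min (gridPt a b (n * q) (i * q + l)) r)) (l + 1) -
        (fun l => A (min (gridPt a b (n * q) (i * q + l)) r)) l) := by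
    intro l hl
    have e : (i * q + l) / q = i := by
      rw [mul_comm, Nat.mul_add_div hq, Nat.div_eq_of_lt (Finset.mem_range.1 hl), add_zero]
    rw [e]; rfl
  rw [Finset.sum_congr rfl this, ← Finset.mul_sum,
    Finset.sum_range_sub (fun l => A (min (gridPt a b (n * q) (i * q + l)) r))]
  have e2 : i * q + q = (i + 1) * q := by ring
  simp only [add_zero, e2, gridPt_mul hn hq]

lemma stepSum_gridPt (hab : a ≤ b) {k : ℕ} (hk : k ≤ n) (A : ℝ → ℝ) (h : ℕ → ℝ) :
    stepSum a b n A h (gridPt a b n k) =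
      ∑ i ∈ Finset.range k, h i * (A (gridPt a b n (i + 1)) - A (gridPt a b n i)) := by
  unfold stepSum
  rw [← Finset.sum_range_add_sum_Ico _ hk]
  have h2 : ∑ i ∈ Finset.Ico k n, h i * (A (min (gridPt a b n (i + 1)) (gridPt a b n k)) -
      A (min (gridPt a b n i) (gridPt a b n k))) = 0 := by
    refine Finset.sum_eq_zero fun i hi => ?_
    have hi' := (Finset.mem_Ico.1 hi).1
    rw [min_eq_right (gridPt_mono hab (by omega)), min_eq_right (gridPt_mono hab hi'), sub_self,
      mul_zero]
  rw [h2, add_zero]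
  refine Finset.sum_congr rfl fun i hi => ?_
  have hi' := Finset.mem_range.1 hi
  rw [min_eq_left (gridPt_mono hab (by omega)), min_eq_left (gridPt_mono hab hi'.le)]

lemma continuousOn_stepSum (hab : a ≤ b) (hn : 0 < n) {A : ℝ → ℝ} (hA : ContinuousOn A (Icc a b))
    (h : ℕ → ℝ) : ContinuousOn (stepSum a b n A h) (Icc a b) := by
  unfold stepSum
  refine continuousOn_finsetSum _ fun i hi => ?_
  have hc : ∀ j, ContinuousOn (fun r => A (min (gridPt a b n j) r)) (Icc a b) := by
    intro j
    refine hA.comp (by fun_prop) fun r hr => ?_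
    have := gridPt_mem hab hn j
    exact ⟨le_min this.1 hr.1, (min_le_right _ _).trans hr.2⟩
  exact continuousOn_const.mul ((hc _).sub (hc _))

/-- Integrating a function which is constant on the steps of the grid, cut at `r`. -/
lemma integral_grid_eq_sum (hab : a < b) (hn : 0 < n) (h : ℕ → ℝ) {r : ℝ} (hr : r ∈ Icc a b) :
    ∫ v in Ioc a r, h (gridIdx a b n v) = stepSum a b n id h r := by
  set q : ℕ → ℝ := fun i => min (gridPt a b n i) r with hq
  have hmono : Monotone q := fun i j hij => min_le_min (gridPt_mono hab.le hij) le_rfl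
  have hval : ∀ i < n, ∀ v ∈ Ioc (q i) (q (i + 1)), h (gridIdx a b n v) = h i := by
    intro i hi v hv
    have h1 : gridPt a b n i < v := by
      rcases min_lt_iff.1 hv.1 with h1 | h1
      · exact h1
      · exact absurd (hv.2.trans (min_le_right _ _)) (not_le.2 h1)
    rw [gridIdx_eq hab hn hi ⟨h1, hv.2.trans (min_le_left _ _)⟩]
  have hint : ∀ i < n, IntervalIntegrable (fun v => h (gridIdx a b n v)) volume
      (q i) (q (i + 1)) := by
    intro i hi
    rw [intervalIntegrable_iff_integrableOn_Ioc_of_le (hmono (Nat.le_succ i))]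
    refine IntegrableOn.congr_fun (f := fun _ => h i) ?_ (fun v hv => (hval i hi v hv).symm)
      measurableSet_Ioc
    exact integrableOn_const (by simp)
  have := intervalIntegral.sum_integral_adjacent_intervals hint
  have e0 : q 0 = a := by simp [hq, hr.1]
  have en : q n = r := by simp [hq, gridPt_last hn, hr.2]
  rw [e0, en, intervalIntegral.integral_of_le hr.1] at this
  rw [← this, stepSum]
  refine Finset.sum_congr rfl fun i hi => ?_
  rw [intervalIntegral.integral_of_le (hmono (Nat.le_succ i)),
    setIntegral_congr_fun measurableSet_Ioc (hval i (Finset.mem_range.1 hi))]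
  rw [setIntegral_const, Measure.real, Real.volume_Ioc,
    ENNReal.toReal_ofReal (sub_nonneg.2 (hmono (Nat.le_succ i))), smul_eq_mul, mul_comm]
  rfl

end Grid

section Drift

variable {a b C : ℝ} {n : ℕ} {h : ℕ → ℝ}

lemma lintegral_grid_sq (hab : a < b) (hn : 0 < n) (hC : ∀ i, |h i| ≤ C) {r : ℝ}
    (hr : r ∈ Icc a b) : ∫⁻ v in Ioc a r, ENNReal.ofReal (h (gridIdx a b n v) ^ 2) =
      ENNReal.ofReal (stepSum a b n id (fun i => h i ^ 2) r) := by
  rw [← integral_grid_eq_sum hab hn _ hr, ofReal_integral_eq_lintegral_ofReal]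
  · refine Measure.integrableOn_of_bounded (M := C ^ 2) (by simp)
      (measurable_comp_gridIdx (a := a) (b := b) (n := n) fun i => h i ^ 2).aestronglyMeasurable
      (Eventually.of_forall fun v => ?_)
    rw [Real.norm_of_nonneg (sq_nonneg _)]
    exact sq_le_sq' (abs_le.1 (hC _)).1 (abs_le.1 (hC _)).2
  · exact Eventually.of_forall fun v => sq_nonneg _

/-- The Cauchy-Schwarz inequality for the integral of a step function over a time interval of
length at most one. -/
lemma stepSum_id_sq_le (hab : a < b) (hb : b ≤ a + 1) (hn : 0 < n) (hC : ∀ i, |h i| ≤ C) {r : ℝ}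
    (hr : r ∈ Icc a b) : ENNReal.ofReal (stepSum a b n id h r ^ 2) ≤
      ∫⁻ v in Ioc a r, ENNReal.ofReal (h (gridIdx a b n v) ^ 2) := by
  rw [lintegral_grid_sq hab hn hC hr]
  refine ENNReal.ofReal_le_ofReal ?_
  set w : ℕ → ℝ := fun i => min (gridPt a b n (i + 1)) r - min (gridPt a b n i) r with hw
  have hw0 : ∀ i, 0 ≤ w i := fun i =>
    sub_nonneg.2 (min_le_min (gridPt_mono hab.le i.le_succ) le_rfl)
  have hsum : ∑ i ∈ Finset.range n, w i ≤ 1 := by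
    rw [Finset.sum_range_sub (fun i => min (gridPt a b n i) r), gridPt_last hn, min_eq_right hr.2,
      gridPt_zero, min_eq_left hr.1]
    linarith [hr.2]
  set x := stepSum a b n id h r with hx
  have hx' : ∑ i ∈ Finset.range n, h i * w i = x := rfl
  have hpos : 0 ≤ ∑ i ∈ Finset.range n, (h i - x) ^ 2 * w i :=
    Finset.sum_nonneg fun i _ => mul_nonneg (sq_nonneg _) (hw0 i)
  have hexp : ∑ i ∈ Finset.range n, (h i - x) ^ 2 * w i =
      stepSum a b n id (fun i => h i ^ 2) r - 2 * x * ∑ i ∈ Finset.range n, h i * w i +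
        x ^ 2 * ∑ i ∈ Finset.range n, w i := by
    simp only [stepSum, id, Finset.mul_sum, ← Finset.sum_sub_distrib, ← Finset.sum_add_distrib]
    refine Finset.sum_congr rfl fun i _ => ?_
    simp only [hw]; ring
  rw [hexp, hx'] at hpos
  nlinarith [mul_le_mul_of_nonneg_left hsum (sq_nonneg x)]

end Drift

/-! ### Paths with one-sided limits -/

section Paths

/-- A function with one-sided limits is bounded on compact intervals. -/
lemma exists_bound_of_one_sided_limits {a b : ℝ} {f : ℝ → ℝ}
    (hl : ∀ r ∈ Ioc a b, ∃ l, Tendsto f (𝓝[<] r) (𝓝 l))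
    (hr : ∀ r ∈ Ico a b, ∃ l, Tendsto f (𝓝[>] r) (𝓝 l)) :
    ∃ C, 0 ≤ C ∧ ∀ r ∈ Icc a b, |f r| ≤ C := by
  suffices H : ∃ C, ∀ r ∈ Icc a b, |f r| ≤ C by
    obtain ⟨C, hC⟩ := H
    exact ⟨max C 0, le_max_right _ _, fun r hr => (hC r hr).trans (le_max_left _ _)⟩
  refine isCompact_Icc.induction_on (p := fun s => ∃ C, ∀ r ∈ s, |f r| ≤ C) ⟨0, by simp⟩
    (fun s t hst ⟨C, hC⟩ => ⟨C, fun r hr => hC r (hst hr)⟩)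
    (fun s t ⟨C, hC⟩ ⟨D, hD⟩ => ⟨max C D, fun r hr => hr.elim
      (fun h => (hC r h).trans (le_max_left _ _)) (fun h => (hD r h).trans (le_max_right _ _))⟩) ?_
  intro x hx
  have hbd : ∀ (l : Filter ℝ), (∃ c, Tendsto f l (𝓝 c)) → ∃ C, ∀ᶠ y in l, |f y| ≤ C := by
    rintro l ⟨c, hc⟩
    exact ⟨|c| + 1, (hc.abs.eventually (gt_mem_nhds (lt_add_one _))).mono fun y hy => le_of_lt hy⟩
  have h1 : ∃ C, ∀ᶠ y in 𝓝[<] x, y ∈ Icc a b → |f y| ≤ C := by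
    rcases eq_or_lt_of_le hx.1 with h | h
    · refine ⟨0, eventually_nhdsWithin_of_forall fun y hy hy' => ?_⟩
      exact absurd hy (not_lt.2 (h ▸ hy'.1))
    · obtain ⟨C, hC⟩ := hbd _ (hl x ⟨h, hx.2⟩)
      exact ⟨C, hC.mono fun y hy _ => hy⟩
  have h2 : ∃ C, ∀ᶠ y in 𝓝[>] x, y ∈ Icc a b → |f y| ≤ C := by
    rcases eq_or_lt_of_le hx.2 with h | h
    · refine ⟨0, eventually_nhdsWithin_of_forall fun y hy hy' => ?_⟩
      exact absurd hy (not_lt.2 (h ▸ hy'.2))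
    · obtain ⟨C, hC⟩ := hbd _ (hr x ⟨hx.1, h⟩)
      exact ⟨C, hC.mono fun y hy _ => hy⟩
  obtain ⟨C, hC⟩ := h1
  obtain ⟨D, hD⟩ := h2
  rw [eventually_nhdsWithin_iff] at hC hD
  refine ⟨{y | y ∈ Icc a b ∧ |f y| ≤ max (max C D) |f x|}, ?_, max (max C D) |f x|,
    fun r hr => hr.2⟩
  rw [mem_nhdsWithin_iff_eventually]
  filter_upwards [hC, hD] with y hyC hyD hy
  refine ⟨hy, ?_⟩
  rcases lt_trichotomy y x with h | h | h
  · exact (hyC h hy).trans ((le_max_left _ _).trans (le_max_left _ _))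
  · rw [h]; exact le_max_right _ _
  · exact (hyD h hy).trans ((le_max_right _ _).trans (le_max_left _ _))

variable {t : ℝ} {f g : ℝ → ℝ}

lemma IsCaglad.exists_bound (hf : IsCaglad t f) : ∃ C, 0 ≤ C ∧ ∀ r ∈ Icc 0 t, |f r| ≤ C :=
  exists_bound_of_one_sided_limits (fun r hr => ⟨_, hf.1 r hr⟩) hf.2

lemma IsCadlag.exists_bound (hf : IsCadlag t f) : ∃ C, 0 ≤ C ∧ ∀ r ∈ Icc 0 t, |f r| ≤ C :=
  exists_bound_of_one_sided_limits hf.2 (fun r hr => ⟨_, hf.1 r hr⟩)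

lemma IsCaglad.mono {q : ℝ} (hf : IsCaglad t f) (hq : q ≤ t) : IsCaglad q f :=
  ⟨fun r hr => hf.1 r ⟨hr.1, hr.2.trans hq⟩, fun r hr => hf.2 r ⟨hr.1, hr.2.trans_le hq⟩⟩

lemma IsCadlag.mono {q : ℝ} (hf : IsCadlag t f) (hq : q ≤ t) : IsCadlag q f :=
  ⟨fun r hr => hf.1 r ⟨hr.1, hr.2.trans_le hq⟩, fun r hr => hf.2 r ⟨hr.1, hr.2.trans hq⟩⟩

lemma IsCadlag.comp_continuous (hf : IsCadlag t f) (hg : Continuous g) :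
    IsCadlag t (fun r => g (f r)) :=
  ⟨fun r hr => hg.continuousAt.comp_continuousWithinAt (hf.1 r hr), fun r hr =>
    let ⟨l, hl⟩ := hf.2 r hr; ⟨g l, (hg.tendsto l).comp hl⟩⟩

lemma IsCaglad.comp_continuous (hf : IsCaglad t f) (hg : Continuous g) :
    IsCaglad t (fun r => g (f r)) :=
  ⟨fun r hr => hg.continuousAt.comp_continuousWithinAt (hf.1 r hr), fun r hr =>
    let ⟨l, hl⟩ := hf.2 r hr; ⟨g l, (hg.tendsto l).comp hl⟩⟩

lemma IsCaglad.tendsto_grid (hf : IsCaglad t f) (ht : 0 < t) {v : ℝ} (hv : v ∈ Ioc 0 t) :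
    Tendsto (fun k : ℕ => f (gridPt 0 t (k + 1) (gridIdx 0 t (k + 1) v))) atTop (𝓝 (f v)) :=
  ((hf.1 v hv).mono fun _ hx => hx.2).tendsto.comp
    (tendsto_gridPt_idx ht (n := fun k => k + 1) (fun k => k.succ_pos) (tendsto_add_atTop_nat 1) hv)

lemma IsCadlag.tendsto_grid (hf : IsCadlag t f) (ht : 0 < t) {v : ℝ} (hv : v ∈ Ioc 0 t) :
    Tendsto (fun k : ℕ => f (gridPt 0 t (k + 1) (gridIdx 0 t (k + 1) v + 1))) atTop
      (𝓝 (f v)) := by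
  refine Tendsto.comp ?_ (tendsto_gridPt_idx_succ ht (n := fun k => k + 1) (fun k => k.succ_pos)
    (tendsto_add_atTop_nat 1) hv)
  rcases eq_or_lt_of_le hv.2 with h | h
  · subst h; simpa using tendsto_pure_nhds f v
  · have := (hf.1 v ⟨hv.1.le, h⟩)
    exact ((continuousWithinAt_Ioi_iff_Ici.1 this).mono fun _ hx => hx.1).tendsto

lemma IsCaglad.aemeasurable {μ : Measure ℝ} (hf : IsCaglad t f) :
    AEMeasurable f (μ.restrict (Ioc 0 t)) := by
  rcases le_or_gt t 0 with ht | ht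
  · simp [Ioc_eq_empty (not_lt.2 ht)]
  refine aemeasurable_of_tendsto_metrizable_ae atTop
    (f := fun (k : ℕ) v => f (gridPt 0 t (k + 1) (gridIdx 0 t (k + 1) v)))
    (fun k => (measurable_comp_gridIdx fun i => f (gridPt 0 t (k + 1) i)).aemeasurable) ?_
  filter_upwards [ae_restrict_mem measurableSet_Ioc] with v hv using hf.tendsto_grid ht hv

lemma IsCadlag.aemeasurable {μ : Measure ℝ} (hf : IsCadlag t f) :
    AEMeasurable f (μ.restrict (Ioc 0 t)) := by
  rcases le_or_gt t 0 with ht | ht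
  · simp [Ioc_eq_empty (not_lt.2 ht)]
  refine aemeasurable_of_tendsto_metrizable_ae atTop
    (f := fun (k : ℕ) v => f (gridPt 0 t (k + 1) (gridIdx 0 t (k + 1) v + 1)))
    (fun k => (measurable_comp_gridIdx fun i => f (gridPt 0 t (k + 1) (i + 1))).aemeasurable) ?_
  filter_upwards [ae_restrict_mem measurableSet_Ioc] with v hv using hf.tendsto_grid ht hv

end Paths


/-! ### The filtration and the independence of the Brownian increments -/

/-- If `m₁` is independent of `m₂` and `m₃` of both together, then `m₁` and `m₃` together are
independent of `m₂`. -/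
lemma indep_sup_of_indep_sup {Ω : Type*} {mΩ : MeasurableSpace Ω} {P : Measure Ω}
    [IsProbabilityMeasure P] {m₁ m₂ m₃ : MeasurableSpace Ω} (h₁ : m₁ ≤ mΩ) (h₂ : m₂ ≤ mΩ)
    (h₃ : m₃ ≤ mΩ) (h : Indep m₁ m₂ P) (h' : Indep (m₁ ⊔ m₂) m₃ P) :
    Indep (m₁ ⊔ m₃) m₂ P := by
  let π : Set (Set Ω) := {s | ∃ u v, MeasurableSet[m₁] u ∧ MeasurableSet[m₃] v ∧ s = u ∩ v}
  have hπ : IsPiSystem π := by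
    rintro _ ⟨u, v, hu, hv, rfl⟩ _ ⟨u', v', hu', hv', rfl⟩ -
    exact ⟨u ∩ u', v ∩ v', hu.inter hu', hv.inter hv', by ext; simp; tauto⟩
  have hgen : m₁ ⊔ m₃ = MeasurableSpace.generateFrom π := by
    apply le_antisymm
    · refine sup_le (fun s hs => ?_) (fun s hs => ?_)
      · exact MeasurableSpace.measurableSet_generateFrom ⟨s, univ, hs, MeasurableSet.univ, by simp⟩
      · exact MeasurableSpace.measurableSet_generateFrom ⟨univ, s, MeasurableSet.univ, hs, by simp⟩
    · refine MeasurableSpace.generateFrom_le ?_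
      rintro _ ⟨u, v, hu, hv, rfl⟩
      exact MeasurableSet.inter ((le_sup_left : m₁ ≤ m₁ ⊔ m₃) _ hu)
        ((le_sup_right : m₃ ≤ m₁ ⊔ m₃) _ hv)
  refine IndepSets.indep (sup_le h₁ h₃) h₂ hπ (@MeasurableSpace.isPiSystem_measurableSet Ω m₂)
    hgen (@MeasurableSpace.generateFrom_measurableSet Ω m₂).symm ?_
  rw [IndepSets_iff]
  rintro _ w ⟨u, v, hu, hv, rfl⟩ hw
  rw [Indep_iff] at h h'
  have hu' : MeasurableSet[m₁ ⊔ m₂] u := (le_sup_left : m₁ ≤ m₁ ⊔ m₂) _ hu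
  have hw' : MeasurableSet[m₁ ⊔ m₂] w := (le_sup_right : m₂ ≤ m₁ ⊔ m₂) _ hw
  have e : u ∩ v ∩ w = (u ∩ w) ∩ v := by ext; simp; tauto
  rw [e, h' _ _ (hu'.inter hw') hv, h _ _ hu hw, h' _ _ hu' hv]
  ring

/-- Each coordinate of a process is measurable for the `σ`-algebra generated by the process. -/
lemma measurable_comap_eval {Ω ι : Type*} (X : ι → Ω → ℝ) (i : ι) :
    Measurable[MeasurableSpace.comap (fun ω j => X j ω) inferInstance] (X i) :=
  (measurable_pi_apply (X := fun _ : ι => ℝ) i).comp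
    (comap_measurable (fun ω j => X j ω))

namespace Model

variable {Ω : Type*} [mΩ : MeasurableSpace Ω] (M : Model Ω)

instance : IsProbabilityMeasure M.P := M.isProbabilityMeasure

lemma filtration_mono {q r : ℝ} (h : q ≤ r) : M.filtration q ≤ M.filtration r :=
  sup_le_sup_right (biSup_mono fun _ hv => ⟨hv.1, hv.2.trans h⟩) _

/-- The `σ`-algebra generated by the null sets is contained in each `filtration r`. -/
lemma measurableSet_of_null (r : ℝ) {N : Set Ω} (hN : M.P N = 0) :
    MeasurableSet[M.filtration r] N :=
  (le_sup_right : _ ≤ M.filtration r) _ (MeasurableSpace.measurableSet_generateFrom hN)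

lemma nullSets_le : MeasurableSpace.generateFrom {N | M.P N = 0} ≤ mΩ :=
  MeasurableSpace.generateFrom_le fun _ hN => M.isComplete.out' _ hN

lemma filtration_le {r : ℝ} (h : r ≤ 1) : M.filtration r ≤ mΩ := by
  refine sup_le (iSup₂_le fun v hv => sup_le ?_ ?_) M.nullSets_le
  · exact (M.isBrownianMotion.measurable v ⟨hv.1, hv.2.trans h⟩).comap_le
  · exact (M.isSubordinator.measurable v ⟨hv.1, hv.2.trans h⟩).comap_le

lemma measurable_B {r q : ℝ} (hr : 0 ≤ r) (hq : r ≤ q) : Measurable[M.filtration q] (M.B r) := by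
  rw [measurable_iff_comap_le]
  exact le_sup_of_le_left (le_iSup₂_of_le r ⟨hr, hq⟩ le_sup_left)

lemma measurable_L {r q : ℝ} (hr : 0 ≤ r) (hq : r ≤ q) : Measurable[M.filtration q] (M.L r) := by
  rw [measurable_iff_comap_le]
  exact le_sup_of_le_left (le_iSup₂_of_le r ⟨hr, hq⟩ le_sup_right)

lemma measurable_congr_ae {r : ℝ} {f g : Ω → ℝ} (hg : Measurable[M.filtration r] g)
    (h : ∀ᵐ ω ∂M.P, f ω = g ω) : Measurable[M.filtration r] f := by
  intro s hs
  have hN : M.P {ω | f ω ≠ g ω} = 0 := h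
  have e : f ⁻¹' s = (g ⁻¹' s \ {ω | f ω ≠ g ω}) ∪ (f ⁻¹' s ∩ {ω | f ω ≠ g ω}) := by
    ext ω; by_cases hω : f ω = g ω <;> simp [hω]
  rw [e]
  exact ((hg hs).diff (M.measurableSet_of_null r hN)).union
    (M.measurableSet_of_null r (measure_mono_null inter_subset_right hN))

lemma measurable_of_tendsto_ae {r : ℝ} {f : ℕ → Ω → ℝ} {g : Ω → ℝ}
    (hf : ∀ k, Measurable[M.filtration r] (f k))
    (h : ∀ᵐ ω ∂M.P, Tendsto (fun k => f k ω) atTop (𝓝 (g ω))) : Measurable[M.filtration r] g := by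
  have hN : M.P {ω | ¬ Tendsto (fun k => f k ω) atTop (𝓝 (g ω))} = 0 := h
  set N := {ω | ¬ Tendsto (fun k => f k ω) atTop (𝓝 (g ω))} with hNdef
  have hN' := (M.measurableSet_of_null r hN).compl
  have hlim : Measurable[M.filtration r] (Nᶜ.indicator g) := by
    refine @measurable_of_tendsto_metrizable Ω ℝ (M.filtration r) _ _ _ _
      (fun k => Nᶜ.indicator (f k)) _ (fun k => (hf k).indicator hN') ?_
    rw [tendsto_pi_nhds]
    intro ω
    by_cases hω : ω ∈ N
    · simp [hω]
    · have : Tendsto (fun k => f k ω) atTop (𝓝 (g ω)) := not_not.1 hω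
      simpa [hω] using this
  refine M.measurable_congr_ae hlim ?_
  filter_upwards [h] with ω hω
  have : ω ∉ N := not_not.2 hω
  simp [this]

/-- The Brownian increments after time `q` are independent of the Brownian path up to `q`: both
are read off one Gaussian process and they are uncorrelated. -/
lemma indepFun_path_increment {q r : ℝ} (hq : q ∈ Icc (0 : ℝ) 1) (hr : r ∈ Icc (0 : ℝ) 1)
    (hqr : q ≤ r) :
    IndepFun (fun ω (v : Icc (0 : ℝ) q) => M.B v ω) (fun ω => M.B r ω - M.B q ω) M.P := by
  let T := Icc (0 : ℝ) 1
  let X : T → Ω → ℝ := fun v => M.B v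
  let _ : OrderBot T := { bot := ⟨0, le_rfl, zero_le_one⟩, bot_le := fun v => v.2.1 }
  have h0 : ∀ᵐ ω ∂M.P, X ⊥ ω = 0 := by
    exact M.isBrownianMotion.zero
  have hlaw : ∀ v : T, HasGaussianLaw (X v) M.P := by
    intro v
    have h1 := (M.isBrownianMotion.law 0 (by simp) v v.2 v.2.1).hasGaussianLaw
    refine h1.congr ?_
    filter_upwards [M.isBrownianMotion.zero] with ω hω
    simp [hω, X]
  have hG : IsGaussianProcess X M.P :=
    HasIndepIncrements.isGaussianProcess hlaw h0 M.isBrownianMotion.indep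
  have hmeas : ∀ v : T, Measurable (X v) := fun v => M.isBrownianMotion.measurable v v.2
  have key : IndepFun (fun ω (v : Icc (0 : ℝ) q) => M.B v ω)
      (fun ω (_ : Unit) => M.B r ω - M.B q ω) M.P := by
    have hm : ∀ v : Icc (0 : ℝ) q, Measurable (M.B v) := fun v =>
      M.isBrownianMotion.measurable v ⟨v.2.1, v.2.2.trans hq.2⟩
    have hm' : Measurable fun ω => M.B r ω - M.B q ω :=
      (M.isBrownianMotion.measurable r hr).sub (M.isBrownianMotion.measurable q hq)
    apply IsGaussianProcess.indepFun_of_covariance_eq_zero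
    · apply hG.of_isGaussianProcess
      rintro (⟨v, hv⟩ | _)
      · exact ⟨{⟨v, hv.1, hv.2.trans hq.2⟩},
          { toFun x := x ⟨⟨v, hv.1, hv.2.trans hq.2⟩, by simp⟩
            map_add' x y := by simp
            map_smul' c x := by simp }, by simp [X]⟩
      · exact ⟨{⟨q, hq⟩, ⟨r, hr⟩},
          { toFun x := x ⟨⟨r, hr⟩, by simp⟩ - x ⟨⟨q, hq⟩, by simp⟩
            map_add' x y := by simp; abel
            map_smul' c x := by simp; ring }, by simp [X]⟩
    · exact fun v => (hm v).aemeasurable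
    · exact fun _ => hm'.aemeasurable
    · rintro v -
      have h1 := M.isBrownianMotion.indep.indepFun_sub_sub (r := ⟨0, by simp⟩)
        (s := ⟨v, v.2.1, v.2.2.trans hq.2⟩) (t := ⟨q, hq⟩) v.2.1 v.2.2
      have hv1 : (v : ℝ) ∈ Icc (0 : ℝ) 1 := ⟨v.2.1, v.2.2.trans hq.2⟩
      have hin := M.isBrownianMotion.indep.indepFun_eval_sub (r := ⟨0, by simp⟩)
        (s := ⟨v, hv1⟩) (t := ⟨r, hr⟩) v.2.1 (v.2.2.trans hqr) M.isBrownianMotion.zero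
      have hin' := M.isBrownianMotion.indep.indepFun_eval_sub (r := ⟨0, by simp⟩)
        (s := ⟨v, hv1⟩) (t := ⟨q, hq⟩) v.2.1 v.2.2 M.isBrownianMotion.zero
      have m2 : ∀ u ∈ Icc (0 : ℝ) 1, MemLp (M.B u) 2 M.P := fun u hu => (hlaw ⟨u, hu⟩).memLp_two
      have c1 := hin.covariance_eq_zero (m2 v hv1) ((m2 r hr).sub (m2 v hv1))
      have c2 := hin'.covariance_eq_zero (m2 v hv1) ((m2 q hq).sub (m2 v hv1))
      rw [covariance_sub_right (m2 v hv1) (m2 r hr) (m2 v hv1)] at c1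
      rw [covariance_sub_right (m2 v hv1) (m2 q hq) (m2 v hv1)] at c2
      rw [covariance_fun_sub_right (m2 v hv1) (m2 r hr) (m2 q hq)]
      linarith
  exact key.comp measurable_id (measurable_pi_apply ())

/-- The Brownian increment after time `q` is independent of the information at time `q`. -/
lemma indep_filtration {q r : ℝ} (hq : q ∈ Icc (0 : ℝ) 1) (hr : r ∈ Icc (0 : ℝ) 1)
    (hqr : q ≤ r) :
    Indep (M.filtration q)
      (MeasurableSpace.comap (fun ω => M.B r ω - M.B q ω) inferInstance) M.P := by
  have hBm : ∀ v ∈ Icc (0 : ℝ) 1, Measurable[mΩ] (M.B v) := M.isBrownianMotion.measurable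
  have hLm : ∀ v ∈ Icc (0 : ℝ) 1, Measurable[mΩ] (M.L v) := M.isSubordinator.measurable
  have hind := M.indep
  have hpath := M.indepFun_path_increment hq hr hqr
  have hnull := M.nullSets_le
  have hprob := M.isProbabilityMeasure
  -- The data are named before the sub-`σ`-algebras, which become local instances.
  let P := M.P
  let B := M.B
  let L := M.L
  let m₁ := MeasurableSpace.comap (fun ω (v : Icc (0 : ℝ) q) => B v ω) inferInstance
  let m₂ := MeasurableSpace.comap (fun ω => B r ω - B q ω) inferInstance
  let m₃ := MeasurableSpace.comap (fun ω (v : Icc (0 : ℝ) 1) => L v ω) inferInstance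
  let mB := MeasurableSpace.comap (fun ω (v : Icc (0 : ℝ) 1) => B v ω) inferInstance
  let m₄ := MeasurableSpace.generateFrom {N | P N = 0}
  have hB1 : ∀ v ∈ Icc (0 : ℝ) 1, Measurable[mB] (B v) := fun v hv =>
    measurable_comap_eval (fun v : Icc (0 : ℝ) 1 => B v) ⟨v, hv⟩
  have l1 : m₁ ≤ mB := by
    rw [← measurable_iff_comap_le]
    exact @measurable_pi_lambda _ _ _ mB _ _ fun v => hB1 v ⟨v.2.1, v.2.2.trans hq.2⟩
  have l2 : m₂ ≤ mB := by
    rw [← measurable_iff_comap_le]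
    exact (hB1 r hr).sub (hB1 q hq)
  have hmBle : mB ≤ mΩ := by
    rw [← measurable_iff_comap_le]
    exact @measurable_pi_lambda _ _ _ mΩ _ _ fun v => hBm v v.2
  have hm₃le : m₃ ≤ mΩ := by
    rw [← measurable_iff_comap_le]
    exact @measurable_pi_lambda _ _ _ mΩ _ _ fun v => hLm v v.2
  have i1 : Indep (m₁ ⊔ m₃) m₂ P :=
    indep_sup_of_indep_sup (l1.trans hmBle) (l2.trans hmBle) hm₃le
      hpath
      (indep_of_indep_of_le_left hind (sup_le l1 l2))
  have i2 : Indep ((m₁ ⊔ m₃) ⊔ m₂) m₄ P := by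
    refine IndepSets.indep (sup_le (sup_le (l1.trans hmBle) hm₃le) (l2.trans hmBle)) hnull
      (@MeasurableSpace.isPiSystem_measurableSet Ω ((m₁ ⊔ m₃) ⊔ m₂))
      (p2 := {N | P N = 0}) ?_
      (@MeasurableSpace.generateFrom_measurableSet Ω ((m₁ ⊔ m₃) ⊔ m₂)).symm rfl ?_
    · intro s hs u hu _
      exact measure_mono_null inter_subset_left hs
    · rw [IndepSets_iff]
      intro s u hs hu
      have hu' : P u = 0 := hu
      rw [hu', mul_zero]
      exact measure_mono_null inter_subset_right hu'
  have i3 : Indep ((m₁ ⊔ m₃) ⊔ m₄) m₂ P :=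
    indep_sup_of_indep_sup (sup_le (l1.trans hmBle) hm₃le) (l2.trans hmBle) hnull i1 i2
  refine indep_of_indep_of_le_left i3 (sup_le_sup_right (iSup₂_le fun v hv => sup_le ?_ ?_) _)
  · refine le_sup_of_le_left ?_
    rw [← measurable_iff_comap_le]
    exact measurable_comap_eval (fun v : Icc (0 : ℝ) q => B v) ⟨v, hv⟩
  · refine le_sup_of_le_right ?_
    rw [← measurable_iff_comap_le]
    exact measurable_comap_eval (fun v : Icc (0 : ℝ) 1 => L v) ⟨v, hv.1, hv.2.trans hq.2⟩

lemma memLp_increment {q r : ℝ} (hq : q ∈ Icc (0 : ℝ) 1) (hr : r ∈ Icc (0 : ℝ) 1)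
    (hqr : q ≤ r) : MemLp (fun ω => M.B r ω - M.B q ω) 2 M.P :=
  (M.isBrownianMotion.law q hq r hr hqr).hasGaussianLaw.memLp_two

lemma integral_increment {q r : ℝ} (hq : q ∈ Icc (0 : ℝ) 1) (hr : r ∈ Icc (0 : ℝ) 1)
    (hqr : q ≤ r) : ∫ ω, (M.B r ω - M.B q ω) ∂M.P = 0 := by
  rw [(M.isBrownianMotion.law q hq r hr hqr).integral_eq, integral_id_gaussianReal]

lemma integral_increment_sq {q r : ℝ} (hq : q ∈ Icc (0 : ℝ) 1) (hr : r ∈ Icc (0 : ℝ) 1)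
    (hqr : q ≤ r) : ∫ ω, (M.B r ω - M.B q ω) ^ 2 ∂M.P = r - q := by
  have h := (M.isBrownianMotion.law q hq r hr hqr).variance_eq
  rw [variance_id_gaussianReal, variance_of_integral_eq_zero
    (M.memLp_increment hq hr hqr).aestronglyMeasurable.aemeasurable
    (M.integral_increment hq hr hqr)] at h
  rw [h, Real.coe_toNNReal _ (by linarith)]

end Model


/-! ### Stochastic integrals of step processes: isometry and maximal inequality -/

lemma abs_cut_le {Ω : Type*} {a b C : ℝ} {n : ℕ} {h : ℕ → Ω → ℝ}
    (hC : ∀ i ω, |h i ω| ≤ C) (r : ℝ) (i : ℕ) (ω : Ω) :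
    |if gridPt a b n i ≤ r then h i ω else 0| ≤ C := by
  split_ifs
  · exact hC i ω
  · simpa using (abs_nonneg _).trans (hC i ω)

namespace Model

variable {Ω : Type*} [mΩ : MeasurableSpace Ω] (M : Model Ω)

/-- The martingale transform `∑ i < k, h i * (B (q (i + 1)) - B (q i))`. -/
noncomputable def transform (q : ℕ → ℝ) (h : ℕ → Ω → ℝ) (k : ℕ) (ω : Ω) : ℝ :=
  ∑ i ∈ Finset.range k, h i ω * (M.B (q (i + 1)) ω - M.B (q i) ω)

section Transform

variable {M} {q : ℕ → ℝ} {h : ℕ → Ω → ℝ} {C : ℝ}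

lemma integral_mul_increment {r s : ℝ} (hr : r ∈ Icc (0 : ℝ) 1) (hs : s ∈ Icc (0 : ℝ) 1)
    (hrs : r ≤ s) {X : Ω → ℝ} (hX : Measurable[M.filtration r] X) :
    ∫ ω, X ω * (M.B s ω - M.B r ω) ∂M.P = 0 := by
  have hind : IndepFun X (fun ω => M.B s ω - M.B r ω) M.P :=
    indep_of_indep_of_le_left (M.indep_filtration hr hs hrs) hX.comap_le
  rw [hind.integral_fun_mul_eq_mul_integral
    (hX.mono (M.filtration_le hr.2) le_rfl).aestronglyMeasurable
    (M.memLp_increment hr hs hrs).aestronglyMeasurable, M.integral_increment hr hs hrs, mul_zero]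

lemma integral_mul_increment_sq {r s : ℝ} (hr : r ∈ Icc (0 : ℝ) 1) (hs : s ∈ Icc (0 : ℝ) 1)
    (hrs : r ≤ s) {X : Ω → ℝ} (hX : Measurable[M.filtration r] X) :
    ∫ ω, (X ω * (M.B s ω - M.B r ω)) ^ 2 ∂M.P = (∫ ω, X ω ^ 2 ∂M.P) * (s - r) := by
  have hind : IndepFun X (fun ω => M.B s ω - M.B r ω) M.P :=
    indep_of_indep_of_le_left (M.indep_filtration hr hs hrs) hX.comap_le
  have hind2 := hind.comp (φ := fun x => x ^ 2) (ψ := fun x => x ^ 2) (by fun_prop) (by fun_prop)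
  have hX' : Measurable X := hX.mono (M.filtration_le hr.2) le_rfl
  have hB := (M.memLp_increment hr hs hrs).aestronglyMeasurable
  simp only [mul_pow]
  have := hind2.integral_fun_mul_eq_mul_integral (hX'.pow_const 2).aestronglyMeasurable
    (hB.pow 2)
  simp only [Function.comp_apply] at this
  rw [this]
  congr 1
  exact M.integral_increment_sq hr hs hrs

variable (hq : Monotone q) (hq01 : ∀ i, q i ∈ Icc (0 : ℝ) 1)
  (hh : ∀ i, Measurable[M.filtration (q i)] (h i)) (hC : ∀ i ω, |h i ω| ≤ C)

include hq hq01 hh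

lemma measurable_transform (k : ℕ) : Measurable[M.filtration (q k)] (M.transform q h k) := by
  unfold transform
  refine Finset.measurable_fun_sum _ fun i hi => ?_
  have hi := Finset.mem_range.1 hi
  exact ((hh i).mono (M.filtration_mono (hq hi.le)) le_rfl).mul
    ((M.measurable_B (hq01 _).1 (hq hi)).sub (M.measurable_B (hq01 _).1 (hq hi.le)))

include hC

lemma memLp_mul_increment (i : ℕ) :
    MemLp (fun ω => h i ω * (M.B (q (i + 1)) ω - M.B (q i) ω)) 2 M.P := by
  have hB := M.memLp_increment (hq01 i) (hq01 (i + 1)) (hq i.le_succ)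
  have hm : Measurable (h i) := (hh i).mono (M.filtration_le (hq01 i).2) le_rfl
  refine hB.of_le_mul (c := C) (hm.aestronglyMeasurable.mul hB.aestronglyMeasurable)
    (Eventually.of_forall fun ω => ?_)
  rw [norm_mul]
  exact mul_le_mul_of_nonneg_right (hC i ω) (norm_nonneg _)

lemma memLp_transform (k : ℕ) : MemLp (M.transform q h k) 2 M.P :=
  memLp_finsetSum _ fun i _ => memLp_mul_increment hq hq01 hh hC i

/-- The isometry for martingale transforms: the cross terms vanish because each increment is
centred and independent of the past. -/
lemma integral_transform_sq (k : ℕ) :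
    ∫ ω, M.transform q h k ω ^ 2 ∂M.P =
      ∑ i ∈ Finset.range k, (∫ ω, h i ω ^ 2 ∂M.P) * (q (i + 1) - q i) := by
  induction k with
  | zero => simp [transform]
  | succ k ih =>
    have hT := memLp_transform hq hq01 hh hC k
    have hI := memLp_mul_increment hq hq01 hh hC k
    have hcross : ∫ ω, M.transform q h k ω * (h k ω * (M.B (q (k + 1)) ω - M.B (q k) ω)) ∂M.P
        = 0 := by
      simp only [← mul_assoc]
      exact integral_mul_increment (hq01 k) (hq01 (k + 1)) (hq k.le_succ)
        ((measurable_transform hq hq01 hh k).mul (hh k))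
    have e : ∀ ω, M.transform q h (k + 1) ω ^ 2 = M.transform q h k ω ^ 2 +
        (h k ω * (M.B (q (k + 1)) ω - M.B (q k) ω)) ^ 2 +
        2 * (M.transform q h k ω * (h k ω * (M.B (q (k + 1)) ω - M.B (q k) ω))) := by
      intro ω
      simp only [transform, Finset.sum_range_succ]
      ring
    simp only [e]
    rw [integral_add, integral_add, integral_const_mul, hcross, ih, Finset.sum_range_succ,
      integral_mul_increment_sq (hq01 k) (hq01 (k + 1)) (hq k.le_succ) (hh k), mul_zero, add_zero]
    · exact hT.integrable_sq
    · exact hI.integrable_sq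
    · exact hT.integrable_sq.add hI.integrable_sq
    · exact (hT.integrable_mul hI).const_mul 2

lemma martingale_transform :
    Martingale (M.transform q h)
      ⟨fun k => M.filtration (q k), fun _ _ hij => M.filtration_mono (hq hij),
        fun k => M.filtration_le (hq01 k).2⟩ M.P := by
  refine martingale_of_setIntegral_eq_succ
    (fun k => (measurable_transform hq hq01 hh k).stronglyMeasurable)
    (fun k => (memLp_transform hq hq01 hh hC k).integrable one_le_two) fun k s hs => ?_
  have hs' : MeasurableSet[M.filtration (q k)] s := hs
  have hs0 : MeasurableSet s := M.filtration_le (hq01 k).2 _ hs'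
  have hT := (memLp_transform hq hq01 hh hC k).integrable one_le_two
  have hI := (memLp_mul_increment hq hq01 hh hC k).integrable one_le_two
  have e : ∀ ω, M.transform q h (k + 1) ω = M.transform q h k ω +
      h k ω * (M.B (q (k + 1)) ω - M.B (q k) ω) := fun ω => by
    simp only [transform, Finset.sum_range_succ]
  simp only [e]
  rw [integral_add hT.integrableOn hI.integrableOn, left_eq_add, ← integral_indicator hs0]
  rw [← integral_mul_increment (hq01 k) (hq01 (k + 1)) (hq k.le_succ) ((hh k).indicator hs')]
  refine integral_congr_ae (Eventually.of_forall fun ω => ?_)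
  by_cases hω : ω ∈ s <;> simp [hω]

/-- Doob's maximal inequality for martingale transforms, combined with
`|x| ≤ (c + x ^ 2 / c) / 2`. -/
lemma maximal_transform (N : ℕ) {ε c : ℝ} (hε : 0 < ε) (hc : 0 < c) :
    ENNReal.ofReal ε * M.P {ω | ∃ k ≤ N, ε ≤ |M.transform q h k ω|} ≤
      ENNReal.ofReal ((c + (∫ ω, M.transform q h N ω ^ 2 ∂M.P) / c) / 2) := by
  have hmart := martingale_transform hq hq01 hh hC
  have hsub : Submartingale (fun k ω => |M.transform q h k ω|) _ M.P :=
    hmart.submartingale.sup hmart.neg.submartingale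
  have hmax := maximal_ineq hsub (fun k ω => abs_nonneg _) (ε := ε.toNNReal) N
  have hLp := memLp_transform hq hq01 hh hC N
  have hint : Integrable (fun ω => |M.transform q h N ω|) M.P := (hLp.integrable one_le_two).abs
  rw [Real.coe_toNNReal ε hε.le] at hmax
  refine le_trans (le_trans (mul_le_mul_right (measure_mono ?_) _) hmax)
    (ENNReal.ofReal_le_ofReal ?_)
  · rintro ω ⟨k, hk, hω⟩
    exact Finset.le_sup'_of_le (fun k => |M.transform q h k ω|)
      (Finset.mem_range.2 (Nat.lt_succ_of_le hk)) hω
  · calc _ ≤ ∫ ω, |M.transform q h N ω| ∂M.P :=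
          setIntegral_le_integral hint (Eventually.of_forall fun ω => abs_nonneg _)
      _ ≤ ∫ ω, (c + M.transform q h N ω ^ 2 / c) / 2 ∂M.P := by
          refine integral_mono hint (((integrable_const c).add
            (hLp.integrable_sq.div_const c)).div_const 2) fun ω => ?_
          have h1 : 0 ≤ (|M.transform q h N ω| - c) ^ 2 / c := by positivity
          have h2 : (|M.transform q h N ω| - c) ^ 2 / c =
              M.transform q h N ω ^ 2 / c - 2 * |M.transform q h N ω| + c := by
            rw [sub_sq, sq_abs]; field_simp
          simp only
          linarith
      _ = _ := by
          rw [integral_div, integral_add (integrable_const c) (hLp.integrable_sq.div_const c),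
            integral_div]
          simp

end Transform

section StepSum

variable {M} {a b : ℝ} {n : ℕ} {h : ℕ → Ω → ℝ} {C : ℝ}

/-- A step integral over `(a, r]` is a martingale transform; the values on steps beyond `r` are
replaced by `0` so that they are measurable for the information at the cut grid point. -/
lemma stepSum_eq_transform (hab : a ≤ b) (r : ℝ) (ω : Ω) :
    stepSum a b n (fun v => M.B v ω) (fun i => h i ω) r =
      M.transform (fun i => min (gridPt a b n i) r)
        (fun i ω => if gridPt a b n i ≤ r then h i ω else 0) n ω := by
  unfold stepSum transform
  refine Finset.sum_congr rfl fun i _ => ?_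
  by_cases hi : gridPt a b n i ≤ r
  · simp [hi]
  · simp only [hi, if_false, zero_mul]
    rw [min_eq_right (not_le.1 hi).le,
      min_eq_right ((not_le.1 hi).le.trans (gridPt_mono hab i.le_succ)), sub_self, mul_zero]

lemma monotone_cut (hab : a ≤ b) (r : ℝ) : Monotone fun i => min (gridPt a b n i) r :=
  fun _ _ hij => min_le_min (gridPt_mono hab hij) le_rfl

lemma cut_mem (ha : 0 ≤ a) (hab : a < b) (hb : b ≤ 1) (hn : 0 < n) {r : ℝ} (hr : r ∈ Icc a b)
    (i : ℕ) : min (gridPt a b n i) r ∈ Icc (0 : ℝ) 1 :=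
  ⟨le_min (ha.trans (gridPt_mem hab.le hn i).1) (ha.trans hr.1),
    (min_le_right _ _).trans (hr.2.trans hb)⟩

lemma measurable_cut (hh : ∀ i, Measurable[M.filtration (gridPt a b n i)] (h i)) (r : ℝ) (i : ℕ) :
    Measurable[M.filtration (min (gridPt a b n i) r)]
      (fun ω => if gridPt a b n i ≤ r then h i ω else 0) := by
  by_cases hi : gridPt a b n i ≤ r
  · simp only [hi, if_true]
    rw [min_eq_left hi]
    exact hh i
  · simp only [hi, if_false]
    exact measurable_const

variable (ha : 0 ≤ a) (hab : a < b) (hb : b ≤ 1) (hn : 0 < n)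
  (hh : ∀ i, Measurable[M.filtration (gridPt a b n i)] (h i))
include ha hab hb hn hh

lemma measurable_stepSum {r : ℝ} (hr : r ∈ Icc a b) : Measurable[M.filtration r]
    (fun ω => stepSum a b n (fun v => M.B v ω) (fun i => h i ω) r) := by
  have := measurable_transform (M := M) (monotone_cut hab.le r) (cut_mem ha hab hb hn hr)
    (measurable_cut hh r) n
  have e : min (gridPt a b n n) r = r := by rw [gridPt_last hn, min_eq_right hr.2]
  simp only [stepSum_eq_transform hab.le]
  rw [e] at this
  exact this

variable (hC : ∀ i ω, |h i ω| ≤ C)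
include hC

lemma memLp_stepSum {r : ℝ} (hr : r ∈ Icc a b) :
    MemLp (fun ω => stepSum a b n (fun v => M.B v ω) (fun i => h i ω) r) 2 M.P := by
  simp only [stepSum_eq_transform hab.le]
  exact memLp_transform (monotone_cut hab.le r) (cut_mem ha hab hb hn hr)
    (measurable_cut hh r) (abs_cut_le hC r) n

/-- The Itô isometry for step integrals. -/
lemma lintegral_stepSum_sq {r : ℝ} (hr : r ∈ Icc a b) :
    ∫⁻ ω, ENNReal.ofReal (stepSum a b n (fun v => M.B v ω) (fun i => h i ω) r ^ 2) ∂M.P =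
      ∫⁻ ω, ∫⁻ v in Ioc a r, ENNReal.ofReal (h (gridIdx a b n v) ω ^ 2) ∂volume ∂M.P := by
  have hm : ∀ i, Measurable (h i) := fun i =>
    (hh i).mono (M.filtration_le ((gridPt_mem hab.le hn i).2.trans hb)) le_rfl
  have hsq : ∀ i ω, h i ω ^ 2 ≤ C ^ 2 := fun i ω => sq_le_sq' (abs_le.1 (hC i ω)).1
    (abs_le.1 (hC i ω)).2
  have hint : ∀ i, Integrable (fun ω => h i ω ^ 2) M.P := fun i =>
    Integrable.of_bound ((hm i).pow_const 2).aestronglyMeasurable (C ^ 2)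
      (Eventually.of_forall fun ω => by
        rw [Real.norm_of_nonneg (sq_nonneg _)]; exact hsq i ω)
  have hpath : ∀ ω, ∫⁻ v in Ioc a r, ENNReal.ofReal (h (gridIdx a b n v) ω ^ 2) =
      ENNReal.ofReal (stepSum a b n id (fun i => h i ω ^ 2) r) := fun ω =>
    lintegral_grid_sq hab hn (fun i => hC i ω) hr
  have hmono := monotone_cut (n := n) hab.le r
  have hstep_nonneg : ∀ ω, 0 ≤ stepSum a b n id (fun i => h i ω ^ 2) r := fun ω =>
    Finset.sum_nonneg fun i _ => mul_nonneg (sq_nonneg _) (sub_nonneg.2 (hmono i.le_succ))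
  have hstep_int : Integrable (fun ω => stepSum a b n id (fun i => h i ω ^ 2) r) M.P :=
    integrable_finsetSum _ fun i _ => (hint i).mul_const _
  simp only [hpath]
  rw [← ofReal_integral_eq_lintegral_ofReal (memLp_stepSum ha hab hb hn hh hC hr).integrable_sq
      (Eventually.of_forall fun _ => sq_nonneg _),
    ← ofReal_integral_eq_lintegral_ofReal hstep_int (Eventually.of_forall hstep_nonneg)]
  congr 1
  simp only [stepSum_eq_transform hab.le]
  rw [integral_transform_sq (monotone_cut hab.le r) (cut_mem ha hab hb hn hr)
    (measurable_cut hh r) (abs_cut_le hC r)]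
  unfold stepSum
  rw [integral_finsetSum _ fun i _ => (hint i).mul_const _]
  refine Finset.sum_congr rfl fun i _ => ?_
  rw [integral_mul_const]
  by_cases hi : gridPt a b n i ≤ r
  · simp [hi]
  · rw [min_eq_right (not_le.1 hi).le,
      min_eq_right ((not_le.1 hi).le.trans (gridPt_mono hab.le i.le_succ))]
    simp

/-- The maximal inequality for step integrals over a whole interval: by continuity of the paths
the supremum is the limit of the maxima over the refined grids. -/
lemma maximal_stepSum {ε c K : ℝ} (hε : 0 < ε) (hc : 0 < c) (hK : 0 ≤ K)
    (hD : ∫⁻ ω, ∫⁻ v in Ioc a b, ENNReal.ofReal (h (gridIdx a b n v) ω ^ 2) ∂volume ∂M.P ≤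
      ENNReal.ofReal (K * c ^ 2)) :
    M.P {ω | ∃ r ∈ Icc a b, ε < |stepSum a b n (fun v => M.B v ω) (fun i => h i ω) r|} ≤
      ENNReal.ofReal ((1 + K) / 2 * (c / ε)) := by
  set f : Ω → ℝ → ℝ := fun ω => stepSum a b n (fun v => M.B v ω) (fun i => h i ω) with hf
  let E : ℕ → Set Ω := fun m => {ω | ∃ k ≤ n * 2 ^ m, ε ≤ |f ω (gridPt a b (n * 2 ^ m) k)|}
  have hpow : ∀ m : ℕ, 0 < n * 2 ^ m := fun m => by positivity
  have hEmono : Monotone E := by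
    refine monotone_nat_of_le_succ fun m ω => ?_
    rintro ⟨k, hk, hω⟩
    refine ⟨k * 2, ?_, ?_⟩
    · rw [pow_succ, ← mul_assoc]; omega
    · rw [pow_succ, ← mul_assoc, gridPt_mul (hpow m) two_pos]; exact hω
  have hsub : {ω | ∃ r ∈ Icc a b, ε < |f ω r|} ≤ᵐ[M.P] ⋃ m, E m := by
    filter_upwards [M.isBrownianMotion.continuous] with ω hcont hω
    obtain ⟨r, hr, hεr⟩ := hω
    have hfc : ContinuousOn (f ω) (Icc a b) := continuousOn_stepSum hab.le hn
      (hcont.mono (Icc_subset_Icc ha hb)) _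
    have hra : a < r := by
      refine lt_of_le_of_ne hr.1 fun h => ?_
      rw [← h] at hεr
      simp only [hf, stepSum_left hab.le, abs_zero] at hεr
      exact absurd hεr (not_lt.2 hε.le)
    have hN : Tendsto (fun m : ℕ => n * 2 ^ m) atTop atTop :=
      (tendsto_pow_atTop_atTop_of_one_lt one_lt_two).const_mul_atTop' hn
    have hlim := tendsto_gridPt_idx hab hpow hN ⟨hra, hr.2⟩
    have hlim' : Tendsto (fun m => gridPt a b (n * 2 ^ m) (gridIdx a b (n * 2 ^ m) r)) atTop
        (𝓝[Icc a b] r) :=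
      hlim.mono_right (nhdsWithin_mono _ fun x hx => ⟨hx.1, hx.2.le.trans hr.2⟩)
    have := ((hfc r hr).tendsto.comp hlim').abs.eventually (lt_mem_nhds hεr)
    obtain ⟨m, hm⟩ := this.exists
    exact mem_iUnion.2 ⟨m, _, (gridIdx_lt (hpow m) r).le, le_of_lt hm⟩
  have hD' : ∫ ω, f ω b ^ 2 ∂M.P ≤ K * c ^ 2 := by
    rw [← lintegral_stepSum_sq ha hab hb hn hh hC (right_mem_Icc.2 hab.le),
      ← ofReal_integral_eq_lintegral_ofReal
        (memLp_stepSum ha hab hb hn hh hC (right_mem_Icc.2 hab.le)).integrable_sq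
        (Eventually.of_forall fun _ => sq_nonneg _)] at hD
    exact (ENNReal.ofReal_le_ofReal_iff (by positivity)).1 hD
  have hE : ∀ m, M.P (E m) ≤ ENNReal.ofReal ((1 + K) / 2 * (c / ε)) := by
    intro m
    have hq : 0 < 2 ^ m := by positivity
    let q := gridPt a b (n * 2 ^ m)
    have hval : ∀ ω, ∀ k ≤ n * 2 ^ m, f ω (q k) = M.transform q (fun j => h (j / 2 ^ m)) k ω := by
      intro ω k hk
      simp only [hf, q]
      rw [stepSum_refine hn hq, stepSum_gridPt hab.le hk]
      rfl
    have hq01 : ∀ i, q i ∈ Icc (0 : ℝ) 1 := fun i =>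
      ⟨ha.trans (gridPt_mem hab.le (hpow m) i).1, (gridPt_mem hab.le (hpow m) i).2.trans hb⟩
    have hmax := maximal_transform (M := M) (q := q) (h := fun j => h (j / 2 ^ m))
      (gridPt_mono hab.le) hq01 (fun j => (hh _).mono (M.filtration_mono (by
        rw [← gridPt_mul hn hq]
        exact gridPt_mono hab.le (Nat.div_mul_le_self _ _))) le_rfl)
      (fun j ω => hC _ ω) (n * 2 ^ m) hε hc
    have e1 : {ω | ∃ k ≤ n * 2 ^ m, ε ≤ |M.transform q (fun j => h (j / 2 ^ m)) k ω|} = E m := by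
      ext ω
      refine exists_congr fun k => and_congr_right fun hk => ?_
      rw [← hval ω k hk]
    have e2 : ∀ ω, M.transform q (fun j => h (j / 2 ^ m)) (n * 2 ^ m) ω = f ω b := fun ω => by
      rw [← hval ω _ le_rfl]; simp only [q, gridPt_last (hpow m)]
    simp only [e1, e2] at hmax
    have h2 : (c + (∫ ω, f ω b ^ 2 ∂M.P) / c) / 2 ≤ ε * ((1 + K) / 2 * (c / ε)) := by
      have : (∫ ω, f ω b ^ 2 ∂M.P) / c ≤ K * c := by
        rw [div_le_iff₀ hc]; nlinarith
      have e : ε * ((1 + K) / 2 * (c / ε)) = (c + K * c) / 2 := by field_simp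
      rw [e]; linarith
    have h3 := hmax.trans (ENNReal.ofReal_le_ofReal h2)
    rw [ENNReal.ofReal_mul hε.le] at h3
    exact (ENNReal.mul_le_mul_iff_right (by simpa using hε) ENNReal.ofReal_ne_top).1 h3
  calc _ ≤ M.P (⋃ m, E m) := measure_mono_ae hsub
    _ = ⨆ m, M.P (E m) := hEmono.measure_iUnion
    _ ≤ _ := iSup_le hE

end StepSum

end Model


/-! ### Mean-square convergence of bounded processes -/

section MeanSquare

variable {Ω E : Type*} [MeasurableSpace Ω] [MeasurableSpace E] {μ : Measure Ω} {ν : Measure E}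

/-- Bounded convergence for iterated integrals. -/
lemma tendsto_lintegral_lintegral_sq [IsFiniteMeasure μ] [IsFiniteMeasure ν] {ι : Type*}
    {l : Filter ι} [l.IsCountablyGenerated] {D : ι → Ω → E → ℝ}
    (hD : ∀ p, Measurable (Function.uncurry (D p))) {C : ℝ} (hC : ∀ p ω v, |D p ω v| ≤ C)
    (hlim : ∀ᵐ ω ∂μ, ∀ᵐ v ∂ν, Tendsto (fun p => D p ω v) l (𝓝 0)) :
    Tendsto (fun p => ∫⁻ ω, ∫⁻ v, ENNReal.ofReal (D p ω v ^ 2) ∂ν ∂μ) l (𝓝 0) := by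
  have hsq : ∀ p ω v, ENNReal.ofReal (D p ω v ^ 2) ≤ ENNReal.ofReal (C ^ 2) := fun p ω v =>
    ENNReal.ofReal_le_ofReal (sq_le_sq' (abs_le.1 (hC p ω v)).1 (abs_le.1 (hC p ω v)).2)
  have hm : ∀ p, Measurable (Function.uncurry fun ω v => ENNReal.ofReal (D p ω v ^ 2)) :=
    fun p => ((hD p).pow_const 2).ennreal_ofReal
  have hinner : ∀ᵐ ω ∂μ, Tendsto (fun p => ∫⁻ v, ENNReal.ofReal (D p ω v ^ 2) ∂ν) l (𝓝 0) := by
    filter_upwards [hlim] with ω hω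
    have := tendsto_lintegral_filter_of_dominated_convergence (μ := ν) (l := l)
      (F := fun p v => ENNReal.ofReal (D p ω v ^ 2)) (f := fun _ => 0)
      (fun _ => ENNReal.ofReal (C ^ 2))
      (Eventually.of_forall fun p => (hm p).comp measurable_prodMk_left)
      (Eventually.of_forall fun p => Eventually.of_forall fun v => hsq p ω v)
      (by simpa using ENNReal.mul_ne_top ENNReal.ofReal_ne_top (measure_ne_top ν univ)) (by
        filter_upwards [hω] with v hv
        simpa using ENNReal.tendsto_ofReal (hv.pow 2))
    simpa using this
  have := tendsto_lintegral_filter_of_dominated_convergence (μ := μ) (l := l)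
    (F := fun p ω => ∫⁻ v, ENNReal.ofReal (D p ω v ^ 2) ∂ν) (f := fun _ => 0)
    (fun _ => ENNReal.ofReal (C ^ 2) * ν univ)
    (Eventually.of_forall fun p => (hm p).lintegral_prod_right')
    (Eventually.of_forall fun p => Eventually.of_forall fun ω => by
      simpa using lintegral_mono (μ := ν) fun v => hsq p ω v)
    (by
      rw [lintegral_const]
      exact ENNReal.mul_ne_top (ENNReal.mul_ne_top ENNReal.ofReal_ne_top (measure_ne_top ν univ))
        (measure_ne_top μ univ)) hinner
  simpa using this

lemma tendsto_zero_of_le_liminf {F : ℕ × ℕ → ℝ≥0∞} {f : ℕ → ℝ≥0∞}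
    (hF : Tendsto F (atTop ×ˢ atTop) (𝓝 0)) (hf : ∀ k, f k ≤ liminf (fun m => F (k, m)) atTop) :
    Tendsto f atTop (𝓝 0) := by
  rw [ENNReal.tendsto_nhds_zero] at hF ⊢
  intro ε hε
  have h := hF ε hε
  rw [prod_atTop_atTop_eq, eventually_atTop] at h
  obtain ⟨⟨k₀, m₀⟩, h⟩ := h
  filter_upwards [eventually_ge_atTop k₀] with k hk
  refine (hf k).trans (liminf_le_of_le (by isBoundedDefault) fun c hc => ?_)
  obtain ⟨m, hm, hm'⟩ := (hc.and (eventually_ge_atTop m₀)).exists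
  exact hm.trans (h (k, m) ⟨hk, hm'⟩)

/-- A mean-square Cauchy sequence which converges almost surely converges in mean square. -/
lemma tendsto_lintegral_sq_of_cauchy {Y : ℕ → Ω → ℝ} {Z : Ω → ℝ} (hY : ∀ k, Measurable (Y k))
    (hlim : ∀ᵐ ω ∂μ, Tendsto (fun k => Y k ω) atTop (𝓝 (Z ω)))
    (hcauchy : Tendsto (fun p : ℕ × ℕ => ∫⁻ ω, ENNReal.ofReal ((Y p.1 ω - Y p.2 ω) ^ 2) ∂μ)
      (atTop ×ˢ atTop) (𝓝 0)) :
    Tendsto (fun k => ∫⁻ ω, ENNReal.ofReal ((Y k ω - Z ω) ^ 2) ∂μ) atTop (𝓝 0) := by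
  refine tendsto_zero_of_le_liminf hcauchy fun k => ?_
  refine le_trans (lintegral_mono_ae ?_) (lintegral_liminf_le fun m =>
    (((hY k).sub (hY m)).pow_const 2).ennreal_ofReal)
  filter_upwards [hlim] with ω hω
  exact (ENNReal.tendsto_ofReal ((tendsto_const_nhds.sub hω).pow 2)).liminf_eq.ge

/-- Bounded processes which converge almost everywhere converge in mean square. -/
lemma tendsto_lintegral_lintegral_sq_sub [IsFiniteMeasure μ] [IsFiniteMeasure ν]
    {G : ℕ → Ω → E → ℝ} {f : Ω → E → ℝ} (hG : ∀ k, Measurable (Function.uncurry (G k))) {C : ℝ}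
    (hC : ∀ k ω v, |G k ω v| ≤ C)
    (hlim : ∀ᵐ ω ∂μ, ∀ᵐ v ∂ν, Tendsto (fun k => G k ω v) atTop (𝓝 (f ω v))) :
    Tendsto (fun p : ℕ × ℕ => ∫⁻ ω, ∫⁻ v, ENNReal.ofReal ((G p.1 ω v - G p.2 ω v) ^ 2) ∂ν ∂μ)
      (atTop ×ˢ atTop) (𝓝 0) ∧
    Tendsto (fun k => ∫⁻ ω, ∫⁻ v, ENNReal.ofReal ((G k ω v - f ω v) ^ 2) ∂ν ∂μ) atTop (𝓝 0) := by
  have hcauchy := tendsto_lintegral_lintegral_sq (μ := μ) (ν := ν) (l := atTop ×ˢ atTop)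
    (D := fun p : ℕ × ℕ => fun ω v => G p.1 ω v - G p.2 ω v)
    (fun p => (hG p.1).sub (hG p.2)) (C := C + C)
    (fun p ω v => (abs_sub _ _).trans (add_le_add (hC _ ω v) (hC _ ω v))) (by
      filter_upwards [hlim] with ω hω
      filter_upwards [hω] with v hv
      simpa using (hv.comp tendsto_fst).sub (hv.comp tendsto_snd))
  refine ⟨hcauchy, tendsto_zero_of_le_liminf hcauchy fun k => ?_⟩
  have hm : ∀ k m, Measurable (Function.uncurry fun ω v =>
      ENNReal.ofReal ((G k ω v - G m ω v) ^ 2)) :=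
    fun k m => (((hG k).sub (hG m)).pow_const 2).ennreal_ofReal
  refine le_trans (lintegral_mono_ae ?_) (lintegral_liminf_le fun m =>
    (hm k m).lintegral_prod_right')
  filter_upwards [hlim] with ω hω
  refine le_trans (lintegral_mono_ae ?_) (lintegral_liminf_le fun m =>
    (hm k m).comp measurable_prodMk_left)
  filter_upwards [hω] with v hv
  exact (ENNReal.tendsto_ofReal ((tendsto_const_nhds.sub hv).pow 2)).liminf_eq.ge

/-- Mean squares of limits of bounded processes are measurable. -/
lemma aemeasurable_lintegral_sq_of_tendsto [IsFiniteMeasure ν] {D : ℕ → Ω → E → ℝ}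
    {f : Ω → E → ℝ} (hD : ∀ k, Measurable (Function.uncurry (D k))) {C : ℝ}
    (hC : ∀ k ω v, |D k ω v| ≤ C)
    (hlim : ∀ᵐ ω ∂μ, ∀ᵐ v ∂ν, Tendsto (fun k => D k ω v) atTop (𝓝 (f ω v))) :
    AEMeasurable (fun ω => ∫⁻ v, ENNReal.ofReal (f ω v ^ 2) ∂ν) μ := by
  have hm : ∀ k, Measurable (Function.uncurry fun ω v => ENNReal.ofReal (D k ω v ^ 2)) :=
    fun k => ((hD k).pow_const 2).ennreal_ofReal
  refine aemeasurable_of_tendsto_metrizable_ae atTop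
    (f := fun k ω => ∫⁻ v, ENNReal.ofReal (D k ω v ^ 2) ∂ν)
    (fun k => (hm k).lintegral_prod_right'.aemeasurable) ?_
  filter_upwards [hlim] with ω hω
  refine tendsto_lintegral_of_dominated_convergence (fun _ => ENNReal.ofReal (C ^ 2))
    (fun k => (hm k).comp measurable_prodMk_left) (fun k => Eventually.of_forall fun v =>
      ENNReal.ofReal_le_ofReal (sq_le_sq' (abs_le.1 (hC k ω v)).1 (abs_le.1 (hC k ω v)).2))
    (by simpa using ENNReal.mul_ne_top ENNReal.ofReal_ne_top (measure_ne_top ν univ)) ?_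
  filter_upwards [hω] with v hv
  exact ENNReal.tendsto_ofReal (hv.pow 2)

end MeanSquare

/-- A process which is constant on the steps of a grid is jointly measurable. -/
lemma measurable_uncurry_gridIdx {Ω : Type*} [MeasurableSpace Ω] {a b : ℝ} {n : ℕ} {h : ℕ → Ω → ℝ}
    (hh : ∀ i, Measurable (h i)) : Measurable (Function.uncurry fun ω v => h (gridIdx a b n v) ω) :=
  (measurable_from_prod_countable_left (f := fun p : Ω × ℕ => h p.2 p.1) hh).comp
    (measurable_fst.prodMk (measurable_gridIdx.comp measurable_snd))

namespace Model

/-- One constant for the bounds and the Lipschitz properties of both coefficients. The latter are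
stated through an intermediate point `y`, with a truncated distance from `y` to `z`; this is
possible for bounded Lipschitz functions. -/
structure IsCoefficientBound {Ω : Type*} [MeasurableSpace Ω] (M : Model Ω) (κ : ℝ) : Prop where
  pos : 0 < κ
  σ_le : ∀ x, |M.σ x| ≤ κ
  b_le : ∀ x, |M.b x| ≤ κ
  σ_sub_le : ∀ x y z, |M.σ x - M.σ z| ≤ κ * (|x - y| + min 1 |y - z|)
  b_sub_le : ∀ x y z, |M.b x - M.b z| ≤ κ * (|x - y| + min 1 |y - z|)

lemma exists_coefficientBound {Ω : Type*} [MeasurableSpace Ω] (M : Model Ω) :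
    ∃ κ, M.IsCoefficientBound κ := by
  have key : ∀ f : ℝ → ℝ, (∃ K, LipschitzWith K f) → (∃ C, ∀ x, |f x| ≤ C) →
      ∃ κ, ∀ κ', κ ≤ κ' → (∀ x, |f x| ≤ κ') ∧
        ∀ x y z, |f x - f z| ≤ κ' * (|x - y| + min 1 |y - z|) := by
    rintro f ⟨K, hK⟩ ⟨C, hC⟩
    have hC0 : 0 ≤ C := (abs_nonneg _).trans (hC 0)
    refine ⟨max K (2 * C), fun κ' hκ => ⟨fun x => (hC x).trans ?_, fun x y z => ?_⟩⟩
    · linarith [(le_max_right (K : ℝ) (2 * C)).trans hκ]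
    · have hKκ : (K : ℝ) ≤ κ' := (le_max_left _ _).trans hκ
      have hCκ : 2 * C ≤ κ' := (le_max_right _ _).trans hκ
      have hl : ∀ u v, |f u - f v| ≤ κ' * |u - v| := fun u v => by
        have := hK.dist_le_mul u v
        rw [Real.dist_eq, Real.dist_eq] at this
        exact this.trans (mul_le_mul_of_nonneg_right hKκ (abs_nonneg _))
      have h2 : |f y - f z| ≤ κ' * min 1 |y - z| := by
        rcases min_choice 1 |y - z| with h | h <;> rw [h]
        · linarith [abs_sub (f y) (f z), hC y, hC z]
        · exact hl y z
      calc |f x - f z| ≤ |f x - f y| + |f y - f z| := abs_sub_le _ _ _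
        _ ≤ κ' * |x - y| + κ' * min 1 |y - z| := add_le_add (hl x y) h2
        _ = _ := by ring
  obtain ⟨κ₁, h₁⟩ := key M.σ M.lipschitz_σ M.bounded_σ
  obtain ⟨κ₂, h₂⟩ := key M.b M.lipschitz_b M.bounded_b
  refine ⟨max 1 (max κ₁ κ₂), lt_of_lt_of_le one_pos (le_max_left _ _), ?_, ?_, ?_, ?_⟩
  · exact (h₁ _ ((le_max_left _ _).trans (le_max_right _ _))).1
  · exact (h₂ _ ((le_max_right _ _).trans (le_max_right _ _))).1
  · exact (h₁ _ ((le_max_left _ _).trans (le_max_right _ _))).2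
  · exact (h₂ _ ((le_max_right _ _).trans (le_max_right _ _))).2

end Model


/-! ### Discretized Picard iteration -/

lemma lintegral_lintegral_const_mul_add {Ω E : Type*} [MeasurableSpace Ω] [MeasurableSpace E]
    {μ : Measure Ω} {ν : Measure E} [SFinite ν] {f g : Ω → E → ℝ≥0∞}
    (hf : Measurable (Function.uncurry f)) {c : ℝ≥0∞} (hc : c ≠ ∞) :
    ∫⁻ ω, ∫⁻ v, c * (f ω v + g ω v) ∂ν ∂μ =
      c * ((∫⁻ ω, ∫⁻ v, f ω v ∂ν ∂μ) + ∫⁻ ω, ∫⁻ v, g ω v ∂ν ∂μ) := by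
  have hfω : ∀ ω, Measurable (f ω) := fun ω => hf.comp measurable_prodMk_left
  have hf' : Measurable fun ω => ∫⁻ v, f ω v ∂ν := hf.lintegral_prod_right'
  rw [← lintegral_add_left hf', ← lintegral_const_mul' _ _ hc]
  refine lintegral_congr fun ω => ?_
  rw [lintegral_const_mul' _ _ hc, lintegral_add_left (hfω ω)]

namespace Model

variable {Ω : Type*} [mΩ : MeasurableSpace Ω] (M : Model Ω)

/-- One step of the discretized Picard iteration for `X = η + ∫ σ(X) dB + ∫ b(X) dr` on `[a, b]`:
the coefficients are frozen at the left points of the grid with `n` steps. -/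
noncomputable def eulerStep (a b : ℝ) (η X : ℝ → Ω → ℝ) (n : ℕ) (r : ℝ) (ω : Ω) : ℝ :=
  η r ω + stepSum a b n (fun v => M.B v ω) (fun i => M.σ (X (gridPt a b n i) ω)) r +
    stepSum a b n id (fun i => M.b (X (gridPt a b n i) ω)) r

/-- An adapted process on `[a, b]` whose paths are almost surely left-continuous at almost every
time. -/
structure IsGridRegular (a b : ℝ) (X : ℝ → Ω → ℝ) : Prop where
  adapted : ∀ r ∈ Icc a b, Measurable[M.filtration r] (X r)
  leftCont : ∀ᵐ ω ∂M.P, ∀ᵐ v ∂volume.restrict (Ioc a b),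
    Tendsto (fun r => X r ω) (𝓝[Ico a v] v) (𝓝 (X v ω))

/-- The mean-square distance of two samplings of a process, at the left points of the grids with `n`
and with `m` steps. It is truncated at `1`, since the process need not have any moments. -/
noncomputable def sampleDist (a b : ℝ) (X : ℝ → Ω → ℝ) (n m : ℕ) : ℝ≥0∞ :=
  ∫⁻ ω, ∫⁻ v in Ioc a b, ENNReal.ofReal ((min 1 |X (gridPt a b n (gridIdx a b n v)) ω -
    X (gridPt a b m (gridIdx a b m v)) ω|) ^ 2) ∂volume ∂M.P

section Scheme

variable {M} {a b : ℝ} (ha : 0 ≤ a) (hab : a < b) (hb : b ≤ 1)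

lemma measurable_σ : Measurable M.σ := by
  obtain ⟨K, hK⟩ := M.lipschitz_σ; exact hK.continuous.measurable

lemma measurable_b : Measurable M.b := by
  obtain ⟨K, hK⟩ := M.lipschitz_b; exact hK.continuous.measurable

include hab hb in
lemma measurable_gridPt {X : ℝ → Ω → ℝ}
    (hX : ∀ r ∈ Icc a b, Measurable[M.filtration r] (X r)) {n : ℕ} (hn : 0 < n) (i : ℕ) :
    Measurable (X (gridPt a b n i)) :=
  (hX _ (gridPt_mem hab.le hn i)).mono
    (M.filtration_le ((gridPt_mem hab.le hn i).2.trans hb)) le_rfl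

include hab hb in
/-- By bounded convergence, samplings on fine dyadic grids are close to each other. -/
lemma exists_level {X : ℝ → Ω → ℝ} (hX : M.IsGridRegular a b X) {ε : ℝ} (hε : 0 < ε) :
    ∃ N, ∀ p q, N ≤ p → N ≤ q → M.sampleDist a b X (2 ^ p) (2 ^ q) ≤ ENNReal.ofReal ε := by
  have hpow : ∀ p : ℕ, 0 < 2 ^ p := fun p => by positivity
  have hlim := tendsto_lintegral_lintegral_sq (μ := M.P) (ν := volume.restrict (Ioc a b))
    (l := (atTop : Filter ℕ) ×ˢ (atTop : Filter ℕ))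
    (D := fun p : ℕ × ℕ => fun ω v => min 1 |X (gridPt a b (2 ^ p.1) (gridIdx a b (2 ^ p.1) v)) ω -
      X (gridPt a b (2 ^ p.2) (gridIdx a b (2 ^ p.2) v)) ω|)
    (fun p => measurable_const.min (_root_.measurable_norm.comp
      ((measurable_uncurry_gridIdx (fun i => measurable_gridPt hab hb hX.adapted
        (hpow p.1) i)).sub (measurable_uncurry_gridIdx
          (fun i => measurable_gridPt hab hb hX.adapted (hpow p.2) i)))))
    (C := 1) (fun p ω v => by
      rw [abs_of_nonneg (le_min zero_le_one (abs_nonneg _))]; exact min_le_left _ _) (by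
      filter_upwards [hX.leftCont] with ω hω
      filter_upwards [hω, ae_restrict_mem measurableSet_Ioc] with v hv hvm
      have h1 : Tendsto (fun p : ℕ => X (gridPt a b (2 ^ p) (gridIdx a b (2 ^ p) v)) ω) atTop
          (𝓝 (X v ω)) := hv.comp (tendsto_gridPt_idx hab hpow
            (tendsto_pow_atTop_atTop_of_one_lt one_lt_two) hvm)
      have h2 := ((h1.comp tendsto_fst).sub (h1.comp (tendsto_snd (f := (atTop : Filter ℕ))
        (g := (atTop : Filter ℕ))))).abs
      simp only [sub_self, abs_zero] at h2
      simpa using (tendsto_const_nhds (x := (1 : ℝ))).min h2)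
  rw [ENNReal.tendsto_nhds_zero] at hlim
  have h := hlim (ENNReal.ofReal ε) (by simpa using hε)
  rw [prod_atTop_atTop_eq, eventually_atTop] at h
  obtain ⟨⟨k₀, m₀⟩, h⟩ := h
  exact ⟨max k₀ m₀, fun p q hp hq => h (p, q)
    ⟨(le_max_left _ _).trans hp, (le_max_right _ _).trans hq⟩⟩

include ha hab hb

lemma eulerStep_adapted {η X : ℝ → Ω → ℝ} (hη : ∀ r ∈ Icc a b, Measurable[M.filtration r] (η r))
    (hX : ∀ r ∈ Icc a b, Measurable[M.filtration r] (X r)) {n : ℕ} (hn : 0 < n) {r : ℝ}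
    (hr : r ∈ Icc a b) : Measurable[M.filtration r] (M.eulerStep a b η X n r) := by
  have h1 : Measurable[M.filtration r] fun ω => stepSum a b n (fun v => M.B v ω)
      (fun i => M.σ (X (gridPt a b n i) ω)) r :=
    measurable_stepSum ha hab hb hn
      (fun i => measurable_σ.comp (hX _ (gridPt_mem hab.le hn i))) hr
  have h2 : Measurable[M.filtration r] fun ω => stepSum a b n id
      (fun i => M.b (X (gridPt a b n i) ω)) r := by
    unfold stepSum
    refine Finset.measurable_fun_sum _ fun i _ => ?_
    by_cases hi : gridPt a b n i ≤ r
    · exact ((measurable_b.comp (hX _ (gridPt_mem hab.le hn i))).mono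
        (M.filtration_mono hi) le_rfl).mul_const _
    · rw [min_eq_right (not_le.1 hi).le,
        min_eq_right ((not_le.1 hi).le.trans (gridPt_mono hab.le i.le_succ)), sub_self]
      simp
  exact ((hη r hr).add h1).add h2

lemma eulerStep_sub_continuousOn (η X : ℝ → Ω → ℝ) {n : ℕ} (hn : 0 < n) : ∀ᵐ ω ∂M.P,
    ContinuousOn (fun r => M.eulerStep a b η X n r ω - η r ω) (Icc a b) := by
  filter_upwards [M.isBrownianMotion.continuous] with ω hω
  have h1 := continuousOn_stepSum hab.le hn (hω.mono (Icc_subset_Icc ha hb))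
    (fun i => M.σ (X (gridPt a b n i) ω))
  have h2 := continuousOn_stepSum hab.le hn continuousOn_id (fun i => M.b (X (gridPt a b n i) ω))
  refine (h1.add h2).congr fun r _ => ?_
  simp only [eulerStep, Pi.add_apply]
  ring

lemma eulerStep_regular {η X : ℝ → Ω → ℝ} (hη : M.IsGridRegular a b η)
    (hX : M.IsGridRegular a b X) {n : ℕ} (hn : 0 < n) :
    M.IsGridRegular a b (M.eulerStep a b η X n) := by
  refine ⟨fun r hr => eulerStep_adapted ha hab hb hη.adapted hX.adapted hn hr, ?_⟩
  filter_upwards [eulerStep_sub_continuousOn ha hab hb η X hn, hη.leftCont] with ω h1 h2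
  filter_upwards [h2, ae_restrict_mem measurableSet_Ioc] with v hv hvm
  have h3 : Tendsto (fun r => M.eulerStep a b η X n r ω - η r ω) (𝓝[Ico a v] v)
      (𝓝 (M.eulerStep a b η X n v ω - η v ω)) :=
    ((h1 v ⟨hvm.1.le, hvm.2⟩).mono fun x hx => ⟨hx.1, hx.2.le.trans hvm.2⟩).tendsto
  simpa using h3.add hv

/-- The iteration, with the level of the `k`-th step chosen so fine that the next iterate sampled
on all finer grids is known up to an error `64⁻ᵏ`. -/
lemma exists_scheme {η : ℝ → Ω → ℝ} (hη : M.IsGridRegular a b η) :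
    ∃ (X : ℕ → ℝ → Ω → ℝ) (N : ℕ → ℕ), X 0 = η ∧
      (∀ k, X (k + 1) = M.eulerStep a b η (X k) (2 ^ N k)) ∧ (∀ k, M.IsGridRegular a b (X k)) ∧
      StrictMono N ∧
      ∀ k, M.sampleDist a b (X k) (2 ^ N (k + 1)) (2 ^ N k) ≤ ENNReal.ofReal ((1 / 64) ^ k) := by
  have hlev : ∀ X : ℝ → Ω → ℝ, ∀ k : ℕ, ∃ N, M.IsGridRegular a b X → ∀ p q, N ≤ p → N ≤ q →
      M.sampleDist a b X (2 ^ p) (2 ^ q) ≤ ENNReal.ofReal ((1 / 64) ^ k) := by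
    intro X k
    by_cases hX : M.IsGridRegular a b X
    · obtain ⟨N, hN⟩ := exists_level hab hb hX (ε := (1 / 64) ^ k) (by positivity)
      exact ⟨N, fun _ => hN⟩
    · exact ⟨0, fun h => absurd h hX⟩
  choose lev hlev using hlev
  let S : ℕ → (ℝ → Ω → ℝ) × ℕ := fun k => Nat.rec (η, lev η 0)
    (fun k s => (M.eulerStep a b η s.1 (2 ^ s.2),
      max (s.2 + 1) (lev (M.eulerStep a b η s.1 (2 ^ s.2)) (k + 1)))) k
  have hreg : ∀ k, M.IsGridRegular a b (S k).1 := by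
    intro k
    induction k with
    | zero => exact hη
    | succ k ih => exact eulerStep_regular ha hab hb hη ih (by positivity)
  have hmono : StrictMono fun k => (S k).2 :=
    strictMono_nat_of_lt_succ fun k => lt_of_lt_of_le (Nat.lt_succ_self _) (le_max_left _ _)
  have hle : ∀ k, lev (S k).1 k ≤ (S k).2 := by
    intro k
    cases k with
    | zero => exact le_rfl
    | succ k => exact le_max_right _ _
  exact ⟨fun k => (S k).1, fun k => (S k).2, rfl, fun k => rfl, hreg, hmono, fun k =>
    hlev _ k (hreg k) _ _ ((hle k).trans (hmono.monotone k.le_succ)) (hle k)⟩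

/-- The mean square of the increment generated by step coefficients. -/
lemma lintegral_stepSum_add_sq_le {n : ℕ} (hn : 0 < n) {h h' : ℕ → Ω → ℝ}
    (hh : ∀ i, Measurable[M.filtration (gridPt a b n i)] (h i)) {C C' : ℝ}
    (hC : ∀ i ω, |h i ω| ≤ C) (hC' : ∀ i ω, |h' i ω| ≤ C') {r : ℝ} (hr : r ∈ Icc a b) :
    ∫⁻ ω, ENNReal.ofReal ((stepSum a b n (fun v => M.B v ω) (fun i => h i ω) r +
        stepSum a b n id (fun i => h' i ω) r) ^ 2) ∂M.P ≤
      2 * (∫⁻ ω, ∫⁻ v in Ioc a b, ENNReal.ofReal (h (gridIdx a b n v) ω ^ 2) ∂volume ∂M.P) +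
      2 * (∫⁻ ω, ∫⁻ v in Ioc a b, ENNReal.ofReal (h' (gridIdx a b n v) ω ^ 2) ∂volume ∂M.P) := by
  have hsub : Ioc a r ⊆ Ioc a b := Ioc_subset_Ioc_right hr.2
  have hm := (measurable_stepSum ha hab hb hn hh hr).mono (M.filtration_le (hr.2.trans hb)) le_rfl
  calc _ ≤ ∫⁻ ω, (2 * ENNReal.ofReal (stepSum a b n (fun v => M.B v ω) (fun i => h i ω) r ^ 2) +
          2 * ENNReal.ofReal (stepSum a b n id (fun i => h' i ω) r ^ 2)) ∂M.P := by
        refine lintegral_mono fun ω => ?_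
        set x := stepSum a b n (fun v => M.B v ω) (fun i => h i ω) r
        set y := stepSum a b n id (fun i => h' i ω) r
        have e : (2 : ℝ≥0∞) = ENNReal.ofReal 2 := by simp
        rw [e, ← ENNReal.ofReal_mul two_pos.le, ← ENNReal.ofReal_mul two_pos.le,
          ← ENNReal.ofReal_add (by positivity) (by positivity)]
        exact ENNReal.ofReal_le_ofReal (by nlinarith [sq_nonneg (x - y)])
    _ = 2 * (∫⁻ ω, ENNReal.ofReal
            (stepSum a b n (fun v => M.B v ω) (fun i => h i ω) r ^ 2) ∂M.P) +
          2 * (∫⁻ ω, ENNReal.ofReal (stepSum a b n id (fun i => h' i ω) r ^ 2) ∂M.P) := by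
        rw [lintegral_add_left ((hm.pow_const 2).ennreal_ofReal.const_mul 2),
          lintegral_const_mul' _ _ (by simp), lintegral_const_mul' _ _ (by simp)]
    _ ≤ _ := by
        refine add_le_add (mul_le_mul_right ?_ 2) (mul_le_mul_right ?_ 2)
        · rw [lintegral_stepSum_sq ha hab hb hn hh hC hr]
          exact lintegral_mono fun ω => lintegral_mono_set hsub
        · exact lintegral_mono fun ω =>
            (stepSum_id_sq_le hab (by linarith) hn (fun i => hC' i _) hr).trans
              (lintegral_mono_set hsub)

omit ha in
/-- The change of a coefficient from one iterate to the next, each sampled on its own grid. -/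
lemma lintegral_coefficient_sub_le {f : ℝ → ℝ} {κ : ℝ}
    (hκ : ∀ x y z, |f x - f z| ≤ κ * (|x - y| + min 1 |y - z|)) {X X' : ℝ → Ω → ℝ}
    (hX : ∀ r ∈ Icc a b, Measurable[M.filtration r] (X r))
    (hX' : ∀ r ∈ Icc a b, Measurable[M.filtration r] (X' r)) {n q : ℕ} (hn : 0 < n) (hq : 0 < q)
    {d e : ℝ} (hd : 0 ≤ d) (he : 0 ≤ e)
    (hD : ∀ r ∈ Icc a b, ∫⁻ ω, ENNReal.ofReal ((X' r ω - X r ω) ^ 2) ∂M.P ≤ ENNReal.ofReal d)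
    (hE : M.sampleDist a b X (n * q) n ≤ ENNReal.ofReal e) :
    ∫⁻ ω, ∫⁻ v in Ioc a b, ENNReal.ofReal
        ((f (X' (gridPt a b (n * q) (gridIdx a b (n * q) v)) ω) -
          f (X (gridPt a b n (gridIdx a b (n * q) v / q)) ω)) ^ 2) ∂volume ∂M.P ≤
      ENNReal.ofReal (2 * κ ^ 2 * ((b - a) * d + e)) := by
  have hnq : 0 < n * q := Nat.mul_pos hn hq
  let A : Ω → ℝ → ℝ≥0∞ := fun ω v =>
    ENNReal.ofReal ((X' (gridPt a b (n * q) (gridIdx a b (n * q) v)) ω -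
      X (gridPt a b (n * q) (gridIdx a b (n * q) v)) ω) ^ 2)
  let E : Ω → ℝ → ℝ≥0∞ := fun ω v =>
    ENNReal.ofReal ((min 1 |X (gridPt a b (n * q) (gridIdx a b (n * q) v)) ω -
      X (gridPt a b n (gridIdx a b n v)) ω|) ^ 2)
  have hA : Measurable (Function.uncurry A) :=
    (((measurable_uncurry_gridIdx (measurable_gridPt hab hb hX' hnq)).sub
      (measurable_uncurry_gridIdx (measurable_gridPt hab hb hX hnq))).pow_const
        2).ennreal_ofReal
  have hpt : ∀ ω, ∀ v ∈ Ioc a b, ENNReal.ofReal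
      ((f (X' (gridPt a b (n * q) (gridIdx a b (n * q) v)) ω) -
          f (X (gridPt a b n (gridIdx a b (n * q) v / q)) ω)) ^ 2) ≤
      ENNReal.ofReal (2 * κ ^ 2) * (A ω v + E ω v) := by
    intro ω v hv
    rw [gridIdx_mul_div hab hn hq hv]
    simp only [A, E]
    rw [← ENNReal.ofReal_add (sq_nonneg _) (sq_nonneg _), ← ENNReal.ofReal_mul (by positivity)]
    refine ENNReal.ofReal_le_ofReal ?_
    have h1 := hκ (X' (gridPt a b (n * q) (gridIdx a b (n * q) v)) ω)
      (X (gridPt a b (n * q) (gridIdx a b (n * q) v)) ω) (X (gridPt a b n (gridIdx a b n v)) ω)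
    rw [← sq_abs]
    refine (pow_le_pow_left₀ (abs_nonneg _) h1 2).trans ?_
    rw [mul_pow, ← sq_abs (_ - X (gridPt a b (n * q) _) ω)]
    set x := |X' (gridPt a b (n * q) (gridIdx a b (n * q) v)) ω -
      X (gridPt a b (n * q) (gridIdx a b (n * q) v)) ω|
    set y := min 1 |X (gridPt a b (n * q) (gridIdx a b (n * q) v)) ω -
      X (gridPt a b n (gridIdx a b n v)) ω|
    have : (x + y) ^ 2 ≤ 2 * (x ^ 2 + y ^ 2) := by nlinarith [sq_nonneg (x - y)]
    nlinarith [mul_le_mul_of_nonneg_left this (sq_nonneg κ)]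
  have hAle : ∫⁻ ω, ∫⁻ v in Ioc a b, A ω v ∂volume ∂M.P ≤ ENNReal.ofReal ((b - a) * d) := by
    rw [lintegral_lintegral_swap hA.aemeasurable]
    refine (lintegral_mono fun v => hD _ (gridPt_idx_mem hab hnq v)).trans_eq ?_
    rw [setLIntegral_const, Real.volume_Ioc, ENNReal.ofReal_mul (by linarith), mul_comm]
  refine (lintegral_mono fun ω => setLIntegral_mono' measurableSet_Ioc (hpt ω)).trans ?_
  rw [lintegral_lintegral_const_mul_add hA ENNReal.ofReal_ne_top]
  refine (mul_le_mul_right (add_le_add hAle hE) _).trans_eq ?_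
  rw [← ENNReal.ofReal_add (mul_nonneg (by linarith) hd) he, ← ENNReal.ofReal_mul (by positivity)]

end Scheme

end Model


/-! ### Convergence of the iteration -/

namespace Model

variable {Ω : Type*} [mΩ : MeasurableSpace Ω] (M : Model Ω)

/-- A run `X` of the discretized Picard iteration started from `η`, where the `k`-th step uses the
grid with `2 ^ N k` steps and this grid is fine enough for the iterate it is applied to. -/
structure IsScheme (a b : ℝ) (η : ℝ → Ω → ℝ) (X : ℕ → ℝ → Ω → ℝ) (N : ℕ → ℕ) : Prop where
  zero : X 0 = η
  succ : ∀ k, X (k + 1) = M.eulerStep a b η (X k) (2 ^ N k)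
  regular : ∀ k, M.IsGridRegular a b (X k)
  strictMono : StrictMono N
  sampleDist_le : ∀ k,
    M.sampleDist a b (X k) (2 ^ N (k + 1)) (2 ^ N k) ≤ ENNReal.ofReal ((1 / 64) ^ k)

variable {M} {a b κ : ℝ} {η : ℝ → Ω → ℝ} {X : ℕ → ℝ → Ω → ℝ} {N : ℕ → ℕ}

/-- The change of the coefficient `f` between the steps `k` and `k + 1` of the iteration, on the
grid of step `k + 1`. -/
noncomputable def coefficientSub (f : ℝ → ℝ) (a b : ℝ) (X : ℕ → ℝ → Ω → ℝ) (N : ℕ → ℕ) (k i : ℕ)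
    (ω : Ω) : ℝ :=
  f (X (k + 1) (gridPt a b (2 ^ N (k + 1)) i) ω) -
    f (X k (gridPt a b (2 ^ N k) (i / 2 ^ (N (k + 1) - N k))) ω)

omit mΩ in
lemma abs_coefficientSub_le {f : ℝ → ℝ} (hf : ∀ x, |f x| ≤ κ) (k i : ℕ) (ω : Ω) :
    |coefficientSub f a b X N k i ω| ≤ 2 * κ := by
  have h1 := hf (X (k + 1) (gridPt a b (2 ^ N (k + 1)) i) ω)
  have h2 := hf (X k (gridPt a b (2 ^ N k) (i / 2 ^ (N (k + 1) - N k))) ω)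
  exact (abs_sub _ _).trans (by linarith)

namespace IsScheme

variable (hS : M.IsScheme a b η X N)
include hS

lemma pow_succ_eq (k : ℕ) : 2 ^ N (k + 1) = 2 ^ N k * 2 ^ (N (k + 1) - N k) := by
  rw [← pow_add, Nat.add_sub_cancel' (hS.strictMono.monotone k.le_succ)]

lemma sub_eq (k : ℕ) (r : ℝ) (ω : Ω) : X (k + 2) r ω - X (k + 1) r ω =
    stepSum a b (2 ^ N (k + 1)) (fun v => M.B v ω)
      (fun i => coefficientSub M.σ a b X N k i ω) r +
    stepSum a b (2 ^ N (k + 1)) id (fun i => coefficientSub M.b a b X N k i ω) r := by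
  have h1 : X (k + 2) = M.eulerStep a b η (X (k + 1)) (2 ^ N (k + 1)) := hS.succ (k + 1)
  have h2 : ∀ (A : ℝ → ℝ) (f : ℝ → ℝ), stepSum a b (2 ^ N k) A
      (fun i => f (X k (gridPt a b (2 ^ N k) i) ω)) r = stepSum a b (2 ^ N (k + 1)) A
      (fun i => f (X k (gridPt a b (2 ^ N k) (i / 2 ^ (N (k + 1) - N k))) ω)) r := by
    intro A f
    rw [hS.pow_succ_eq k]
    exact stepSum_refine (Nat.two_pow_pos _) (Nat.two_pow_pos _) A
      (fun i => f (X k (gridPt a b (2 ^ N k) i) ω)) r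
  have e1 : X (k + 2) r ω = M.eulerStep a b η (X (k + 1)) (2 ^ N (k + 1)) r ω := by rw [h1]
  have e2 : X (k + 1) r ω = M.eulerStep a b η (X k) (2 ^ N k) r ω := by rw [hS.succ k]
  rw [e1, e2]
  simp only [eulerStep, coefficientSub, stepSum_sub]
  rw [h2 _ M.σ, h2 _ M.b]
  ring

variable (ha : 0 ≤ a) (hab : a < b) (hb : b ≤ 1)
include ha hab hb

omit ha hb in
lemma measurable_coefficientSub {f : ℝ → ℝ} (hf : Measurable f) (k i : ℕ) :
    Measurable[M.filtration (gridPt a b (2 ^ N (k + 1)) i)] (coefficientSub f a b X N k i) := by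
  refine (hf.comp ((hS.regular _).adapted _ (gridPt_mem hab.le (Nat.two_pow_pos _) i))).sub
    ((hf.comp ((hS.regular _).adapted _ (gridPt_mem hab.le (Nat.two_pow_pos _) _))).mono
      (M.filtration_mono ?_) le_rfl)
  rw [hS.pow_succ_eq k, ← gridPt_mul (Nat.two_pow_pos _) (Nat.two_pow_pos (N (k + 1) - N k))]
  exact gridPt_mono hab.le (Nat.div_mul_le_self _ _)

variable (hκ : M.IsCoefficientBound κ) (hsmall : 256 * κ ^ 2 * (b - a) ≤ 1)
include hκ hsmall

omit ha hκ in
lemma lintegral_coefficientSub_le {f : ℝ → ℝ}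
    (hf : ∀ x y z, |f x - f z| ≤ κ * (|x - y| + min 1 |y - z|)) {k : ℕ}
    (hD : ∀ r ∈ Icc a b, ∫⁻ ω, ENNReal.ofReal ((X (k + 1) r ω - X k r ω) ^ 2) ∂M.P ≤
      ENNReal.ofReal (256 * κ ^ 2 * (1 / 16) ^ k)) :
    ∫⁻ ω, ∫⁻ v in Ioc a b, ENNReal.ofReal
        (coefficientSub f a b X N k (gridIdx a b (2 ^ N (k + 1)) v) ω ^ 2) ∂volume ∂M.P ≤
      ENNReal.ofReal (4 * κ ^ 2 * (1 / 16) ^ k) := by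
  have he := hS.sampleDist_le k
  rw [hS.pow_succ_eq k] at he
  have h := lintegral_coefficient_sub_le hab hb hf (hS.regular k).adapted
    (hS.regular (k + 1)).adapted (Nat.two_pow_pos (N k)) (Nat.two_pow_pos (N (k + 1) - N k))
    (by positivity) (by positivity) hD he
  rw [← hS.pow_succ_eq k] at h
  refine h.trans (ENNReal.ofReal_le_ofReal ?_)
  have h16 : (0 : ℝ) ≤ (1 / 16) ^ k := by positivity
  have h64 : ((1 : ℝ) / 64) ^ k ≤ (1 / 16) ^ k := by gcongr; norm_num
  have h1 : (b - a) * (256 * κ ^ 2 * (1 / 16) ^ k) ≤ (1 / 16) ^ k := by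
    nlinarith [mul_le_mul_of_nonneg_right hsmall h16]
  nlinarith [sq_nonneg κ]

/-- The iteration contracts in mean square: by the isometry and the Lipschitz property, a squared
distance `d` of consecutive iterates turns into at most `8 κ ^ 2 ((b - a) d + 64 ^ (-k))`. -/
lemma lintegral_sub_sq_le (k : ℕ) : ∀ r ∈ Icc a b,
    ∫⁻ ω, ENNReal.ofReal ((X (k + 1) r ω - X k r ω) ^ 2) ∂M.P ≤
      ENNReal.ofReal (256 * κ ^ 2 * (1 / 16) ^ k) := by
  induction k with
  | zero =>
    intro r hr
    have hn := Nat.two_pow_pos (N 0)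
    have hη := hS.regular 0
    have h1 := lintegral_stepSum_add_sq_le ha hab hb hn
      (h := fun i => M.σ ∘ X 0 (gridPt a b (2 ^ N 0) i))
      (h' := fun i => M.b ∘ X 0 (gridPt a b (2 ^ N 0) i))
      (fun i => measurable_σ.comp (hη.adapted _ (gridPt_mem hab.le hn i)))
      (fun i ω => hκ.σ_le _) (fun i ω => hκ.b_le _) hr
    have h2 : ∀ f : ℝ → ℝ, (∀ x, |f x| ≤ κ) → ∫⁻ ω, ∫⁻ v in Ioc a b, ENNReal.ofReal
        (f (X 0 (gridPt a b (2 ^ N 0) (gridIdx a b (2 ^ N 0) v)) ω) ^ 2) ∂volume ∂M.P ≤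
        ENNReal.ofReal (κ ^ 2) := by
      intro f hf
      calc _ ≤ ∫⁻ ω, ∫⁻ v in Ioc a b, ENNReal.ofReal (κ ^ 2) ∂volume ∂M.P :=
            lintegral_mono fun ω => lintegral_mono fun v => ENNReal.ofReal_le_ofReal
              (sq_le_sq' (abs_le.1 (hf _)).1 (abs_le.1 (hf _)).2)
        _ = ENNReal.ofReal (κ ^ 2) * ENNReal.ofReal (b - a) := by simp
        _ ≤ ENNReal.ofReal (κ ^ 2) * 1 := by
            gcongr; rw [ENNReal.ofReal_le_one]; linarith
        _ = _ := mul_one _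
    have h3 : ∀ ω, X (0 + 1) r ω - X 0 r ω = stepSum a b (2 ^ N 0) (fun v => M.B v ω)
        (fun i => (M.σ ∘ X 0 (gridPt a b (2 ^ N 0) i)) ω) r +
        stepSum a b (2 ^ N 0) id (fun i => (M.b ∘ X 0 (gridPt a b (2 ^ N 0) i)) ω) r := by
      intro ω
      rw [hS.succ 0, hS.zero]
      simp only [eulerStep, Function.comp_apply]
      ring
    simp only [h3]
    refine h1.trans ((add_le_add (mul_le_mul_right (h2 _ hκ.σ_le) 2)
      (mul_le_mul_right (h2 _ hκ.b_le) 2)).trans ?_)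
    rw [show (2 : ℝ≥0∞) = ENNReal.ofReal 2 by simp, ← ENNReal.ofReal_mul two_pos.le,
      ← ENNReal.ofReal_add (by positivity) (by positivity)]
    refine ENNReal.ofReal_le_ofReal ?_
    nlinarith [sq_nonneg κ]
  | succ k ih =>
    intro r hr
    have h1 := lintegral_stepSum_add_sq_le ha hab hb (Nat.two_pow_pos (N (k + 1)))
      (h := coefficientSub M.σ a b X N k) (h' := coefficientSub M.b a b X N k)
      (fun i => hS.measurable_coefficientSub hab measurable_σ k i)
      (fun i ω => abs_coefficientSub_le hκ.σ_le k i ω)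
      (fun i ω => abs_coefficientSub_le hκ.b_le k i ω) hr
    simp only [hS.sub_eq k r]
    refine h1.trans ((add_le_add
      (mul_le_mul_right (hS.lintegral_coefficientSub_le hab hb hsmall hκ.σ_sub_le ih) 2)
      (mul_le_mul_right (hS.lintegral_coefficientSub_le hab hb hsmall hκ.b_sub_le ih) 2)).trans ?_)
    rw [show (2 : ℝ≥0∞) = ENNReal.ofReal 2 by simp, ← ENNReal.ofReal_mul two_pos.le,
      ← ENNReal.ofReal_add (by positivity) (by positivity)]
    refine ENNReal.ofReal_le_ofReal (le_of_eq ?_)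
    rw [pow_succ]; ring

/-- By the maximal inequality and the Borel-Cantelli lemma, consecutive iterates are almost surely
uniformly close. -/
lemma ae_eventually_abs_sub_le : ∀ᵐ ω ∂M.P, ∀ᶠ k in atTop, ∀ r ∈ Icc a b,
    |X (k + 2) r ω - X (k + 1) r ω| ≤ 2 * (1 / 2) ^ k := by
  let S : ℕ → Set Ω := fun k => {ω | ∃ r ∈ Icc a b, (1 / 2) ^ k <
    |stepSum a b (2 ^ N (k + 1)) (fun v => M.B v ω)
      (fun i => coefficientSub M.σ a b X N k i ω) r|}
  let I : ℕ → Ω → ℝ≥0∞ := fun k ω => ∫⁻ v in Ioc a b, ENNReal.ofReal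
    (coefficientSub M.b a b X N k (gridIdx a b (2 ^ N (k + 1)) v) ω ^ 2)
  let T : ℕ → Set Ω := fun k => {ω | ENNReal.ofReal ((1 / 4) ^ k) ≤ I k ω}
  have hD := hS.lintegral_sub_sq_le ha hab hb hκ hsmall
  have hPS : ∀ k, M.P (S k) ≤ ENNReal.ofReal ((1 + 4 * κ ^ 2) / 2 * (1 / 2) ^ k) := by
    intro k
    have h1 := hS.lintegral_coefficientSub_le hab hb hsmall hκ.σ_sub_le (hD k)
    have e : 4 * κ ^ 2 * ((1 : ℝ) / 16) ^ k = 4 * κ ^ 2 * ((1 / 4) ^ k) ^ 2 := by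
      rw [← pow_mul, mul_comm k 2, pow_mul]; norm_num
    rw [e] at h1
    have h2 := maximal_stepSum ha hab hb (Nat.two_pow_pos (N (k + 1)))
      (fun i => hS.measurable_coefficientSub hab measurable_σ k i)
      (fun i ω => abs_coefficientSub_le hκ.σ_le k i ω) (ε := (1 / 2) ^ k)
      (by positivity) (by positivity) (by positivity) h1
    have e2 : ((1 : ℝ) / 4) ^ k / (1 / 2) ^ k = (1 / 2) ^ k := by
      rw [← div_pow]; norm_num
    rwa [e2] at h2
  have hIm : ∀ k, Measurable (I k) := by
    intro k
    have := measurable_uncurry_gridIdx (a := a) (b := b) (n := 2 ^ N (k + 1))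
      (h := coefficientSub M.b a b X N k) (fun i =>
      (hS.measurable_coefficientSub hab measurable_b k i).mono
        (M.filtration_le ((gridPt_mem hab.le (Nat.two_pow_pos _) i).2.trans hb)) le_rfl)
    exact ((this.pow_const 2).ennreal_ofReal).lintegral_prod_right'
  have hPT : ∀ k, M.P (T k) ≤ ENNReal.ofReal (4 * κ ^ 2 * (1 / 4) ^ k) := by
    intro k
    have h1 := (mul_meas_ge_le_lintegral (μ := M.P) (hIm k) (ENNReal.ofReal ((1 / 4) ^ k))).trans
      (hS.lintegral_coefficientSub_le hab hb hsmall hκ.b_sub_le (hD k))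
    have e : 4 * κ ^ 2 * ((1 : ℝ) / 16) ^ k = (1 / 4) ^ k * (4 * κ ^ 2 * (1 / 4) ^ k) := by
      rw [show (1 : ℝ) / 16 = 1 / 4 * (1 / 4) by norm_num, mul_pow]; ring
    rw [e, ENNReal.ofReal_mul (by positivity)] at h1
    exact (ENNReal.mul_le_mul_iff_right (by simp) ENNReal.ofReal_ne_top).1 h1
  have hsumS : ∑' k, M.P (S k) ≠ ∞ := ne_top_of_le_ne_top
    ((summable_geometric_of_lt_one (by norm_num) (by norm_num : (1 : ℝ) / 2 < 1)).mul_left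
      ((1 + 4 * κ ^ 2) / 2)).tsum_ofReal_ne_top (ENNReal.tsum_le_tsum hPS)
  have hsumT : ∑' k, M.P (T k) ≠ ∞ := ne_top_of_le_ne_top
    ((summable_geometric_of_lt_one (by norm_num) (by norm_num : (1 : ℝ) / 4 < 1)).mul_left
      (4 * κ ^ 2)).tsum_ofReal_ne_top (ENNReal.tsum_le_tsum hPT)
  filter_upwards [ae_eventually_notMem hsumS, ae_eventually_notMem hsumT] with ω h1 h2
  filter_upwards [h1, h2] with k hk1 hk2 r hr
  have h3 : |stepSum a b (2 ^ N (k + 1)) (fun v => M.B v ω)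
      (fun i => coefficientSub M.σ a b X N k i ω) r| ≤ (1 / 2) ^ k := by
    by_contra hcon
    exact hk1 ⟨r, hr, not_le.1 hcon⟩
  have h4 : |stepSum a b (2 ^ N (k + 1)) id
      (fun i => coefficientSub M.b a b X N k i ω) r| ≤ (1 / 2) ^ k := by
    have h5 := stepSum_id_sq_le hab (by linarith) (Nat.two_pow_pos (N (k + 1)))
      (fun i => abs_coefficientSub_le (a := a) (b := b) (X := X) (N := N) hκ.b_le k i ω) hr
    have h6 : I k ω < ENNReal.ofReal ((1 / 4) ^ k) := not_le.1 hk2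
    have h7 := lt_of_le_of_lt (h5.trans (lintegral_mono_set (Ioc_subset_Ioc_right hr.2))) h6
    have h8 := (ENNReal.ofReal_lt_ofReal_iff (by positivity)).1 h7
    have e : ((1 : ℝ) / 4) ^ k = ((1 / 2) ^ k) ^ 2 := by
      rw [← pow_mul, mul_comm k 2, pow_mul]; norm_num
    rw [e] at h8
    exact (abs_lt_of_sq_lt_sq h8 (by positivity)).le
  rw [hS.sub_eq k r ω]
  exact (abs_add_le _ _).trans (by linarith)

end IsScheme

end Model


/-! ### Strong existence on a short time interval -/

lemma tendstoUniformlyOn_limUnder {x : ℕ → ℝ → ℝ} {s : Set ℝ}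
    (h : ∀ᶠ k in atTop, ∀ r ∈ s, |x (k + 2) r - x (k + 1) r| ≤ 2 * (1 / 2) ^ k) :
    TendstoUniformlyOn x (fun r => limUnder atTop fun k => x k r) atTop s := by
  obtain ⟨K, hK⟩ := eventually_atTop.1 h
  have hstep : ∀ r ∈ s, ∀ n, dist (x (n + (K + 1)) r) (x (n + 1 + (K + 1)) r) ≤
      4 * (1 / 2) ^ K / 2 / 2 ^ n := by
    intro r hr n
    have := hK (n + K) (by omega) r hr
    rw [dist_comm, Real.dist_eq, show n + 1 + (K + 1) = n + K + 2 by ring,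
      show n + (K + 1) = n + K + 1 by ring]
    refine this.trans (le_of_eq ?_)
    rw [pow_add, one_div, inv_pow, inv_pow]
    field_simp
    norm_num
  have hlim : ∀ r ∈ s, Tendsto (fun n => x (n + (K + 1)) r) atTop
      (𝓝 (limUnder atTop fun k => x k r)) := by
    intro r hr
    obtain ⟨l, hl⟩ := cauchySeq_tendsto_of_complete (cauchySeq_of_le_geometric_two (hstep r hr))
    have hl' : Tendsto (fun k => x k r) atTop (𝓝 l) := (tendsto_add_atTop_iff_nat (K + 1)).1 hl
    rw [hl'.limUnder_eq]; exact hl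
  rw [Metric.tendstoUniformlyOn_iff]
  intro ε hε
  have h0 : Tendsto (fun n : ℕ => (4 * (1 / 2) ^ K / 2 ^ n : ℝ)) atTop (𝓝 0) :=
    tendsto_const_nhds.div_atTop (tendsto_pow_atTop_atTop_of_one_lt one_lt_two)
  have h1 := h0.eventually (gt_mem_nhds hε)
  obtain ⟨n₀, hn₀⟩ := eventually_atTop.1 h1
  refine eventually_atTop.2 ⟨n₀ + (K + 1), fun m hm r hr => ?_⟩
  obtain ⟨n, rfl⟩ := Nat.exists_eq_add_of_le' (show K + 1 ≤ m by omega)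
  rw [dist_comm]
  exact (dist_le_of_le_geometric_two_of_tendsto (hstep r hr) (hlim r hr) n).trans_lt
    (hn₀ n (by omega))

namespace Model

variable {Ω : Type*} [mΩ : MeasurableSpace Ω] {M : Model Ω} {a b : ℝ}

/-- The step process on a grid of `[a, b]`, cut at time `r`, as a simple process on `(0, r]`. -/
noncomputable def gridProcess (ha : 0 ≤ a) (hab : a < b) {n : ℕ} (hn : 0 < n) {h : ℕ → Ω → ℝ}
    (hh : ∀ i, Measurable[M.filtration (gridPt a b n i)] (h i)) {C : ℝ}
    (hC : ∀ i ω, |h i ω| ≤ C) {r : ℝ} (hr : a ≤ r) : SimpleProcess M.filtration r where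
  n := n
  time i := min (gridPt a b n i) r
  value i ω := if gridPt a b n i ≤ r then h i ω else 0
  monotone_time := monotone_cut hab.le r
  time_mem i := ⟨le_min (ha.trans (gridPt_mem hab.le hn i).1) (ha.trans hr), min_le_right _ _⟩
  measurable_value := measurable_cut hh r
  bounded_value i := ⟨C, abs_cut_le hC r i⟩

section GridProcess

variable (ha : 0 ≤ a) (hab : a < b) {n : ℕ} (hn : 0 < n) {h : ℕ → Ω → ℝ}
  (hh : ∀ i, Measurable[M.filtration (gridPt a b n i)] (h i)) {C : ℝ}
  (hC : ∀ i ω, |h i ω| ≤ C) {r : ℝ}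

lemma gridProcess_integral (hr : a ≤ r) (ω : Ω) :
    (gridProcess ha hab hn hh hC hr).integral M.B ω =
      stepSum a b n (fun v => M.B v ω) (fun i => h i ω) r :=
  (stepSum_eq_transform hab.le r ω).symm

lemma gridProcess_eval (hr : r ∈ Icc a b) {v : ℝ} (hv : v ∈ Ioc a r) (ω : Ω) :
    (gridProcess ha hab hn hh hC hr.1).eval v ω = h (gridIdx a b n v) ω := by
  have hvb : v ∈ Ioc a b := ⟨hv.1, hv.2.trans hr.2⟩
  have hg := mem_grid hab hn hvb
  unfold SimpleProcess.eval
  rw [Finset.sum_eq_single (gridIdx a b n v)]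
  · rw [indicator_of_mem]
    · simp only [gridProcess, if_pos (hg.1.le.trans hv.2)]
    · exact ⟨lt_of_le_of_lt (min_le_left _ _) hg.1, le_min hg.2 hv.2⟩
  · intro i hi hne
    refine indicator_of_notMem (fun hmem => hne ?_) _
    have h1 : gridPt a b n i < v := by
      rcases min_lt_iff.1 hmem.1 with h1 | h1
      · exact h1
      · exact absurd hv.2 (not_le.2 h1)
    exact (gridIdx_eq hab hn (Finset.mem_range.1 hi) ⟨h1, hmem.2.trans (min_le_left _ _)⟩).symm
  · intro hcon
    exact absurd (Finset.mem_range.2 (gridIdx_lt hn v)) hcon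

end GridProcess

/-- The isometry for the difference of two step integrals on nested grids. -/
lemma lintegral_stepSum_sub_sq (ha : 0 ≤ a) (hab : a < b) (hb : b ≤ 1) {n q : ℕ} (hn : 0 < n)
    (hq : 0 < q) {h h' : ℕ → Ω → ℝ} (hh : ∀ i, Measurable[M.filtration (gridPt a b n i)] (h i))
    (hh' : ∀ i, Measurable[M.filtration (gridPt a b (n * q) i)] (h' i)) {C : ℝ}
    (hC : ∀ i ω, |h i ω| ≤ C) (hC' : ∀ i ω, |h' i ω| ≤ C) {r : ℝ} (hr : r ∈ Icc a b) :
    ∫⁻ ω, ENNReal.ofReal ((stepSum a b n (fun v => M.B v ω) (fun i => h i ω) r -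
        stepSum a b (n * q) (fun v => M.B v ω) (fun i => h' i ω) r) ^ 2) ∂M.P =
      ∫⁻ ω, ∫⁻ v in Ioc a r, ENNReal.ofReal
        ((h (gridIdx a b n v) ω - h' (gridIdx a b (n * q) v) ω) ^ 2) ∂volume ∂M.P := by
  have hmeas : ∀ j, Measurable[M.filtration (gridPt a b (n * q) j)]
      (fun ω => h (j / q) ω - h' j ω) := by
    intro j
    refine ((hh (j / q)).mono (M.filtration_mono ?_) le_rfl).sub (hh' j)
    rw [← gridPt_mul hn hq]
    exact gridPt_mono hab.le (Nat.div_mul_le_self _ _)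
  have hbd : ∀ j ω, |h (j / q) ω - h' j ω| ≤ C + C := fun j ω =>
    (abs_sub _ _).trans (add_le_add (hC _ ω) (hC' _ ω))
  have e : ∀ ω, stepSum a b n (fun v => M.B v ω) (fun i => h i ω) r -
      stepSum a b (n * q) (fun v => M.B v ω) (fun i => h' i ω) r =
      stepSum a b (n * q) (fun v => M.B v ω) (fun j => h (j / q) ω - h' j ω) r := by
    intro ω
    rw [stepSum_sub, stepSum_refine hn hq]
  simp only [e]
  rw [lintegral_stepSum_sq ha hab hb (Nat.mul_pos hn hq) hmeas hbd hr]
  refine lintegral_congr fun ω => setLIntegral_congr_fun measurableSet_Ioc fun v hv => ?_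
  simp only [gridIdx_mul_div hab hn hq (⟨hv.1, hv.2.trans hr.2⟩ : v ∈ Ioc a b)]

/-- Strong existence for `X = η + ∫ σ(X) dB + ∫ b(X) dr` on a short interval `[a, b]`, with the
stochastic integral realized as a limit of simple processes living on `[a, b]`. -/
theorem exists_solution {κ : ℝ} {η : ℝ → Ω → ℝ} (ha : 0 ≤ a) (hab : a < b) (hb : b ≤ 1)
    (hκ : M.IsCoefficientBound κ) (hsmall : 256 * κ ^ 2 * (b - a) ≤ 1)
    (hη : M.IsGridRegular a b η) :
    ∃ Y : ℝ → Ω → ℝ, (∀ r ∈ Icc a b, Measurable[M.filtration r] (Y r)) ∧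
      (∀ᵐ ω ∂M.P, ContinuousOn (fun r => Y r ω - η r ω) (Icc a b)) ∧ (∀ ω, Y a ω = η a ω) ∧
      ∀ r ∈ Icc a b, ∃ (J : Ω → ℝ) (G : ℕ → SimpleProcess M.filtration r),
        (∀ k i, a ≤ (G k).time i) ∧ Measurable J ∧
        (∀ k, AEMeasurable (fun ω => ∫⁻ v in Ioc a r,
          ENNReal.ofReal (((G k).eval v ω - M.σ (Y v ω)) ^ 2)) M.P) ∧
        Tendsto (fun k => ∫⁻ ω, ∫⁻ v in Ioc a r,
          ENNReal.ofReal (((G k).eval v ω - M.σ (Y v ω)) ^ 2) ∂volume ∂M.P) atTop (𝓝 0) ∧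
        Tendsto (fun k => ∫⁻ ω, ENNReal.ofReal (((G k).integral M.B ω - J ω) ^ 2) ∂M.P)
          atTop (𝓝 0) ∧
        ∀ ω, Y r ω = η r ω + J ω + ∫ v in a..r, M.b (Y v ω) := by
  -- The solution is the uniform limit of the iterates.
  obtain ⟨X, N, h0, hsucc, hreg, hmono, hdist⟩ := exists_scheme ha hab hb hη
  have hS : M.IsScheme a b η X N := ⟨h0, hsucc, hreg, hmono, hdist⟩
  let Y : ℝ → Ω → ℝ := fun r ω => limUnder atTop fun k => X k r ω
  have hunif : ∀ᵐ ω ∂M.P, TendstoUniformlyOn (fun k r => X k r ω) (fun r => Y r ω) atTop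
      (Icc a b) := by
    filter_upwards [hS.ae_eventually_abs_sub_le ha hab hb hκ hsmall] with ω hω
    exact tendstoUniformlyOn_limUnder hω
  have hcont : ∀ᵐ ω ∂M.P, ContinuousOn (fun r => Y r ω - η r ω) (Icc a b) := by
    have hX : ∀ᵐ ω ∂M.P, ∀ k, ContinuousOn (fun r => X k r ω - η r ω) (Icc a b) := by
      rw [ae_all_iff]
      intro k
      cases k with
      | zero => simp [h0, continuousOn_const]
      | succ k =>
        rw [hsucc k]
        exact eulerStep_sub_continuousOn ha hab hb η (X k) (Nat.two_pow_pos _)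
    filter_upwards [hX, hunif] with ω h1 h2
    refine TendstoUniformlyOn.continuousOn (F := fun k r => X k r ω - η r ω) (p := atTop) ?_
      (Frequently.of_forall h1)
    rw [Metric.tendstoUniformlyOn_iff] at h2 ⊢
    intro ε hε
    filter_upwards [h2 ε hε] with k hk r hr
    simpa using hk r hr
  have hpt : ∀ᵐ ω ∂M.P, ∀ᵐ v ∂volume.restrict (Ioc a b),
      Tendsto (fun k => X k (gridPt a b (2 ^ N k) (gridIdx a b (2 ^ N k) v)) ω) atTop
        (𝓝 (Y v ω)) := by
    filter_upwards [hunif, hcont, hη.leftCont] with ω h1 h2 h3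
    filter_upwards [h3, ae_restrict_mem measurableSet_Ioc] with v hv hvm
    have hgrid : Tendsto (fun k => gridPt a b (2 ^ N k) (gridIdx a b (2 ^ N k) v)) atTop
        (𝓝[Ico a v] v) := tendsto_gridPt_idx hab (fun k => Nat.two_pow_pos _)
      ((tendsto_pow_atTop_atTop_of_one_lt one_lt_two).comp hmono.tendsto_atTop) hvm
    have hZ : Tendsto (fun r => Y r ω - η r ω) (𝓝[Ico a v] v) (𝓝 (Y v ω - η v ω)) :=
      ((h2 v ⟨hvm.1.le, hvm.2⟩).mono fun x hx => ⟨hx.1, hx.2.le.trans hvm.2⟩).tendsto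
    have hYv : Tendsto (fun r => Y r ω) (𝓝[Ico a v] v) (𝓝 (Y v ω)) := by simpa using hZ.add hv
    have hd : Tendsto (fun k => X k (gridPt a b (2 ^ N k) (gridIdx a b (2 ^ N k) v)) ω -
        Y (gridPt a b (2 ^ N k) (gridIdx a b (2 ^ N k) v)) ω) atTop (𝓝 0) := by
      rw [Metric.tendsto_nhds]
      intro ε hε
      filter_upwards [(Metric.tendstoUniformlyOn_iff.1 h1) ε hε] with k hk
      have := hk _ (gridPt_idx_mem hab (Nat.two_pow_pos (N k)) v)
      rwa [dist_comm, Real.dist_eq, ← sub_zero (_ - _), ← Real.dist_eq] at this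
    simpa using hd.add (hYv.comp hgrid)
  refine ⟨Y, fun r hr => ?_, hcont, fun ω => ?_, fun r hr => ?_⟩
  · refine M.measurable_of_tendsto_ae (fun k => (hreg k).adapted r hr) ?_
    filter_upwards [hunif] with ω hω using hω.tendsto_at hr
  · have : ∀ k, X k a ω = η a ω := by
      intro k
      cases k with
      | zero => rw [h0]
      | succ k => rw [hsucc k]; simp [eulerStep, stepSum_left hab.le]
    simp only [Y, this]
    exact tendsto_const_nhds.limUnder_eq
  · have hsub : Ioc a r ⊆ Ioc a b := Ioc_subset_Ioc_right hr.2
    let h : ℕ → ℕ → Ω → ℝ := fun k i ω => M.σ (X k (gridPt a b (2 ^ N k) i) ω)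
    have hh : ∀ k i, Measurable[M.filtration (gridPt a b (2 ^ N k) i)] (h k i) := fun k i =>
      measurable_σ.comp ((hreg k).adapted _ (gridPt_mem hab.le (Nat.two_pow_pos _) i))
    have hC : ∀ k i ω, |h k i ω| ≤ κ := fun k i ω => hκ.σ_le _
    have hpt' : ∀ᵐ ω ∂M.P, ∀ᵐ v ∂volume.restrict (Ioc a r),
        Tendsto (fun k => X k (gridPt a b (2 ^ N k) (gridIdx a b (2 ^ N k) v)) ω) atTop
          (𝓝 (Y v ω)) := by
      filter_upwards [hpt] with ω hω using ae_restrict_of_ae_restrict_of_subset hsub hω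
    have hσc : Continuous M.σ := let ⟨_, hK⟩ := M.lipschitz_σ; hK.continuous
    have hbc : Continuous M.b := let ⟨_, hK⟩ := M.lipschitz_b; hK.continuous
    have hms := tendsto_lintegral_lintegral_sq_sub (μ := M.P) (ν := volume.restrict (Ioc a r))
      (G := fun k ω v => h k (gridIdx a b (2 ^ N k) v) ω) (f := fun ω v => M.σ (Y v ω))
      (fun k => measurable_uncurry_gridIdx fun i => (hh k i).mono
        (M.filtration_le ((gridPt_mem hab.le (Nat.two_pow_pos _) i).2.trans hb)) le_rfl)
      (C := κ) (fun k ω v => hC k _ ω) (by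
        filter_upwards [hpt'] with ω hω
        filter_upwards [hω] with v hv using (hσc.tendsto _).comp hv)
    let S : ℕ → Ω → ℝ := fun k ω => stepSum a b (2 ^ N k) (fun v => M.B v ω) (fun i => h k i ω) r
    -- The stochastic integral is read off the equation; it remains to see that it is one.
    let J : Ω → ℝ := fun ω => Y r ω - η r ω - ∫ v in a..r, M.b (Y v ω)
    have hSsub : ∀ k m, k ≤ m → ∫⁻ ω, ENNReal.ofReal ((S k ω - S m ω) ^ 2) ∂M.P =
        ∫⁻ ω, ∫⁻ v in Ioc a r, ENNReal.ofReal ((h k (gridIdx a b (2 ^ N k) v) ω -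
          h m (gridIdx a b (2 ^ N m) v) ω) ^ 2) ∂volume ∂M.P := by
      intro k m hkm
      have e : 2 ^ N m = 2 ^ N k * 2 ^ (N m - N k) := by
        rw [← pow_add, Nat.add_sub_cancel' (hmono.monotone hkm)]
      have hm := hh m
      simp only [S]
      rw [e] at hm ⊢
      exact lintegral_stepSum_sub_sq ha hab hb (Nat.two_pow_pos _) (Nat.two_pow_pos _) (hh k) hm
        (hC k) (hC m) hr
    have hScauchy : Tendsto (fun p : ℕ × ℕ => ∫⁻ ω, ENNReal.ofReal ((S p.1 ω - S p.2 ω) ^ 2) ∂M.P)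
        (atTop ×ˢ atTop) (𝓝 0) := by
      refine hms.1.congr fun p => ?_
      rcases le_total p.1 p.2 with hp | hp
      · exact (hSsub _ _ hp).symm
      · have := hSsub _ _ hp
        simp only [sub_sq_comm (S p.2 _), sub_sq_comm (h p.2 _ _)] at this
        exact this.symm
    have hSlim : ∀ᵐ ω ∂M.P, Tendsto (fun k => S k ω) atTop (𝓝 (J ω)) := by
      filter_upwards [hunif, hpt'] with ω h1 h2
      have hD : Tendsto (fun k => ∫ v in Ioc a r,
          M.b (X k (gridPt a b (2 ^ N k) (gridIdx a b (2 ^ N k) v)) ω)) atTop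
          (𝓝 (∫ v in Ioc a r, M.b (Y v ω))) := by
        refine tendsto_integral_of_dominated_convergence (fun _ => κ) (fun k =>
          (measurable_comp_gridIdx
            fun i => M.b (X k (gridPt a b (2 ^ N k) i) ω)).aestronglyMeasurable)
          (integrable_const κ) (fun k => Eventually.of_forall fun v => hκ.b_le _) ?_
        filter_upwards [h2] with v hv using (hbc.tendsto _).comp hv
      have hX : Tendsto (fun k => X (k + 1) r ω) atTop (𝓝 (Y r ω)) :=
        (h1.tendsto_at hr).comp (tendsto_add_atTop_nat 1)
      have e : ∀ k, S k ω = X (k + 1) r ω - η r ω - ∫ v in Ioc a r,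
          M.b (X k (gridPt a b (2 ^ N k) (gridIdx a b (2 ^ N k) v)) ω) := by
        intro k
        rw [hsucc k, integral_grid_eq_sum hab (Nat.two_pow_pos _)
          (fun i => M.b (X k (gridPt a b (2 ^ N k) i) ω)) hr]
        simp only [eulerStep, S, h]
        ring
      simp only [e, J, intervalIntegral.integral_of_le hr.1]
      exact (hX.sub_const _).sub hD
    have hSm : ∀ k, Measurable (S k) := fun k =>
      (measurable_stepSum ha hab hb (Nat.two_pow_pos _) (hh k) hr).mono
        (M.filtration_le (hr.2.trans hb)) le_rfl
    refine ⟨J, fun k => gridProcess ha hab (Nat.two_pow_pos (N k)) (hh k) (hC k) hr.1, ?_, ?_, ?_,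
      ?_, ?_, ?_⟩
    · intro k i
      exact le_min (gridPt_mem hab.le (Nat.two_pow_pos _) i).1 hr.1
    · exact (M.measurable_of_tendsto_ae (fun k =>
        measurable_stepSum ha hab hb (Nat.two_pow_pos _) (hh k) hr) hSlim).mono
        (M.filtration_le (hr.2.trans hb)) le_rfl
    · intro k
      have hgm : ∀ k, Measurable (Function.uncurry
          fun ω v => h k (gridIdx a b (2 ^ N k) v) ω) := fun k =>
        measurable_uncurry_gridIdx fun i => (hh k i).mono
          (M.filtration_le ((gridPt_mem hab.le (Nat.two_pow_pos _) i).2.trans hb)) le_rfl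
      refine (aemeasurable_lintegral_sq_of_tendsto (μ := M.P) (ν := volume.restrict (Ioc a r))
        (D := fun m ω v => h k (gridIdx a b (2 ^ N k) v) ω - h m (gridIdx a b (2 ^ N m) v) ω)
        (f := fun ω v => h k (gridIdx a b (2 ^ N k) v) ω - M.σ (Y v ω))
        (fun m => (hgm k).sub (hgm m)) (C := κ + κ)
        (fun m ω v => (abs_sub _ _).trans (add_le_add (hC _ _ _) (hC _ _ _))) ?_).congr ?_
      · filter_upwards [hpt'] with ω hω
        filter_upwards [hω] with v hv
        exact tendsto_const_nhds.sub ((hσc.tendsto _).comp hv)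
      · refine Eventually.of_forall fun ω => setLIntegral_congr_fun measurableSet_Ioc
          fun v hv => ?_
        simp only [gridProcess_eval ha hab (Nat.two_pow_pos (N k)) (hh k) (hC k) hr hv]
    · refine hms.2.congr fun k => lintegral_congr fun ω =>
        setLIntegral_congr_fun measurableSet_Ioc fun v hv => ?_
      simp only [gridProcess_eval ha hab (Nat.two_pow_pos (N k)) (hh k) (hC k) hr hv]
    · simp only [gridProcess_integral]
      exact tendsto_lintegral_sq_of_cauchy hSm hSlim hScauchy
    · intro ω
      simp only [J]
      ring

end Model


/-! ### Integration along a nondecreasing path -/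

section PathMeasure

variable {f : ℝ → ℝ}

lemma extendPath_of_mem {r : ℝ} (hr : r ∈ Icc (0 : ℝ) 1) : extendPath f r = f r := by
  rw [extendPath, min_eq_right hr.2, max_eq_right hr.1]

lemma rightLim_extendPath (hf : IsCadlag 1 f) {r : ℝ} (hr : r ∈ Icc (0 : ℝ) 1) :
    Function.rightLim (extendPath f) r = f r := by
  rw [← extendPath_of_mem (f := f) hr]
  refine ContinuousWithinAt.rightLim_eq (continuousWithinAt_Ioi_iff_Ici.1 ?_)
  rcases eq_or_lt_of_le hr.2 with h | h
  · refine (continuousWithinAt_const (b := f 1)).congr (fun x hx => ?_) ?_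
    · have : (1 : ℝ) < x := h ▸ hx
      rw [extendPath, min_eq_left this.le, max_eq_right zero_le_one]
    · rw [extendPath_of_mem hr, h]
  · have hc := hf.1 r ⟨hr.1, h⟩
    refine hc.congr_of_eventuallyEq ?_ (extendPath_of_mem hr)
    filter_upwards [Ioo_mem_nhdsGT h] with x hx
    exact extendPath_of_mem ⟨hr.1.trans hx.1.le, hx.2.le⟩

lemma pathMeasure_Ioc (hf : MonotoneOn f (Icc 0 1)) (hf' : IsCadlag 1 f) {q r : ℝ}
    (hq : q ∈ Icc (0 : ℝ) 1) (hr : r ∈ Icc (0 : ℝ) 1) :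
    pathMeasure f (Ioc q r) = ENNReal.ofReal (f r - f q) := by
  rw [pathMeasure, dif_pos hf, StieltjesFunction.measure_Ioc, Monotone.stieltjesFunction_eq,
    Monotone.stieltjesFunction_eq, rightLim_extendPath hf' hq, rightLim_extendPath hf' hr]

/-- The integral along a path of a function which is constant after time `τ`. -/
lemma setIntegral_pathMeasure_ite (hf : MonotoneOn f (Icc 0 1)) (hf' : IsCadlag 1 f)
    {τ r : ℝ} (hτ : 0 ≤ τ) (hτr : τ ≤ r) (hr : r ≤ 1) {z : ℝ → ℝ}
    (hz : IntegrableOn z (Ioc 0 τ) (pathMeasure f)) (k : ℝ) :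
    ∫ v in Ioc 0 r, (if v ≤ τ then z v else k) ∂pathMeasure f =
      (∫ v in Ioc 0 τ, z v ∂pathMeasure f) + k * (f r - f τ) := by
  have hτ1 : τ ∈ Icc (0 : ℝ) 1 := ⟨hτ, hτr.trans hr⟩
  have hr1 : r ∈ Icc (0 : ℝ) 1 := ⟨hτ.trans hτr, hr⟩
  have e1 : EqOn (fun v => if v ≤ τ then z v else k) z (Ioc 0 τ) := fun v hv => if_pos hv.2
  have e2 : EqOn (fun v => if v ≤ τ then z v else k) (fun _ => k) (Ioc τ r) :=
    fun v hv => if_neg (not_le.2 hv.1)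
  have hfin : pathMeasure f (Ioc τ r) ≠ ∞ := by
    rw [pathMeasure_Ioc hf hf' hτ1 hr1]; exact ENNReal.ofReal_ne_top
  rw [← Ioc_union_Ioc_eq_Ioc hτ hτr, setIntegral_union (Ioc_disjoint_Ioc_of_le le_rfl)
    measurableSet_Ioc (hz.congr_fun e1.symm measurableSet_Ioc)
    ((integrableOn_const hfin).congr_fun e2.symm measurableSet_Ioc),
    setIntegral_congr_fun measurableSet_Ioc e1, setIntegral_congr_fun measurableSet_Ioc e2,
    setIntegral_const, Measure.real, pathMeasure_Ioc hf hf' hτ1 hr1,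
    ENNReal.toReal_ofReal (sub_nonneg.2 (hf hτ1 hr1 hτr)), smul_eq_mul, mul_comm k]

lemma integrableOn_pathMeasure (hf : MonotoneOn f (Icc 0 1)) (hf' : IsCadlag 1 f) {τ : ℝ}
    (hτ : τ ∈ Icc (0 : ℝ) 1) {z : ℝ → ℝ} (hz : IsCaglad τ z) :
    IntegrableOn z (Ioc 0 τ) (pathMeasure f) := by
  obtain ⟨C, -, hC⟩ := hz.exists_bound
  have : IsFiniteMeasure ((pathMeasure f).restrict (Ioc 0 τ)) := by
    refine ⟨?_⟩
    rw [Measure.restrict_apply_univ, pathMeasure_Ioc hf hf' ⟨le_rfl, zero_le_one⟩ hτ]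
    exact ENNReal.ofReal_lt_top
  refine Integrable.of_bound hz.aemeasurable.aestronglyMeasurable C ?_
  filter_upwards [ae_restrict_mem measurableSet_Ioc] with v hv using hC v ⟨hv.1.le, hv.2⟩

/-- A monotone path has at most countably many discontinuities. -/
lemma ae_tendsto_left_of_monotoneOn (hf : MonotoneOn f (Icc 0 1)) {a b : ℝ} (ha : 0 ≤ a)
    (hb : b ≤ 1) :
    ∀ᵐ v ∂volume.restrict (Ioc a b), Tendsto f (𝓝[Ico a v] v) (𝓝 (f v)) := by
  have hnull := hf.countable_not_continuousWithinAt.measure_zero volume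
  have h : ∀ᵐ v, v ∉ {x ∈ Icc (0 : ℝ) 1 | ¬ContinuousWithinAt f (Icc 0 1) x} :=
    measure_eq_zero_iff_ae_notMem.1 hnull
  filter_upwards [ae_restrict_of_ae h, ae_restrict_mem measurableSet_Ioc] with v hv hvm
  have hv1 : v ∈ Icc (0 : ℝ) 1 := ⟨ha.trans hvm.1.le, hvm.2.trans hb⟩
  have hc : ContinuousWithinAt f (Icc 0 1) v := by
    by_contra hcon
    exact hv ⟨hv1, hcon⟩
  exact (hc.mono fun x hx => ⟨ha.trans hx.1, hx.2.le.trans hv1.2⟩).tendsto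

end PathMeasure

namespace Model

variable {Ω : Type*} [mΩ : MeasurableSpace Ω] (M : Model Ω)

/-- The market impact function, which only matters on `[0, ∞)`, has a continuous extension. -/
lemma exists_continuous_g : ∃ G : ℝ → ℝ, Continuous G ∧ ∀ x, 0 ≤ x → M.g x = G x := by
  have hc : Continuous fun y => M.h (max 0 y) :=
    M.continuous_h.comp_continuous (by fun_prop) fun y => mem_Ici.2 (le_max_left _ _)
  refine ⟨fun x => ∫ y in (0 : ℝ)..x, M.h (max 0 y),
    intervalIntegral.continuous_primitive (fun a b => hc.intervalIntegrable a b) 0,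
    fun x hx => intervalIntegral.integral_congr fun y hy => ?_⟩
  rw [uIcc_of_le hx] at hy
  simp only [max_eq_right hy.1]

end Model


/-! ### Concatenation of stochastic integrals -/

section Append

variable {Ω : Type*} {F : ℝ → MeasurableSpace Ω} {τ r : ℝ}

/-- The concatenation of a simple process on `(0, τ]` and a simple process which vanishes up to
time `τ`. One step, with value `0`, joins the two. -/
def SimpleProcess.append (G : SimpleProcess F τ) (H : SimpleProcess F r) (hτr : τ ≤ r)
    (hH : ∀ i, τ ≤ H.time i) : SimpleProcess F r where
  n := G.n + 1 + H.n
  time i := if i ≤ G.n then G.time i else H.time (i - (G.n + 1))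
  value i := if i < G.n then G.value i else if i = G.n then 0 else H.value (i - (G.n + 1))
  monotone_time := by
    intro i j hij
    dsimp only
    split_ifs with h1 h2 h2
    · exact G.monotone_time hij
    · exact (G.time_mem i).2.trans (hH _)
    · omega
    · exact H.monotone_time (by omega)
  time_mem i := by
    split_ifs with h
    · exact ⟨(G.time_mem i).1, (G.time_mem i).2.trans hτr⟩
    · exact H.time_mem _
  measurable_value i := by
    rcases lt_trichotomy i G.n with h | h | h
    · rw [if_pos h, if_pos h.le]; exact G.measurable_value i
    · rw [if_neg h.not_lt, if_pos h]; exact @measurable_const _ _ _ (F _) 0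
    · rw [if_neg h.not_gt, if_neg h.ne', if_neg h.not_ge]; exact H.measurable_value _
  bounded_value i := by
    rcases lt_trichotomy i G.n with h | h | h
    · rw [if_pos h]; exact G.bounded_value i
    · rw [if_neg h.not_lt, if_pos h]; exact ⟨0, by simp⟩
    · rw [if_neg h.not_gt, if_neg h.ne']; exact H.bounded_value _

variable (G : SimpleProcess F τ) (H : SimpleProcess F r) (hτr : τ ≤ r) (hH : ∀ i, τ ≤ H.time i)

/-- The steps of a concatenation, summed with a weight depending on their end points. -/
lemma SimpleProcess.sum_append (w : ℝ → ℝ → ℝ → ℝ) (hw : ∀ x y, w x y 0 = 0) (ω : Ω) :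
    ∑ i ∈ Finset.range (G.append H hτr hH).n, w ((G.append H hτr hH).time i)
        ((G.append H hτr hH).time (i + 1)) ((G.append H hτr hH).value i ω) =
      ∑ i ∈ Finset.range G.n, w (G.time i) (G.time (i + 1)) (G.value i ω) +
        ∑ i ∈ Finset.range H.n, w (H.time i) (H.time (i + 1)) (H.value i ω) := by
  have hn : (G.append H hτr hH).n = G.n + 1 + H.n := rfl
  rw [hn, Finset.sum_range_add, Finset.sum_range_succ]
  have e0 : (G.append H hτr hH).value G.n ω = 0 := by simp [SimpleProcess.append]
  rw [e0, hw, add_zero]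
  congr 1
  · refine Finset.sum_congr rfl fun i hi => ?_
    have hi' := Finset.mem_range.1 hi
    simp only [SimpleProcess.append, if_pos hi', if_pos hi'.le, if_pos (Nat.succ_le_of_lt hi')]
  · refine Finset.sum_congr rfl fun i _ => ?_
    have h1 : ¬ G.n + 1 + i < G.n := by omega
    have h2 : G.n + 1 + i ≠ G.n := by omega
    have h3 : ¬ G.n + 1 + i ≤ G.n := by omega
    have h4 : ¬ G.n + 1 + i + 1 ≤ G.n := by omega
    have h5 : G.n + 1 + i - (G.n + 1) = i := by omega
    have h6 : G.n + 1 + i + 1 - (G.n + 1) = i + 1 := by omega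
    simp only [SimpleProcess.append, if_neg h1, if_neg h2, if_neg h3, if_neg h4, h5, h6]

lemma SimpleProcess.append_integral (B : ℝ → Ω → ℝ) (ω : Ω) :
    (G.append H hτr hH).integral B ω = G.integral B ω + H.integral B ω :=
  G.sum_append H hτr hH (fun x y c => c * (B y ω - B x ω)) (by simp) ω

lemma SimpleProcess.append_eval (v : ℝ) (ω : Ω) :
    (G.append H hτr hH).eval v ω = G.eval v ω + H.eval v ω :=
  G.sum_append H hτr hH (fun x y c => (Ioc x y).indicator (fun _ => c) v) (by simp) ω

lemma SimpleProcess.eval_of_lt {v : ℝ} (hv : τ < v) (ω : Ω) : G.eval v ω = 0 :=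
  Finset.sum_eq_zero fun _ _ => indicator_of_notMem
    (fun h => absurd (h.2.trans (G.time_mem _).2) (not_le.2 hv)) _

include hH in
lemma SimpleProcess.eval_of_le {v : ℝ} (hv : v ≤ τ) (ω : Ω) : H.eval v ω = 0 :=
  Finset.sum_eq_zero fun _ _ => indicator_of_notMem
    (fun h => absurd (hv.trans (hH _)) (not_le.2 h.1)) _

variable [mΩ : MeasurableSpace Ω] {P : Measure Ω} {B K : ℝ → Ω → ℝ} {J J' : Ω → ℝ}

lemma SimpleProcess.measurable_integral (hF : ∀ q ≤ r, F q ≤ mΩ)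
    (hB : ∀ q ∈ Icc 0 r, Measurable (B q)) : Measurable (H.integral B) := by
  unfold SimpleProcess.integral
  refine Finset.measurable_fun_sum _ fun i _ => ?_
  exact ((H.measurable_value i).mono (hF _ (H.time_mem i).2) le_rfl).mul
    ((hB _ (H.time_mem _)).sub (hB _ (H.time_mem _)))

lemma IsItoIntegral.congr {K' : ℝ → Ω → ℝ} (hJ : IsItoIntegral P F B K r J)
    (hK : ∀ v ∈ Ioc 0 r, ∀ ω, K' v ω = K v ω) : IsItoIntegral P F B K' r J := by
  obtain ⟨G, h1, h2⟩ := hJ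
  refine ⟨G, h1.congr fun k => lintegral_congr fun ω =>
    setLIntegral_congr_fun measurableSet_Ioc fun v hv => ?_, h2⟩
  simp only [hK v hv]

/-- Stochastic integrals over `(0, τ]` and `(τ, r]` add up. -/
lemma IsItoIntegral.append (hτ : 0 ≤ τ) (hτr : τ ≤ r) (hF : ∀ q ≤ r, F q ≤ mΩ)
    (hB : ∀ q ∈ Icc 0 r, Measurable (B q)) (hJ : IsItoIntegral P F B K τ J)
    {H : ℕ → SimpleProcess F r} (hH : ∀ k i, τ ≤ (H k).time i) (hJ' : Measurable J')
    (hm : ∀ k, AEMeasurable (fun ω => ∫⁻ v in Ioc τ r,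
      ENNReal.ofReal (((H k).eval v ω - K v ω) ^ 2)) P)
    (h1 : Tendsto (fun k => ∫⁻ ω, ∫⁻ v in Ioc τ r,
      ENNReal.ofReal (((H k).eval v ω - K v ω) ^ 2) ∂volume ∂P) atTop (𝓝 0))
    (h2 : Tendsto (fun k => ∫⁻ ω, ENNReal.ofReal (((H k).integral B ω - J' ω) ^ 2) ∂P)
      atTop (𝓝 0)) :
    IsItoIntegral P F B K r (fun ω => J ω + J' ω) := by
  obtain ⟨G, g1, g2⟩ := hJ
  refine ⟨fun k => (G k).append (H k) hτr (hH k), ?_, ?_⟩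
  · have := g1.add h1
    rw [add_zero] at this
    refine this.congr fun k => ?_
    rw [← lintegral_add_right' _ (hm k)]
    refine lintegral_congr fun ω => ?_
    rw [← Ioc_union_Ioc_eq_Ioc hτ hτr, lintegral_union measurableSet_Ioc
      (Ioc_disjoint_Ioc_of_le le_rfl)]
    congr 1
    · refine setLIntegral_congr_fun measurableSet_Ioc fun v hv => ?_
      simp only [SimpleProcess.append_eval, (H k).eval_of_le (hH k) hv.2, add_zero]
    · refine setLIntegral_congr_fun measurableSet_Ioc fun v hv => ?_
      simp only [SimpleProcess.append_eval, (G k).eval_of_lt hv.1, zero_add]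
  · have hlim := (ENNReal.Tendsto.const_mul g2 (Or.inr ENNReal.ofNat_ne_top) (a := 2)).add
      (ENNReal.Tendsto.const_mul h2 (Or.inr ENNReal.ofNat_ne_top) (a := 2))
    simp only [mul_zero, add_zero] at hlim
    refine tendsto_of_tendsto_of_tendsto_of_le_of_le tendsto_const_nhds hlim
      (fun _ => zero_le) fun k => ?_
    have hmeas : Measurable fun ω => 2 * ENNReal.ofReal (((H k).integral B ω - J' ω) ^ 2) :=
      (((((H k).measurable_integral hF hB).sub hJ').pow_const 2).ennreal_ofReal).const_mul 2
    simp only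
    rw [← lintegral_const_mul' _ _ ENNReal.ofNat_ne_top,
      ← lintegral_const_mul' _ _ ENNReal.ofNat_ne_top, ← lintegral_add_right _ hmeas]
    refine lintegral_mono fun ω => ?_
    have e2 : (2 : ℝ≥0∞) = ENNReal.ofReal 2 := by simp
    rw [e2, ← ENNReal.ofReal_mul zero_le_two, ← ENNReal.ofReal_mul zero_le_two,
      ← ENNReal.ofReal_add (by positivity) (by positivity), SimpleProcess.append_integral]
    refine ENNReal.ofReal_le_ofReal ?_
    nlinarith [sq_nonneg (((G k).integral B ω - J ω) - ((H k).integral B ω - J' ω))]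

end Append


/-! ### Extension of the log-price after a change of the strategy -/

lemma IsCaglad.integrableOn {t : ℝ} {f : ℝ → ℝ} (hf : IsCaglad t f) :
    IntegrableOn f (Ioc 0 t) := by
  obtain ⟨C, -, hC⟩ := hf.exists_bound
  refine Integrable.of_bound hf.aemeasurable.aestronglyMeasurable C ?_
  filter_upwards [ae_restrict_mem measurableSet_Ioc] with v hv using hC v ⟨hv.1.le, hv.2⟩

lemma IsCadlag.integrableOn {t : ℝ} {f : ℝ → ℝ} (hf : IsCadlag t f) :
    IntegrableOn f (Ioc 0 t) := by
  obtain ⟨C, -, hC⟩ := hf.exists_bound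
  refine Integrable.of_bound hf.aemeasurable.aestronglyMeasurable C ?_
  filter_upwards [ae_restrict_mem measurableSet_Ioc] with v hv using hC v ⟨hv.1.le, hv.2⟩

/-- A càdlàg path up to time `τ`, continued by a path which is càdlàg up to a continuous term. -/
lemma IsCadlag.ite {τ t : ℝ} {f f' ℓ : ℝ → ℝ} (hf : IsCadlag τ f)
    (hfτ : f' τ = f τ) (hℓ : IsCadlag t ℓ) (hc : ContinuousOn (fun r => f' r - ℓ r) (Icc τ t)) :
    IsCadlag t (fun r => if r ≤ τ then f r else f' r) := by
  have hf' : ∀ r, f' r = f' r - ℓ r + ℓ r := fun r => by ring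
  refine ⟨fun r hr => ?_, fun r hr => ?_⟩
  · rcases lt_or_ge r τ with h | h
    · refine (hf.1 r ⟨hr.1, h⟩).congr_of_eventuallyEq ?_ (if_pos h.le)
      filter_upwards [Ioo_mem_nhdsGT h] with v hv using if_pos hv.2.le
    · have h1 : ContinuousWithinAt (fun v => f' v - ℓ v) (Ioi r) r :=
        (hc r ⟨h, hr.2.le⟩).mono_of_mem_nhdsWithin
          (mem_of_superset (Ioo_mem_nhdsGT hr.2) fun v hv => ⟨h.trans hv.1.le, hv.2.le⟩)
      have h2 : ContinuousWithinAt f' (Ioi r) r := by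
        refine (h1.add (hℓ.1 r hr)).congr (fun v _ => hf' v) (hf' r)
      refine h2.congr (fun v hv => if_neg (not_le.2 (h.trans_lt hv))) ?_
      rcases eq_or_lt_of_le h with h' | h'
      · simp [← h', hfτ]
      · exact if_neg (not_le.2 h')
  · rcases le_or_gt r τ with h | h
    · obtain ⟨l, hl⟩ := hf.2 r ⟨hr.1, h⟩
      refine ⟨l, hl.congr' ?_⟩
      filter_upwards [self_mem_nhdsWithin] with v hv
      exact (if_pos ((le_of_lt hv).trans h)).symm
    · obtain ⟨l, hl⟩ := hℓ.2 r hr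
      have h1 : ContinuousWithinAt (fun v => f' v - ℓ v) (Iio r) r :=
        (hc r ⟨h.le, hr.2⟩).mono_of_mem_nhdsWithin
          (mem_of_superset (Ioo_mem_nhdsLT h) fun v hv => ⟨hv.1.le, hv.2.le.trans hr.2⟩)
      refine ⟨f' r - ℓ r + l, (h1.tendsto.add hl).congr' ?_⟩
      filter_upwards [Ioo_mem_nhdsLT h] with v hv
      simp [not_le.2 hv.1]

namespace Model

variable {Ω : Type*} [mΩ : MeasurableSpace Ω] {M : Model Ω}

lemma continuous_b : Continuous M.b := let ⟨_, hK⟩ := M.lipschitz_b; hK.continuous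

/-- If the strategy is replaced after a time `τ` close to `t` by a rate of selling known at time
`τ`, the log-price can be continued from its value at time `τ`: the impact of the new strategy is
an explicit multiple of `L_r - L_τ`. -/
theorem exists_logPrice_ite {κ t τ x : ℝ} {ζ X : ℝ → Ω → ℝ} {c : Ω → ℝ} (hτ : 0 ≤ τ)
    (hτt : τ < t) (ht : t ≤ 1) (hκ : M.IsCoefficientBound κ)
    (hsmall : 256 * κ ^ 2 * (t - τ) ≤ 1) (hX : M.IsLogPrice t x ζ X)
    (hζ : ∀ ω, IsCaglad t fun r => ζ r ω) (hζ0 : ∀ r ∈ Icc 0 t, ∀ ω, 0 ≤ ζ r ω)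
    (hc : Measurable[M.filtration τ] c) (hc0 : ∀ ω, 0 ≤ c ω) :
    ∃ X' : ℝ → Ω → ℝ, M.IsLogPrice t x (fun r ω => if r ≤ τ then ζ r ω else c ω) X' ∧
      ∀ r ≤ τ, ∀ ω, X' r ω = X r ω := by
  obtain ⟨G, hG, hgG⟩ := M.exists_continuous_g
  have hτt' : τ ∈ Icc 0 t := ⟨hτ, hτt.le⟩
  let η : ℝ → Ω → ℝ := fun r ω => X τ ω - G (c ω) * (M.L r ω - M.L τ ω)
  have hη : M.IsGridRegular τ t η := by
    constructor
    · intro r hr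
      have hFr := M.filtration_mono hr.1
      exact ((hX.adapted τ hτt').mono hFr le_rfl).sub ((hG.measurable.comp (hc.mono hFr le_rfl)).mul
        ((M.measurable_L (hτ.trans hr.1) le_rfl).sub (M.measurable_L hτ hr.1)))
    · filter_upwards [M.isSubordinator.monotone] with ω hω
      filter_upwards [ae_tendsto_left_of_monotoneOn hω hτ ht] with v hv
      exact tendsto_const_nhds.sub (tendsto_const_nhds.mul (hv.sub_const _))
  obtain ⟨Y, hYm, hYc, hYτ, hY⟩ := exists_solution hτ hτt ht hκ hsmall hη
  have hYX : ∀ ω, Y τ ω = X τ ω := fun ω => by rw [hYτ]; simp [η]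
  let X' : ℝ → Ω → ℝ := fun r ω => if r ≤ τ then X r ω else Y r ω
  have hle : ∀ r ≤ τ, ∀ ω, X' r ω = X r ω := fun r hr ω => if_pos hr
  have hge : ∀ r, τ ≤ r → ∀ ω, X' r ω = Y r ω := by
    intro r hr ω
    rcases eq_or_lt_of_le hr with h | h
    · rw [← h, hle τ le_rfl, hYX]
    · exact if_neg (not_le.2 h)
  have hcad : ∀ᵐ ω ∂M.P, IsCadlag t (fun r => X' r ω) := by
    filter_upwards [hX.cadlag, M.isSubordinator.cadlag, hYc] with ω h1 h2 h3
    refine (h1.mono hτt.le).ite (f' := fun r => Y r ω) (ℓ := fun r => η r ω) (hYX ω) ?_ h3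
    exact (h2.mono ht).comp_continuous (g := fun y => X τ ω - G (c ω) * (y - M.L τ ω))
      (by fun_prop)
  refine ⟨X', ⟨fun r hr => ?_, hcad, fun r hr => ?_⟩, hle⟩
  · rcases le_or_gt r τ with h | h
    · simpa only [X', if_pos h] using hX.adapted r hr
    · simpa only [X', if_neg (not_le.2 h)] using hYm r ⟨h.le, hr.2⟩
  rcases le_or_gt r τ with h | h
  · obtain ⟨J, hJ, hJe⟩ := hX.equation r hr
    refine ⟨J, hJ.congr fun v hv ω => by rw [hle v (hv.2.trans h)], ?_⟩
    filter_upwards [hJe] with ω hω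
    rw [hle r h, hω]
    congr 1
    · congr 1
      refine intervalIntegral.integral_congr fun v hv => ?_
      rw [uIcc_of_le hr.1] at hv
      simp only [hle v (hv.2.trans h)]
    · refine setIntegral_congr_fun measurableSet_Ioc fun v hv => ?_
      simp only [if_pos (hv.2.trans h)]
  · obtain ⟨J, hJ, hJe⟩ := hX.equation τ hτt'
    obtain ⟨J', H, hH, hJ'm, hHm, h1, h2, hYe⟩ := hY r ⟨h.le, hr.2⟩
    have eY : ∀ k ω, ∫⁻ v in Ioc τ r, ENNReal.ofReal (((H k).eval v ω - M.σ (Y v ω)) ^ 2) =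
        ∫⁻ v in Ioc τ r, ENNReal.ofReal (((H k).eval v ω - M.σ (X' v ω)) ^ 2) := by
      intro k ω
      refine setLIntegral_congr_fun measurableSet_Ioc fun v hv => ?_
      simp only [hge v hv.1.le]
    simp only [eY] at hHm h1
    have hJ0 : IsItoIntegral M.P M.filtration M.B (fun v ω => M.σ (X' v ω)) τ J :=
      hJ.congr fun v hv ω => by rw [hle v hv.2]
    refine ⟨fun ω => J ω + J' ω, hJ0.append hτ h.le
      (fun q hq => M.filtration_le (hq.trans (hr.2.trans ht)))
      (fun q hq => M.isBrownianMotion.measurable q ⟨hq.1, hq.2.trans (hr.2.trans ht)⟩)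
      hH hJ'm hHm h1 h2, ?_⟩
    filter_upwards [hJe, hcad, M.isSubordinator.monotone, M.isSubordinator.cadlag]
      with ω hω hXω hLm hLc
    have hI := (hXω.comp_continuous (continuous_b (M := M))).integrableOn
    have hI1 : IntervalIntegrable (fun v => M.b (X' v ω)) volume 0 τ :=
      (intervalIntegrable_iff_integrableOn_Ioc_of_le hτ).2
        (hI.mono_set (Ioc_subset_Ioc_right hτt.le))
    have hI2 : IntervalIntegrable (fun v => M.b (X' v ω)) volume τ r :=
      (intervalIntegrable_iff_integrableOn_Ioc_of_le h.le).2
        (hI.mono_set (Ioc_subset_Ioc hτ hr.2))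
    have eb1 : ∫ v in (0 : ℝ)..τ, M.b (X' v ω) = ∫ v in (0 : ℝ)..τ, M.b (X v ω) := by
      refine intervalIntegral.integral_congr fun v hv => ?_
      rw [uIcc_of_le hτ] at hv
      simp only [hle v hv.2]
    have eb2 : ∫ v in τ..r, M.b (X' v ω) = ∫ v in τ..r, M.b (Y v ω) := by
      refine intervalIntegral.integral_congr fun v hv => ?_
      rw [uIcc_of_le h.le] at hv
      simp only [hge v hv.1]
    have hgi : IntegrableOn (fun v => M.g (ζ v ω)) (Ioc 0 τ) (pathMeasure fun q => M.L q ω) := by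
      refine (integrableOn_pathMeasure hLm hLc ⟨hτ, hτt.le.trans ht⟩
        (((hζ ω).mono hτt.le).comp_continuous hG)).congr_fun (fun v hv => ?_) measurableSet_Ioc
      exact (hgG _ (hζ0 v ⟨hv.1.le, hv.2.trans hτt.le⟩ ω)).symm
    have eg := setIntegral_pathMeasure_ite hLm hLc hτ h.le (hr.2.trans ht) hgi (M.g (c ω))
    have eite : ∀ v, M.g (if v ≤ τ then ζ v ω else c ω) =
        if v ≤ τ then M.g (ζ v ω) else M.g (c ω) := fun v => apply_ite M.g _ _ _
    rw [hge r h.le, hYe ω, ← intervalIntegral.integral_add_adjacent_intervals hI1 hI2, eb1, eb2]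
    simp only [eite]
    rw [eg, hgG _ (hc0 ω)]
    simp only [η, hω]
    ring

end Model


/-! ### Integrals of left-continuous against right-continuous paths -/

section Products

variable {t T : ℝ} {y z : ℝ → ℝ}

/-- Riemann sums which read the left-continuous factor at the left points of a grid, and the
right-continuous factor at the right points. -/
lemma tendsto_stepSum_mul (hT : 0 < T) (hz : IsCaglad T z) (hy : IsCadlag T y) :
    Tendsto (fun k : ℕ => stepSum 0 T (k + 1) id
      (fun i => z (gridPt 0 T (k + 1) i) * y (gridPt 0 T (k + 1) (i + 1))) T) atTop
      (𝓝 (∫ v in (0 : ℝ)..T, z v * y v)) := by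
  obtain ⟨C, hC0, hC⟩ := hz.exists_bound
  obtain ⟨D, -, hD⟩ := hy.exists_bound
  rw [intervalIntegral.integral_of_le hT.le]
  have e : ∀ k : ℕ, stepSum 0 T (k + 1) id
      (fun i => z (gridPt 0 T (k + 1) i) * y (gridPt 0 T (k + 1) (i + 1))) T =
      ∫ v in Ioc 0 T, z (gridPt 0 T (k + 1) (gridIdx 0 T (k + 1) v)) *
        y (gridPt 0 T (k + 1) (gridIdx 0 T (k + 1) v + 1)) := fun k =>
    (integral_grid_eq_sum hT k.succ_pos
      (fun i => z (gridPt 0 T (k + 1) i) * y (gridPt 0 T (k + 1) (i + 1)))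
      (right_mem_Icc.2 hT.le)).symm
  simp only [e]
  refine tendsto_integral_of_dominated_convergence (fun _ => C * D) (fun k =>
    (measurable_comp_gridIdx fun i =>
      z (gridPt 0 T (k + 1) i) * y (gridPt 0 T (k + 1) (i + 1))).aestronglyMeasurable)
    (integrable_const _) (fun k => Eventually.of_forall fun v => ?_) ?_
  · rw [norm_mul]
    exact mul_le_mul (hC _ (gridPt_idx_mem hT k.succ_pos v))
      (hD _ (gridPt_idx_succ_mem hT k.succ_pos v)) (norm_nonneg _) hC0
  · filter_upwards [ae_restrict_mem measurableSet_Ioc] with v hv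
    exact (hz.tendsto_grid hT hv).mul (hy.tendsto_grid hT hv)

lemma IsCaglad.integrableOn_mul (hz : IsCaglad t z) (hy : IsCadlag t y) :
    IntegrableOn (fun v => z v * y v) (Ioc 0 t) := by
  obtain ⟨C, hC0, hC⟩ := hz.exists_bound
  obtain ⟨D, -, hD⟩ := hy.exists_bound
  refine Integrable.of_bound (hz.aemeasurable.mul hy.aemeasurable).aestronglyMeasurable (C * D) ?_
  filter_upwards [ae_restrict_mem measurableSet_Ioc] with v hv
  rw [norm_mul]
  exact mul_le_mul (hC v ⟨hv.1.le, hv.2⟩) (hD v ⟨hv.1.le, hv.2⟩) (norm_nonneg _) hC0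

lemma isCadlag_const (c : ℝ) : IsCadlag t fun _ => c :=
  ⟨fun _ _ => continuousWithinAt_const, fun _ _ => ⟨c, tendsto_const_nhds⟩⟩

lemma measurable_stepSum_id {Ω : Type*} [MeasurableSpace Ω] {a b : ℝ} {n : ℕ} {h : ℕ → Ω → ℝ}
    (hh : ∀ i, Measurable (h i)) (r : ℝ) :
    Measurable fun ω => stepSum a b n id (fun i => h i ω) r :=
  Finset.measurable_fun_sum _ fun i _ => (hh i).mul_const _

lemma measurable_integral_of_isCaglad {Ω : Type*} [MeasurableSpace Ω] {Z : ℝ → Ω → ℝ}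
    (hT : 0 ≤ T) (hZ : ∀ v ∈ Icc 0 T, Measurable (Z v)) (hZ' : ∀ ω, IsCaglad T fun v => Z v ω) :
    Measurable fun ω => ∫ v in (0 : ℝ)..T, Z v ω := by
  rcases eq_or_lt_of_le hT with rfl | hT
  · simp
  refine measurable_of_tendsto_metrizable (f := fun (k : ℕ) ω => stepSum 0 T (k + 1) id
    (fun i => Z (gridPt 0 T (k + 1) i) ω * 1) T) (fun k => measurable_stepSum_id (fun i =>
      (hZ _ (gridPt_mem hT.le k.succ_pos i)).mul_const 1) T) (tendsto_pi_nhds.2 fun ω => ?_)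
  simpa using tendsto_stepSum_mul hT (hZ' ω) (isCadlag_const 1)

lemma aemeasurable_integral_mul {Ω : Type*} [MeasurableSpace Ω] {P : Measure Ω}
    {Z Y : ℝ → Ω → ℝ} (hT : 0 ≤ T) (hZ : ∀ v ∈ Icc 0 T, Measurable (Z v))
    (hZ' : ∀ ω, IsCaglad T fun v => Z v ω) (hY : ∀ v ∈ Icc 0 T, Measurable (Y v))
    (hY' : ∀ᵐ ω ∂P, IsCadlag T fun v => Y v ω) :
    AEMeasurable (fun ω => ∫ v in (0 : ℝ)..T, Z v ω * Y v ω) P := by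
  rcases eq_or_lt_of_le hT with rfl | hT
  · simp
  refine aemeasurable_of_tendsto_metrizable_ae atTop
    (f := fun (k : ℕ) ω => stepSum 0 T (k + 1) id
      (fun i => Z (gridPt 0 T (k + 1) i) ω * Y (gridPt 0 T (k + 1) (i + 1)) ω) T)
    (fun k => (measurable_stepSum_id (fun i => (hZ _ (gridPt_mem hT.le k.succ_pos i)).mul
      (hY _ (gridPt_mem hT.le k.succ_pos (i + 1)))) T).aemeasurable) ?_
  filter_upwards [hY'] with ω hω using tendsto_stepSum_mul hT (hZ' ω) hω

/-- A càglàd path up to time `τ`, continued by a constant. -/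
lemma IsCaglad.ite_const {τ : ℝ} (hτt : τ ≤ t) (hz : IsCaglad t z) (k : ℝ) :
    IsCaglad t fun r => if r ≤ τ then z r else k := by
  refine ⟨fun r hr => ?_, fun r hr => ?_⟩
  · rcases le_or_gt r τ with h | h
    · exact (hz.1 r hr).congr (fun v hv => if_pos ((le_of_lt hv).trans h)) (if_pos h)
    · refine (continuousWithinAt_const (b := k)).congr_of_eventuallyEq ?_ (if_neg (not_le.2 h))
      filter_upwards [Ioo_mem_nhdsLT h] with v hv using if_neg (not_le.2 hv.1)
  · rcases lt_or_ge r τ with h | h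
    · obtain ⟨l, hl⟩ := hz.2 r ⟨hr.1, h.trans_le hτt⟩
      refine ⟨l, hl.congr' ?_⟩
      filter_upwards [Ioo_mem_nhdsGT h] with v hv using (if_pos hv.2.le).symm
    · refine ⟨k, tendsto_const_nhds.congr' ?_⟩
      filter_upwards [self_mem_nhdsWithin] with v hv
      exact (if_neg (not_le.2 (h.trans_lt hv))).symm

lemma IsCadlag.congr (hy : IsCadlag t y) (h : ∀ r ∈ Icc 0 t, z r = y r) : IsCadlag t z := by
  refine ⟨fun r hr => ?_, fun r hr => ?_⟩
  · refine (hy.1 r hr).congr_of_eventuallyEq ?_ (h r ⟨hr.1, hr.2.le⟩)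
    filter_upwards [Ioo_mem_nhdsGT hr.2] with v hv using h v ⟨hr.1.trans hv.1.le, hv.2.le⟩
  · obtain ⟨l, hl⟩ := hy.2 r hr
    refine ⟨l, hl.congr' ?_⟩
    filter_upwards [Ioo_mem_nhdsLT hr.1] with v hv using (h v ⟨hv.1.le, hv.2.le.trans hr.2⟩).symm

end Products

/-! ### Selling the remaining shares just before the end -/

namespace Model

variable {Ω : Type*} [mΩ : MeasurableSpace Ω] {M : Model Ω} {t φ s : ℝ} {ζ S : ℝ → Ω → ℝ}

/-- The constant rate which sells on `(τ, t]` the shares left at time `τ` by the strategy `ζ`. The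
maximum with `0` only matters on the null set where `ζ` sells more than `φ` shares. -/
noncomputable def liquidationRate (φ τ t : ℝ) (ζ : ℝ → Ω → ℝ) (ω : Ω) : ℝ :=
  max 0 ((φ - ∫ v in (0 : ℝ)..τ, ζ v ω) / (t - τ))

/-- The strategy `ζ` up to time `τ`, followed by the liquidation of the remaining shares. -/
noncomputable def liquidate (φ τ t : ℝ) (ζ : ℝ → Ω → ℝ) (r : ℝ) (ω : Ω) : ℝ :=
  if r ≤ τ then ζ r ω else liquidationRate φ τ t ζ ω

omit mΩ in
lemma liquidate_of_le {τ r : ℝ} (h : r ≤ τ) : liquidate φ τ t ζ r = ζ r :=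
  funext fun _ => if_pos h

omit mΩ in
lemma liquidate_of_lt {τ r : ℝ} (h : τ < r) :
    liquidate φ τ t ζ r = liquidationRate φ τ t ζ :=
  funext fun _ => if_neg (not_le.2 h)

lemma Admissible.measurable_liquidationRate (hζ : M.Admissible t φ ζ) {τ : ℝ} (hτ : 0 ≤ τ)
    (hτt : τ ≤ t) : Measurable[M.filtration τ] (liquidationRate φ τ t ζ) := by
  have h : Measurable[M.filtration τ] fun ω => ∫ v in (0 : ℝ)..τ, ζ v ω :=
    @measurable_integral_of_isCaglad τ Ω (M.filtration τ) ζ hτ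
      (fun v hv => (hζ.adapted v ⟨hv.1, hv.2.trans hτt⟩).mono (M.filtration_mono hv.2) le_rfl)
      (fun ω => (hζ.caglad ω).mono hτt)
  exact measurable_const.max ((measurable_const.sub h).div_const _)

theorem Admissible.liquidate (hζ : M.Admissible t φ ζ) {τ : ℝ} (hτ : 0 ≤ τ) (hτt : τ < t) :
    M.AdmissibleSellOff t φ (liquidate φ τ t ζ) := by
  have hcag : ∀ ω, IsCaglad t fun r => Model.liquidate φ τ t ζ r ω := fun ω =>
    (hζ.caglad ω).ite_const hτt.le _
  have hint : ∀ ω, IntervalIntegrable (fun r => ζ r ω) volume 0 τ := fun ω =>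
    (intervalIntegrable_iff_integrableOn_Ioc_of_le hτ).2
      ((hζ.caglad ω).integrableOn.mono_set (Ioc_subset_Ioc_right hτt.le))
  have hint' : ∀ ω, IntervalIntegrable (fun r => ζ r ω) volume τ t := fun ω =>
    (intervalIntegrable_iff_integrableOn_Ioc_of_le hτt.le).2
      ((hζ.caglad ω).integrableOn.mono_set (Ioc_subset_Ioc_left hτ))
  have hd : 0 < t - τ := sub_pos.2 hτt
  have htot : ∀ᵐ ω ∂M.P, ∫ r in (0 : ℝ)..t, Model.liquidate φ τ t ζ r ω = φ := by
    filter_upwards [hζ.total_le] with ω hω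
    have hle : ∫ v in (0 : ℝ)..τ, ζ v ω ≤ φ := by
      refine le_trans ?_ hω
      rw [← intervalIntegral.integral_add_adjacent_intervals (hint ω) (hint' ω)]
      exact le_add_of_nonneg_right (intervalIntegral.integral_nonneg hτt.le fun v hv =>
        hζ.nonneg v ⟨hτ.trans hv.1, hv.2⟩ ω)
    have hI := (hcag ω).integrableOn
    rw [← intervalIntegral.integral_add_adjacent_intervals (b := τ)
      ((intervalIntegrable_iff_integrableOn_Ioc_of_le hτ).2
        (hI.mono_set (Ioc_subset_Ioc_right hτt.le)))
      ((intervalIntegrable_iff_integrableOn_Ioc_of_le hτt.le).2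
        (hI.mono_set (Ioc_subset_Ioc_left hτ)))]
    have e1 : ∫ v in (0 : ℝ)..τ, Model.liquidate φ τ t ζ v ω = ∫ v in (0 : ℝ)..τ, ζ v ω := by
      refine intervalIntegral.integral_congr fun v hv => ?_
      rw [uIcc_of_le hτ] at hv
      exact if_pos hv.2
    have e2 : ∫ v in τ..t, Model.liquidate φ τ t ζ v ω = φ - ∫ v in (0 : ℝ)..τ, ζ v ω := by
      rw [intervalIntegral.integral_of_le hτt.le, setIntegral_congr_fun
        (f := fun v => Model.liquidate φ τ t ζ v ω) (g := fun _ => liquidationRate φ τ t ζ ω)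
        measurableSet_Ioc (fun v hv => congrFun (liquidate_of_lt hv.1) ω),
        ← intervalIntegral.integral_of_le hτt.le, intervalIntegral.integral_const, smul_eq_mul,
        liquidationRate, max_eq_right (div_nonneg (sub_nonneg.2 hle) hd.le),
        mul_div_cancel₀ _ hd.ne']
    rw [e1, e2, add_sub_cancel]
  obtain ⟨C, hC⟩ := hζ.bounded
  refine ⟨⟨fun r hr => ?_, hcag, fun r hr ω => ?_, ⟨max C (max 0 (φ / (t - τ))), fun r hr ω => ?_⟩,
    htot.mono fun ω hω => hω.le⟩, htot⟩
  · rcases le_or_gt r τ with h | h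
    · rw [liquidate_of_le h]; exact hζ.adapted r hr
    · rw [liquidate_of_lt h]
      exact (hζ.measurable_liquidationRate hτ hτt.le).mono (M.filtration_mono h.le) le_rfl
  · unfold Model.liquidate
    split_ifs
    · exact hζ.nonneg r hr ω
    · exact le_max_left _ _
  · unfold Model.liquidate
    split_ifs
    · exact (hC r hr ω).trans (le_max_left _ _)
    · refine le_trans (max_le_max le_rfl ?_) (le_max_right _ _)
      refine div_le_div_of_nonneg_right (sub_le_self _ ?_) hd.le
      exact intervalIntegral.integral_nonneg hτ fun v hv =>
        hζ.nonneg v ⟨hv.1, hv.2.trans hτt.le⟩ ω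

lemma IsPrice.nonneg (hS : M.IsPrice t s ζ S) {r : ℝ} (hr : r ∈ Icc 0 t) (ω : Ω) : 0 ≤ S r ω := by
  rcases hS with ⟨-, X, -, h⟩ | ⟨-, h⟩
  · rw [h r hr]; exact (Real.exp_pos _).le
  · rw [h r hr]

lemma IsPrice.measurable (hS : M.IsPrice t s ζ S) (ht : t ≤ 1) {r : ℝ} (hr : r ∈ Icc 0 t) :
    Measurable (S r) := by
  rcases hS with ⟨-, X, hX, h⟩ | ⟨-, h⟩
  · rw [show S r = fun ω => Real.exp (X r ω) from funext (h r hr)]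
    exact ((hX.adapted r hr).mono (M.filtration_le (hr.2.trans ht)) le_rfl).exp
  · rw [show S r = fun _ => 0 from funext (h r hr)]
    exact measurable_const

lemma IsPrice.cadlag (hS : M.IsPrice t s ζ S) : ∀ᵐ ω ∂M.P, IsCadlag t fun r => S r ω := by
  rcases hS with ⟨-, X, hX, h⟩ | ⟨-, h⟩
  · filter_upwards [hX.cadlag] with ω hω
    exact (hω.comp_continuous Real.continuous_exp).congr fun r hr => h r hr ω
  · exact Eventually.of_forall fun ω => (isCadlag_const 0).congr fun r hr => h r hr ω

/-- The price can be continued after the change of the strategy. -/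
lemma IsPrice.exists_liquidate (hS : M.IsPrice t s ζ S) (hζ : M.Admissible t φ ζ) {τ κ : ℝ}
    (hτ : 0 ≤ τ) (hτt : τ < t) (ht : t ≤ 1) (hκ : M.IsCoefficientBound κ)
    (hsmall : 256 * κ ^ 2 * (t - τ) ≤ 1) :
    ∃ S' : ℝ → Ω → ℝ, M.IsPrice t s (liquidate φ τ t ζ) S' ∧
      ∀ r ∈ Icc 0 τ, ∀ ω, S' r ω = S r ω := by
  rcases hS with ⟨hs, X, hX, h⟩ | ⟨hs, h⟩
  · obtain ⟨X', hX', hXX'⟩ := exists_logPrice_ite hτ hτt ht hκ hsmall hX hζ.caglad hζ.nonneg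
      (hζ.measurable_liquidationRate hτ hτt.le) (fun ω => le_max_left _ _)
    refine ⟨fun r ω => Real.exp (X' r ω), Or.inl ⟨hs, X', hX', fun r _ ω => rfl⟩,
      fun r hr ω => ?_⟩
    simp only [h r ⟨hr.1, hr.2.trans hτt.le⟩, hXX' r hr.2]
  · exact ⟨S, Or.inr ⟨hs, h⟩, fun r _ ω => rfl⟩

end Model


/-! ### Expectations as extended real numbers -/

section Expectation

variable {Ω : Type*} [MeasurableSpace Ω] {P : Measure Ω}

lemma expectation_mono {Y Z : Ω → ℝ} (h : ∀ᵐ ω ∂P, Y ω ≤ Z ω) :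
    expectation P Y ≤ expectation P Z := by
  refine EReal.sub_le_sub (EReal.coe_ennreal_le_coe_ennreal_iff.2 (lintegral_mono_ae ?_))
    (EReal.coe_ennreal_le_coe_ennreal_iff.2 (lintegral_mono_ae ?_))
  · filter_upwards [h] with ω hω using ENNReal.ofReal_le_ofReal hω
  · filter_upwards [h] with ω hω using ENNReal.ofReal_le_ofReal (neg_le_neg hω)

/-- Monotone convergence of expectations, for random variables bounded below. -/
lemma tendsto_expectation [IsFiniteMeasure P] {Y : ℕ → Ω → ℝ} {Z : Ω → ℝ}
    (hY : ∀ n, AEMeasurable (Y n) P) (hmono : ∀ᵐ ω ∂P, Monotone fun n => Y n ω)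
    (hlim : ∀ᵐ ω ∂P, Tendsto (fun n => Y n ω) atTop (𝓝 (Z ω))) {c : ℝ}
    (hc : ∀ᵐ ω ∂P, c ≤ Y 0 ω) :
    Tendsto (fun n => expectation P (Y n)) atTop (𝓝 (expectation P Z)) := by
  have h1 := lintegral_tendsto_of_tendsto_of_monotone (μ := P)
    (f := fun n ω => ENNReal.ofReal (Y n ω)) (F := fun ω => ENNReal.ofReal (Z ω))
    (fun n => (hY n).ennreal_ofReal)
    (hmono.mono fun ω hω i j hij => ENNReal.ofReal_le_ofReal (hω hij))
    (hlim.mono fun ω hω => ENNReal.tendsto_ofReal hω)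
  have hfin : ∀ {V : Ω → ℝ}, (∀ᵐ ω ∂P, c ≤ V ω) → ∫⁻ ω, ENNReal.ofReal (-V ω) ∂P ≠ ∞ := by
    intro V hV
    refine ((lintegral_mono_ae (g := fun _ => ENNReal.ofReal (-c)) (hV.mono fun ω hω =>
      ENNReal.ofReal_le_ofReal (neg_le_neg hω))).trans_lt ?_).ne
    rw [lintegral_const]
    exact ENNReal.mul_lt_top ENNReal.ofReal_lt_top (measure_lt_top P univ)
  have h2 := lintegral_tendsto_of_tendsto_of_antitone (μ := P)
    (f := fun n ω => ENNReal.ofReal (-Y n ω)) (F := fun ω => ENNReal.ofReal (-Z ω))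
    (fun n => (hY n).neg.ennreal_ofReal)
    (hmono.mono fun ω hω i j hij => ENNReal.ofReal_le_ofReal (neg_le_neg (hω hij)))
    (hfin hc) (hlim.mono fun ω hω => ENNReal.tendsto_ofReal hω.neg)
  have hZ : ∀ᵐ ω ∂P, c ≤ Z ω := by
    filter_upwards [hc, hmono, hlim] with ω h h' h''
    exact h.trans (h'.ge_of_tendsto h'' 0)
  have hne : -((∫⁻ ω, ENNReal.ofReal (-Z ω) ∂P : ℝ≥0∞) : EReal) ≠ ⊥ := by
    rw [Ne, EReal.neg_eq_bot_iff, EReal.coe_ennreal_eq_top_iff]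
    exact hfin hZ
  exact (EReal.continuousAt_add (Or.inr hne) (Or.inl (EReal.coe_ennreal_ne_bot _))).tendsto.comp
    (((continuous_coe_ennreal_ereal.tendsto _).comp h1).prodMk_nhds
      ((continuous_neg.tendsto _).comp ((continuous_coe_ennreal_ereal.tendsto _).comp h2)))

end Expectation

/-! ### Comparison of the two value functions -/

namespace Model

variable {Ω : Type*} [mΩ : MeasurableSpace Ω] {M : Model Ω} {U : ℝ → ℝ} {t w φ s : ℝ}

lemma sellOffValue_le_value :
    M.sellOffValue t w φ s U ≤ M.value t w φ s (fun w' _ _ => U w') := by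
  refine sSup_le_sSup ?_
  rintro y ⟨ζ, W, Φ, S, hζ, hW, rfl⟩
  exact ⟨ζ, W, Φ, S, hζ.toAdmissible, hW, rfl⟩

/-- Stopping just before the end, and selling the remaining shares afterwards, gives at least the
cash collected by the original strategy up to the stopping time. -/
lemma expectation_le_sellOffValue (hU : Monotone U) {ζ S : ℝ → Ω → ℝ} (ht : t ≤ 1)
    (hζ : M.Admissible t φ ζ) (hS : M.IsPrice t s ζ S) {τ κ : ℝ} (hτ : 0 ≤ τ) (hτt : τ < t)
    (hκ : M.IsCoefficientBound κ) (hsmall : 256 * κ ^ 2 * (t - τ) ≤ 1) :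
    expectation M.P (fun ω => U (w + ∫ v in (0 : ℝ)..τ, ζ v ω * S v ω)) ≤
      M.sellOffValue t w φ s U := by
  obtain ⟨S', hS', hSS'⟩ := hS.exists_liquidate hζ hτ hτt ht hκ hsmall
  have hζ' := hζ.liquidate hτ hτt
  refine le_trans (expectation_mono ?_) (le_sSup ⟨liquidate φ τ t ζ,
    fun r ω => w + ∫ v in (0 : ℝ)..r, liquidate φ τ t ζ v ω * S' v ω,
    fun r ω => φ - ∫ v in (0 : ℝ)..r, liquidate φ τ t ζ v ω, S', hζ',
    ⟨fun _ _ => Eventually.of_forall fun _ => rfl, fun _ _ => Eventually.of_forall fun _ => rfl,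
      hS'⟩, rfl⟩)
  filter_upwards [hS'.cadlag] with ω hω
  refine hU (add_le_add le_rfl ?_)
  have hI := (hζ'.caglad ω).integrableOn_mul hω
  rw [← intervalIntegral.integral_add_adjacent_intervals (b := τ)
    ((intervalIntegrable_iff_integrableOn_Ioc_of_le hτ).2
      (hI.mono_set (Ioc_subset_Ioc_right hτt.le)))
    ((intervalIntegrable_iff_integrableOn_Ioc_of_le hτt.le).2
      (hI.mono_set (Ioc_subset_Ioc_left hτ)))]
  have e : ∫ v in (0 : ℝ)..τ, ζ v ω * S v ω =
      ∫ v in (0 : ℝ)..τ, liquidate φ τ t ζ v ω * S' v ω := by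
    refine intervalIntegral.integral_congr fun v hv => ?_
    rw [uIcc_of_le hτ] at hv
    simp only [liquidate_of_le hv.2, hSS' v hv]
  rw [e]
  refine le_add_of_nonneg_right (intervalIntegral.integral_nonneg hτt.le fun v hv => ?_)
  have hv' : v ∈ Icc 0 t := ⟨hτ.trans hv.1, hv.2⟩
  exact mul_nonneg (hζ'.nonneg v hv' ω) (hS'.nonneg hv' ω)

lemma value_le_sellOffValue (hU_cont : Continuous U) (hU : Monotone U) (ht0 : 0 < t)
    (ht : t ≤ 1) : M.value t w φ s (fun w' _ _ => U w') ≤ M.sellOffValue t w φ s U := by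
  refine sSup_le ?_
  rintro y ⟨ζ, W, Φ, S, hζ, hW, rfl⟩
  have hS := hW.price
  obtain ⟨κ, hκ⟩ := M.exists_coefficientBound
  have hκ0 := hκ.pos
  -- The liquidation periods `(τ n, t]` shrink to the final time and are short enough throughout.
  let δ : ℝ := min t (1 / (256 * κ ^ 2))
  have hδ0 : 0 < δ := lt_min ht0 (by positivity)
  let τ : ℕ → ℝ := fun n => t - δ / (n + 1)
  have hτle : ∀ n : ℕ, 0 < δ / (n + 1) ∧ δ / (n + 1) ≤ δ := fun n =>
    ⟨by positivity, div_le_self hδ0.le (by simp)⟩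
  have hτ0 : ∀ n, 0 ≤ τ n := fun n => sub_nonneg.2 ((hτle n).2.trans (min_le_left _ _))
  have hτt : ∀ n, τ n < t := fun n => sub_lt_self _ (hτle n).1
  have hsmall : ∀ n, 256 * κ ^ 2 * (t - τ n) ≤ 1 := by
    intro n
    have h1 : t - τ n ≤ 1 / (256 * κ ^ 2) := by
      simpa [τ] using (hτle n).2.trans (min_le_right _ _)
    rwa [le_div_iff₀ (by positivity), mul_comm] at h1
  have hτmono : Monotone τ := by
    intro i j hij
    have : (i : ℝ) ≤ j := Nat.cast_le.2 hij
    exact sub_le_sub_left (div_le_div_of_nonneg_left hδ0.le (by positivity) (by linarith)) _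
  have hτlim : Tendsto τ atTop (𝓝 t) := by
    have : Tendsto (fun n : ℕ => δ / ((n : ℝ) + 1)) atTop (𝓝 0) :=
      tendsto_const_nhds.div_atTop (tendsto_atTop_add_const_right _ _ tendsto_natCast_atTop_atTop)
    simpa using this.const_sub t
  have hnn : ∀ v ∈ Icc 0 t, ∀ ω, 0 ≤ ζ v ω * S v ω := fun v hv ω =>
    mul_nonneg (hζ.nonneg v hv ω) (hS.nonneg hv ω)
  have hI : ∀ᵐ ω ∂M.P, IntervalIntegrable (fun v => ζ v ω * S v ω) volume 0 t := by
    filter_upwards [hS.cadlag] with ω hω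
    exact (intervalIntegrable_iff_integrableOn_Ioc_of_le ht0.le).2
      ((hζ.caglad ω).integrableOn_mul hω)
  have hlim : Tendsto (fun n => expectation M.P
      (fun ω => U (w + ∫ v in (0 : ℝ)..τ n, ζ v ω * S v ω))) atTop
      (𝓝 (expectation M.P (fun ω => U (W t ω)))) := by
    refine tendsto_expectation (c := U w) (fun n => ?_) ?_ ?_ ?_
    · refine hU_cont.measurable.comp_aemeasurable (AEMeasurable.const_add
        (aemeasurable_integral_mul (hτ0 n) (fun v hv => ?_) (fun ω => (hζ.caglad ω).mono (hτt n).le)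
        (fun v hv => hS.measurable ht ⟨hv.1, hv.2.trans (hτt n).le⟩) ?_) w)
      · exact (hζ.adapted v ⟨hv.1, hv.2.trans (hτt n).le⟩).mono
          (M.filtration_le (hv.2.trans ((hτt n).le.trans ht))) le_rfl
      · filter_upwards [hS.cadlag] with ω hω using hω.mono (hτt n).le
    · filter_upwards [hI] with ω hω i j hij
      refine hU (add_le_add le_rfl ?_)
      refine intervalIntegral.integral_mono_interval le_rfl (hτ0 i) (hτmono hij) ?_
        (hω.mono_set ?_)
      · filter_upwards [ae_restrict_mem measurableSet_Ioc] with v hv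
        exact hnn v ⟨hv.1.le, hv.2.trans (hτt j).le⟩ ω
      · rw [uIcc_of_le (hτ0 j), uIcc_of_le ht0.le]
        exact Icc_subset_Icc_right (hτt j).le
    · filter_upwards [hI, hW.cash t (right_mem_Icc.2 ht0.le)] with ω hω hWω
      rw [hWω]
      refine (hU_cont.tendsto _).comp (tendsto_const_nhds.add ?_)
      have hc := intervalIntegral.continuousOn_primitive_interval' hω left_mem_uIcc
      rw [uIcc_of_le ht0.le] at hc
      exact (hc t (right_mem_Icc.2 ht0.le)).tendsto.comp (tendsto_nhdsWithin_iff.2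
        ⟨hτlim, Eventually.of_forall fun n => ⟨hτ0 n, (hτt n).le⟩⟩)
    · refine Eventually.of_forall fun ω => hU (le_add_of_nonneg_right ?_)
      exact intervalIntegral.integral_nonneg (hτ0 0) fun v hv =>
        hnn v ⟨hv.1, hv.2.trans (hτt 0).le⟩ ω
  exact le_of_tendsto' hlim fun n =>
    expectation_le_sellOffValue hU ht hζ hS (hτ0 n) (hτt n) hκ (hsmall n)

end Model

end OptimalExecution

theorem mainTheorem6 {Ω : Type*} [MeasurableSpace Ω] (M : OptimalExecution.Model Ω)
    (U : ℝ → ℝ) (hU_cont : Continuous U) (hU_mono : Monotone U)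
    (hU_growth : ∃ C m : ℝ, 0 < C ∧ 0 < m ∧ ∀ w, |U w| ≤ C * (1 + |w| ^ m))
    (t : ℝ) (ht0 : 0 ≤ t) (ht1 : t ≤ 1) (w φ s : ℝ) (hφ : 0 ≤ φ) (hs : 0 ≤ s)
    (hne : t = 0 → φ = 0) :
    M.sellOffValue t w φ s U = M.value t w φ s (fun w' _ _ => U w') := by
  refine le_antisymm OptimalExecution.Model.sellOffValue_le_value ?_
  rcases eq_or_lt_of_le ht0 with h | h
  -- For `t = 0` there is nothing to sell, and every admissible strategy sells exactly that.
  · refine sSup_le_sSup ?_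
    rintro y ⟨ζ, W, Φ, S, hζ, hW, rfl⟩
    refine ⟨ζ, W, Φ, S, ⟨hζ, Eventually.of_forall fun ω => ?_⟩, hW, rfl⟩
    rw [← h, intervalIntegral.integral_same, hne h.symm]
  · exact OptimalExecution.Model.value_le_sellOffValue hU_cont hU_mono h ht1
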